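/- Setting. Let $\alpha>0$. For a measure space $(S,\mu)$, let $L^\alpha_+(S,\mu)$ be the set of measurable $f:S\to[0,\infty)$ with $\|f\|^\alpha:=\int_S f^\alpha\,d\mu<\infty$, with the metric $\rho(f,g)=\int_S|f^\alpha-g^\alpha|\,d\mu$; elements are identified modulo $\mu$-null sets. An $\alpha$-Fréchet random sup-measure $M$ with control measure $\mu$ assigns independent random variables to finitely many disjoint measurable sets, satisfies $\mathbb P(M(A)\le x)=\exp(-\mu(A)x^{-\alpha})$ for $x>0$, and $M(\bigcup_i A_i)=\bigvee_i M(A_i)$ a.s. for every sequence of disjoint measurable sets. The extremal integral of a simple function $\sum_i a_i\mathbf 1_{A_i}$ ($A_i$ disjoint, $a_i\ge 0$) is $\bigvee_i a_iM(A_i)$; it extends to $L^\alpha_+(S,\mu)$ by continuity in probability. A family $(f_t)_{t\in T}\subset L^\alpha_+(S,\mu)$ is a spectral representation of a process $X=(X_t)_{t\in T}$ if $X$ has the same finite-dimensional distributions as the process of extremal integrals of the $f_t$ (such an $X$ is an $\alpha$-Fréchet process). It is minimal if (a) its closed max-linear span (the $\rho$-closure of the set of finite maxima $\bigvee_{i=1}^n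 a_if_{t_i}$, $n\ge1$, $a_i>0$) contains a function that is nonzero $\mu$-a.e., and (b) every measurable set of $S$ agrees modulo $\mu$ with a set of the $\sigma$-field generated by the $[0,\infty]$-valued ratios $f_t/f_u$, $t,u\in T$. A max-linear isometry is a map $U$ with $U(af\vee bg)=aUf\vee bUg$ a.e. for all $a,b\ge0$ and $\|Uf\|=\|f\|$. For $I\in\{0,1\}$ and $N\in\{0,1,2,\dots,\infty\}$ let $S_{I,N}\subset(0,1)\cup\{1,2,\dots\}$ be the union of $(0,1)$ (if $I=1$; of $\emptyset$ if $I=0$) and $S_N:=\{n\in\{1,2,\dots\}:n\le N\}$, and let $\lambda_{I,N}$ be Lebesgue measure on the first part and counting measure on the second. A minimal representation has standardized support if its measure space is some $(S_{I,N},\lambda_{I,N})$. Statement. Let $(f^{(i)}_t)_{t\in T}\subset L^\alpha_+(S_{I_i,N_i},\lambda_{I_i,N_i})$, $i=1,2$, be two minimal representations with standardized support of the same $\alpha$-Fréchet process $X$. Then $I_1=I_2=:I$ and $N_1=N_2=:N$. Moreover, there is a max-linear isometry $U$ from $L^\alpha_+(S_{I_1,N_1},\lambda_{I_1,N_1})$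 onto $L^\alpha_+(S_{I_2,N_2},\lambda_{I_2,N_2})$ with $Uf^{(1)}_t=f^{(2)}_t$ a.e. for all $t\in T$. It is the only such max-linear isometry of $L^\alpha_+(S_{I_1,N_1},\lambda_{I_1,N_1})$ into $L^\alpha_+(S_{I_2,N_2},\lambda_{I_2,N_2})$, and its restriction to the closed max-linear span of $(f^{(1)}_t)$ is the only max-linear isometry of that span with this property. There are measurable functions $\Phi:S_{I_2,N_2}\to S_{I_1,N_1}$, one-to-one and onto, and $h:S_{I_2,N_2}\to(0,\infty)$ such that $$f^{(2)}_t=h\cdot(f^{(1)}_t\circ\Phi)\quad\lambda_{I_2,N_2}\text{-a.e. for every }t\in T,\qquad \frac{d(\lambda_{I_1,N_1}\circ\Phi)}{d\lambda_{I_2,N_2}}=h^\alpha\quad\lambda_{I_2,N_2}\text{-a.e.},$$ where $\lambda_{I_1,N_1}\circ\Phi$ is the measure $A\mapsto\lambda_{I_1,N_1}(\Phi(A))$, absolutely continuous with respect to $\lambda_{I_2,N_2}$. The pair $(\Phi,h)$ with these properties is unique modulo $\lambda_{I_2,N_2}$, and $Uf=h\cdot(f\circ\Phi)$ a.e. for all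 $f\in L^\alpha_+(S_{I_1,N_1},\lambda_{I_1,N_1})$. Furthermore, extending functions on $(0,1)$ and on $S_N$ by zero to $S_{I,N}$: (i) if $I=1$, then $\Phi$ restricts to a bimeasurable bijection $\Phi_I$ of $(0,1)$ and, with $\lambda$ the Lebesgue measure on $(0,1)$, $\lambda\circ\Phi_I\ll\lambda$ and for all $f\in L^\alpha_+((0,1),\lambda)$, $$Uf=\Big(\frac{d(\lambda\circ\Phi_I)}{d\lambda}\Big)^{1/\alpha}(f\circ\Phi_I)\quad\text{a.e.};$$ (ii) if $N\ne0$, then $\Phi$ restricts to a permutation $\Phi_N$ of $S_N$ and $Uf=f\circ\Phi_N$ for all $f\in L^\alpha_+(S_N,\text{counting measure})$. -/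

import Mathlib

open MeasureTheory ProbabilityTheory Filter Topology Set
open scoped ENNReal NNReal

noncomputable section

namespace MaxStable

/-! ### Random sup-measures and extremal integrals -/

section ExtremalIntegral

variable {S Ω Ω' T : Type*} [MeasurableSpace S] [MeasurableSpace Ω] [MeasurableSpace Ω']

/-- `Z` has the `α`-Fréchet distribution with scale coefficient `σ`:
`P (Z ≤ x) = exp (- σ ^ α * x ^ (-α))` for `0 < x < ∞`. The degenerate scales `0` (where `Z = 0` a.s.)
and `∞` (where `Z = ∞` a.s.) are allowed, as a control measure takes these values. -/
def IsFrechet (α : ℝ) (P : Measure Ω) (σ : ℝ≥0∞) (Z : Ω → ℝ≥0∞) : Prop :=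
  ∀ x : ℝ≥0, 0 < x →
    P {ω | Z ω ≤ x} = EReal.exp (-((σ ^ α * (x : ℝ≥0∞) ^ (-α) : ℝ≥0∞) : EReal))

/-- `M` is an `α`-Fréchet random sup-measure on `S` with control measure `μ`
(only its values at measurable sets matter). -/
structure IsFrechetSupMeasure (α : ℝ) (μ : Measure S) (P : Measure Ω)
    (M : Set S → Ω → ℝ≥0∞) : Prop where
  measurable : ∀ A, MeasurableSet A → Measurable (M A)
  indep : ∀ (n : ℕ) (A : Fin n → Set S), (∀ i, MeasurableSet (A i)) →
    Pairwise (Function.onFun Disjoint A) → iIndepFun (fun i => M (A i)) P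
  frechet : ∀ A, MeasurableSet A → IsFrechet α P (μ A ^ (1 / α)) (M A)
  iUnion : ∀ A : ℕ → Set S, (∀ i, MeasurableSet (A i)) →
    Pairwise (Function.onFun Disjoint A) →
    ∀ᵐ ω ∂P, M (⋃ i, A i) ω = ⨆ i, M (A i) ω

/-- The space of integrands `L₊^α(S, μ)`: measurable `f : S → [0, ∞)` with `∫ f ^ α dμ < ∞`.
Its elements are functions; identification modulo `μ`-null sets is always made explicit. -/
def LPlus (α : ℝ) (μ : Measure S) : Set (S → ℝ≥0) :=
  {f | Measurable f ∧ ∫⁻ s, (f s : ℝ≥0∞) ^ α ∂μ < ∞}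

/-- `‖f‖ = (∫ f ^ α dμ) ^ (1 / α)`. -/
def lNorm (α : ℝ) (μ : Measure S) (f : S → ℝ≥0) : ℝ≥0∞ :=
  (∫⁻ s, (f s : ℝ≥0∞) ^ α ∂μ) ^ (1 / α)

/-- The metric `ρ(f, g) = ∫ |f ^ α - g ^ α| dμ`. -/
def rho (α : ℝ) (μ : Measure S) (f g : S → ℝ≥0) : ℝ≥0∞ :=
  ∫⁻ s, ENNReal.ofReal |(f s : ℝ) ^ α - (g s : ℝ) ^ α| ∂μ

/-- The extremal integral `⋁ a_i M(A_i)` of a simple function `∑ a_i 1_{A_i}`, with `a_i` its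
values and `A_i` the (disjoint) level sets. -/
def simpleIntegral (M : Set S → Ω → ℝ≥0∞) (φ : SimpleFunc S ℝ≥0) (ω : Ω) : ℝ≥0∞ :=
  φ.range.sup fun a => (a : ℝ≥0∞) * M (φ ⁻¹' {a}) ω

/-- `ξ` is (a version of) the extremal integral of `f` with respect to `M`, i.e. the limit in
probability of the extremal integrals of simple functions that tend to `f` in the metric `ρ`. -/
def IsExtremalIntegral (α : ℝ) (μ : Measure S) (P : Measure Ω) (M : Set S → Ω → ℝ≥0∞)
    (f : S → ℝ≥0) (ξ : Ω → ℝ≥0) : Prop :=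
  ∃ φ : ℕ → SimpleFunc S ℝ≥0,
    (∀ n, ⇑(φ n) ∈ LPlus α μ) ∧
    Tendsto (fun n => rho α μ (φ n) f) atTop (𝓝 0) ∧
    TendstoInMeasure P (fun n => simpleIntegral M (φ n)) atTop (fun ω => (ξ ω : ℝ≥0∞))

/-- The process `X`, on a probability space with measure `P`, has the spectral representation
`(f_t)` over `L₊^α(S, μ)`: it has the finite-dimensional distributions of the process of extremal
integrals of the `f_t` with respect to `M`. The process `X` is then `α`-Fréchet. -/
def IsSpectralRepresentation (α : ℝ) (P : Measure Ω) (X : T → Ω → ℝ)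
    (μ : Measure S) (P' : Measure Ω') (M : Set S → Ω' → ℝ≥0∞) (f : T → S → ℝ≥0) : Prop :=
  (∀ t, f t ∈ LPlus α μ) ∧
  ∃ ξ : T → Ω' → ℝ≥0,
    (∀ t, IsExtremalIntegral α μ P' M (f t) (ξ t)) ∧
    ∀ J : Finset T,
      IdentDistrib (fun ω (t : J) => X t ω) (fun ω (t : J) => (ξ t ω : ℝ)) P P'

end ExtremalIntegral

/-! ### Max-linear spaces and minimal representations -/

section Minimal

variable {S S₁ S₂ T : Type*} [MeasurableSpace S] [MeasurableSpace S₁] [MeasurableSpace S₂]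

/-- The max-linear combinations `⋁_{1 ≤ i ≤ n} a_i f_{t_i}` with `n ≥ 1` and `a_i > 0`. -/
def maxSpan (f : T → S → ℝ≥0) : Set (S → ℝ≥0) :=
  {g | ∃ (n : ℕ) (a : Fin n → ℝ≥0) (t : Fin n → T), 0 < n ∧ (∀ i, 0 < a i) ∧
    g = fun s => Finset.univ.sup fun i => a i * f (t i) s}

/-- The closed max-linear span of `(f_t)`: the closure of `maxSpan f` in `L₊^α(S, μ)` with respect
to the metric `ρ`. -/
def closedMaxSpan (α : ℝ) (μ : Measure S) (f : T → S → ℝ≥0) : Set (S → ℝ≥0) :=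
  {g | g ∈ LPlus α μ ∧ ∀ ε : ℝ≥0∞, 0 < ε → ∃ m ∈ maxSpan f, rho α μ m g < ε}

/-- `f₀` has full support with respect to the collection `F`. -/
def HasFullSupport (μ : Measure S) (F : Set (S → ℝ≥0)) (f₀ : S → ℝ≥0) : Prop :=
  ∀ g ∈ F, μ (Function.support g \ Function.support f₀) = 0

/-- The ratio `σ`-field, generated by the ratios `f_t / f_u` with values in `[0, ∞]`
(here `0 / 0 = 0`). -/
abbrev ratioField (f : T → S → ℝ≥0) : MeasurableSpace S :=
  ⨆ (t : T) (u : T),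
    MeasurableSpace.comap (fun s => (f t s : ℝ≥0∞) / (f u s : ℝ≥0∞)) inferInstance

/-- Minimality of a spectral representation `(f_t)` over `L₊^α(S, μ)`: the support of `(f_t)`, that
is, of a function of full support in the closed max-linear span, is `S` modulo `μ`, and every
measurable set agrees modulo `μ` with a set of the ratio `σ`-field. -/
structure IsMinimal (α : ℝ) (μ : Measure S) (f : T → S → ℝ≥0) : Prop where
  support : ∃ f₀ ∈ closedMaxSpan α μ f,
    HasFullSupport μ (closedMaxSpan α μ f) f₀ ∧ μ (Function.support f₀)ᶜ = 0
  ratio : ∀ B, MeasurableSet B → ∃ A, MeasurableSet[ratioField f] A ∧ μ (symmDiff A B) = 0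

/-- `U` is a max-linear isometry from `F ⊆ L₊^α(S₁, μ₁)` to `L₊^α(S₂, μ₂)` (its values outside `F`
are irrelevant). -/
structure IsMaxLinearIsometryOn (α : ℝ) (μ₁ : Measure S₁) (μ₂ : Measure S₂)
    (F : Set (S₁ → ℝ≥0)) (U : (S₁ → ℝ≥0) → (S₂ → ℝ≥0)) : Prop where
  mapsTo : ∀ f ∈ F, U f ∈ LPlus α μ₂
  maxLinear : ∀ f ∈ F, ∀ g ∈ F, ∀ a b : ℝ≥0,
    U (fun s => max (a * f s) (b * g s)) =ᵐ[μ₂] fun s => max (a * U f s) (b * U g s)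
  norm_eq : ∀ f ∈ F, lNorm α μ₂ (U f) = lNorm α μ₁ f

/-- `U` is a max-linear isometry on `F` with `U f_t⁽¹⁾ = f_t⁽²⁾` for all `t`. -/
def IsRelatingIsometryOn (α : ℝ) (μ₁ : Measure S₁) (μ₂ : Measure S₂)
    (f₁ : T → S₁ → ℝ≥0) (f₂ : T → S₂ → ℝ≥0)
    (F : Set (S₁ → ℝ≥0)) (U : (S₁ → ℝ≥0) → (S₂ → ℝ≥0)) : Prop :=
  IsMaxLinearIsometryOn α μ₁ μ₂ F U ∧ ∀ t, U (f₁ t) =ᵐ[μ₂] f₂ t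

/-- The pair `(Φ, h)` relates `(f_t⁽¹⁾)` and `(f_t⁽²⁾)` pointwise: `Φ` is measurable, one-to-one and
onto, `h` is measurable and positive, `f_t⁽²⁾ = h · (f_t⁽¹⁾ ∘ Φ)` a.e. for all `t`, and
`d(μ₁ ∘ Φ) / dμ₂ = h ^ α`, where `μ₁ ∘ Φ`, in Mathlib `μ₁.comap Φ`, is the measure
`A ↦ μ₁ (Φ '' A)`. -/
structure IsPointMapRelation (α : ℝ) (μ₁ : Measure S₁) (μ₂ : Measure S₂)
    (f₁ : T → S₁ → ℝ≥0) (f₂ : T → S₂ → ℝ≥0) (Φ : S₂ → S₁) (h : S₂ → ℝ≥0) : Prop where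
  measurable_map : Measurable Φ
  bijective : Function.Bijective Φ
  measurable_weight : Measurable h
  weight_pos : ∀ s, 0 < h s
  relates : ∀ t, f₂ t =ᵐ[μ₂] fun s => h s * f₁ t (Φ s)
  absolutelyContinuous : μ₁.comap Φ ≪ μ₂
  rnDeriv_eq : (μ₁.comap Φ).rnDeriv μ₂ =ᵐ[μ₂] fun s => (h s : ℝ≥0∞) ^ α

end Minimal

/-! ### Standardized supports -/

/-- The continuous part of `S_{I,N}`: the interval `(0, 1)` if `I = 1`, and empty if `I = 0`. -/
def contPart (I : Fin 2) : Set ℝ := {s | I = 1 ∧ s ∈ Ioo (0 : ℝ) 1}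

/-- The discrete part of `S_{I,N}`: the integers `n` with `1 ≤ n ≤ N`, for `N ∈ {0, 1, 2, …, ∞}`. -/
def discPart (N : ℕ∞) : Set ℝ := {s | ∃ n : ℕ, 1 ≤ n ∧ (n : ℕ∞) ≤ N ∧ s = n}

/-- The standardized support `S_{I,N} ⊆ (0, 1) ∪ {1, 2, 3, …}`. -/
abbrev StdSupport (I : Fin 2) (N : ℕ∞) : Type := ↥(contPart I ∪ discPart N)

/-- `λ_{I,N}`: Lebesgue measure on the continuous part and counting measure on the discrete part. -/
def stdMeasure (I : Fin 2) (N : ℕ∞) : Measure (StdSupport I N) :=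
  (volume.restrict (contPart I) + Measure.count.restrict (discPart N)).comap Subtype.val

/-- The extension by zero to `S_{I,N}` of a function on `A ⊆ ℝ`. -/
def extendZero {I : Fin 2} {N : ℕ∞} (A : Set ℝ) (f : A → ℝ≥0) : StdSupport I N → ℝ≥0 :=
  open Classical in fun s => if hs : (s : ℝ) ∈ A then f ⟨s, hs⟩ else 0

/-- Lebesgue measure on the interval `(0, 1)`. -/
def lebesgue : Measure (Ioo (0 : ℝ) 1) := (volume : Measure ℝ).comap Subtype.val

end MaxStable

end

open MaxStable

noncomputable section

namespace MaxStable

/-! The law of `X` and the integrals `∫ (max a_i f_{t_i}) ^ α dμ` determine each other: the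
probability that `a_i ξ_i ≤ 1` for all `i`, where `ξ_i` is the extremal integral of `f_{t_i}`, is
`exp` of minus this integral (`IsFrechetSupMeasure.prob_extremalIntegral_le`). Hence two
representations of `X` give the same norms to all finite max-linear combinations (`NormsAgree`), and
to countable ones by monotone convergence.

Norms of maxima determine more. The right derivative of `∫ max (b q) v ^ α` at `b = 1` yields the
integral of `q ^ α` over `{v ≤ q}`. With `v = max f_t / b_t` this is the mass of the box `{f_t / q ≤
b_t}` under `q ^ α dμ`. So the spectral measures, the images of `q ^ α dμ` under `s ↦ (f_t s / q
s)_t`, coincide (`NormsAgree.map_ratioMap_eq`); here `q` is a weighted supremum of countably many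
`f_t` that is positive and finite almost everywhere.

Minimality makes countably many of these ratios separate the points off a null set
(`IsMinimal.exists_countable`). By Lusin–Souslin, standard Borel measures with the same image under
almost injective maps are isomorphic modulo null sets; this isomorphism is `Φ`, and `h = q₂ / (q₁ ∘
Φ)`. On the leftover null sets `Φ` is completed by any Borel isomorphism (`exists_pointMap`).

The isometry is `f ↦ h · (f ∘ Φ)`. On the closed max-linear span it is unique because max-linear
isometries preserve `ρ`. On all of `L₊^α`, any competitor `V` is compared with it through the
inequality `h · (g ∘ Φ) ≤ V g`. The functions `g` satisfying it are stable under countable suprema,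
under minima and under restriction to sets of the ratio `σ`-field, so they exhaust `L₊^α`
(`LPlus_subset_dominated`), and equality of norms turns the inequality into an equality. Finally,
comparing masses of points shows that `Φ` preserves atoms and that `h = 1` there, which gives `I₁ =
I₂`, `N₁ = N₂` and the two parts of `U`. -/

/-! ### The law of extremal integrals -/

/-- The function `x ↦ exp (-x)` on `[0, ∞]`. -/
def expNeg (x : ℝ≥0∞) : ℝ≥0∞ := EReal.exp (-(x : EReal))

theorem expNeg_zero : expNeg 0 = 1 := by simp [expNeg]

theorem expNeg_add (x y : ℝ≥0∞) : expNeg (x + y) = expNeg x * expNeg y := by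
  unfold expNeg
  rw [EReal.coe_ennreal_add, EReal.neg_add (Or.inl (EReal.coe_ennreal_ne_bot x))
    (Or.inr (EReal.coe_ennreal_ne_bot y)), sub_eq_add_neg, EReal.exp_add]

theorem expNeg_injective : Function.Injective expNeg := by
  intro x y h
  exact EReal.coe_ennreal_injective (neg_injective (EReal.exp_strictMono.injective h))

theorem continuous_expNeg : Continuous expNeg :=
  ENNReal.continuous_exp.comp (continuous_neg.comp continuous_coe_ennreal_ereal)

theorem expNeg_sum {ι : Type*} (s : Finset ι) (x : ι → ℝ≥0∞) :
    expNeg (∑ i ∈ s, x i) = ∏ i ∈ s, expNeg (x i) := by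
  classical
  induction s using Finset.induction_on with
  | empty => simp [expNeg_zero]
  | insert a s ha ih => rw [Finset.sum_insert ha, Finset.prod_insert ha, expNeg_add, ih]

theorem pairwise_disjoint_fiber {S β : Type*} (φ : S → β) :
    Pairwise (Function.onFun Disjoint fun v => φ ⁻¹' {v}) := by
  intro v w hvw
  exact Disjoint.preimage φ (by simpa using hvw)

section Law

variable {S Ω : Type*} [MeasurableSpace S] [MeasurableSpace Ω] {α : ℝ} {μ : Measure S}
  {P : Measure Ω} {M : Set S → Ω → ℝ≥0∞}

theorem IsFrechetSupMeasure.prob_le (hM : IsFrechetSupMeasure α μ P M) (hα : 0 < α)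
    {A : Set S} (hA : MeasurableSet A) {x : ℝ≥0} (hx : 0 < x) :
    P {ω | M A ω ≤ x} = expNeg (μ A * (x : ℝ≥0∞) ^ (-α)) := by
  have h := hM.frechet A hA x hx
  rwa [← ENNReal.rpow_mul, one_div, inv_mul_cancel₀ hα.ne', ENNReal.rpow_one] at h

variable [IsProbabilityMeasure P]

theorem IsFrechetSupMeasure.prob_mul_le (hM : IsFrechetSupMeasure α μ P M) (hα : 0 < α)
    {A : Set S} (hA : MeasurableSet A) (c : ℝ≥0) :
    P {ω | (c : ℝ≥0∞) * M A ω ≤ 1} = expNeg ((c : ℝ≥0∞) ^ α * μ A) := by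
  rcases eq_or_ne c 0 with rfl | hc
  · simp [expNeg_zero, ENNReal.zero_rpow_of_pos hα]
  · have : {ω | (c : ℝ≥0∞) * M A ω ≤ 1} = {ω | M A ω ≤ ((c⁻¹ : ℝ≥0) : ℝ≥0∞)} := by
      ext ω
      simp only [mem_ofPred_eq]
      rw [ENNReal.coe_inv hc, ENNReal.le_inv_iff_mul_le, mul_comm]
    rw [this, hM.prob_le hα hA (by positivity), ENNReal.coe_inv hc, ENNReal.inv_rpow,
      ENNReal.rpow_neg, inv_inv, mul_comm]

/-- The scale is `0`, so `M ∅ ≤ 1 / (n + 1)` has probability `1` for every `n`. This permits padding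
finite families with `∅` in the countable max-additivity axiom. -/
theorem IsFrechetSupMeasure.empty (hM : IsFrechetSupMeasure α μ P M) (hα : 0 < α) :
    ∀ᵐ ω ∂P, M ∅ ω = 0 := by
  have h : ∀ n : ℕ, ∀ᵐ ω ∂P, M ∅ ω ≤ ((1 / (n + 1) : ℝ≥0) : ℝ≥0∞) := by
    intro n
    have h1 := hM.prob_le hα MeasurableSet.empty (x := 1 / (n + 1)) (by positivity)
    rw [measure_empty, zero_mul, expNeg_zero] at h1
    exact (prob_compl_eq_zero_iff
      (measurableSet_le (hM.measurable ∅ MeasurableSet.empty) measurable_const)).2 h1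
  filter_upwards [ae_all_iff.2 h] with ω hω
  by_contra hne
  obtain ⟨r, hr0, hr⟩ := ENNReal.lt_iff_exists_nnreal_btwn.1 (pos_iff_ne_zero.2 hne)
  obtain ⟨n, hn⟩ := exists_nat_one_div_lt (K := ℝ≥0) (by exact_mod_cast hr0 : (0 : ℝ≥0) < r)
  have := (hω n).trans_lt (by exact_mod_cast hn : ((1 / (n + 1) : ℝ≥0) : ℝ≥0∞) < r)
  exact absurd hr (not_lt.2 this.le)

theorem IsFrechetSupMeasure.union (hM : IsFrechetSupMeasure α μ P M) (hα : 0 < α) {A B : Set S}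
    (hA : MeasurableSet A) (hB : MeasurableSet B) (hAB : Disjoint A B) :
    ∀ᵐ ω ∂P, M (A ∪ B) ω = M A ω ⊔ M B ω := by
  let C : ℕ → Set S := fun n => Nat.casesOn n A fun m => Nat.casesOn m B fun _ => ∅
  have hC : ∀ i, MeasurableSet (C i) := by
    rintro (_ | _ | n)
    exacts [hA, hB, MeasurableSet.empty]
  have hd : Pairwise (Function.onFun Disjoint C) := by
    rintro (_ | _ | n) (_ | _ | m) h <;> simp_all [Function.onFun, C, hAB.symm]
  have hU : ⋃ i, C i = A ∪ B := by
    ext s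
    simp only [mem_iUnion, mem_union]
    constructor
    · rintro ⟨_ | _ | n, h⟩
      exacts [Or.inl h, Or.inr h, absurd h (notMem_empty s)]
    · rintro (h | h)
      exacts [⟨0, h⟩, ⟨1, h⟩]
  filter_upwards [hM.iUnion C hC hd, hM.empty hα] with ω h h0
  rw [hU] at h
  rw [h]
  apply le_antisymm
  · refine iSup_le ?_
    rintro (_ | _ | n)
    · exact le_sup_left
    · exact le_sup_right
    · change M ∅ ω ≤ _
      simp [h0]
  · exact sup_le (le_iSup (fun i => M (C i) ω) 0) (le_iSup (fun i => M (C i) ω) 1)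

theorem IsFrechetSupMeasure.biUnion_finset (hM : IsFrechetSupMeasure α μ P M) (hα : 0 < α)
    {β : Type*} (s : Finset β) (A : β → Set S) (hA : ∀ i, MeasurableSet (A i))
    (hd : Pairwise (Function.onFun Disjoint A)) :
    ∀ᵐ ω ∂P, M (⋃ i ∈ s, A i) ω = s.sup fun i => M (A i) ω := by
  classical
  induction s using Finset.induction_on with
  | empty =>
    filter_upwards [hM.empty hα] with ω h
    simp [h]
  | insert a s ha ih =>
    have hdis : Disjoint (A a) (⋃ i ∈ s, A i) := by
      simp only [disjoint_iUnion_right]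
      intro i hi
      exact hd (by rintro rfl; exact ha hi)
    filter_upwards [ih, hM.union hα (hA a) (s.measurableSet_biUnion fun i _ => hA i) hdis]
      with ω h1 h2
    rw [Finset.set_biUnion_insert, h2, h1, Finset.sup_insert]

/-- The extremal integral of a function of a simple function. -/
theorem IsFrechetSupMeasure.simpleIntegral_map (hM : IsFrechetSupMeasure α μ P M) (hα : 0 < α)
    {β : Type*} (φ : SimpleFunc S β) (g : β → ℝ≥0) :
    ∀ᵐ ω ∂P, simpleIntegral M (φ.map g) ω =
      φ.range.sup fun v => (g v : ℝ≥0∞) * M (φ ⁻¹' {v}) ω := by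
  classical
  have h : ∀ a ∈ (φ.map g).range, ∀ᵐ ω ∂P, M (⇑(φ.map g) ⁻¹' {a}) ω =
      (φ.range.filter fun v => g v = a).sup fun v => M (φ ⁻¹' {v}) ω := by
    intro a _
    have := hM.biUnion_finset hα (φ.range.filter fun v => g v = a) (fun v => φ ⁻¹' {v})
      (fun v => φ.measurableSet_fiber v) (pairwise_disjoint_fiber φ)
    convert this using 4
    ext s
    simp
  filter_upwards [(Finset.eventually_all _).2 h] with ω hω
  unfold simpleIntegral
  apply le_antisymm
  · refine Finset.sup_le fun a ha => ?_
    rw [hω a ha]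
    rcases (φ.range.filter fun v => g v = a).eq_empty_or_nonempty with h0 | h0
    · simp [h0]
    · obtain ⟨v, hv, hve⟩ := Finset.exists_mem_eq_sup _ h0 fun v => M (φ ⁻¹' {v}) ω
      rw [hve]
      obtain ⟨hv1, rfl⟩ := Finset.mem_filter.1 hv
      exact Finset.le_sup (f := fun v => (g v : ℝ≥0∞) * M (φ ⁻¹' {v}) ω) hv1
  · refine Finset.sup_le fun v hv => ?_
    have hg : g v ∈ (φ.map g).range := by
      rw [SimpleFunc.range_map]
      exact Finset.mem_image_of_mem g hv
    refine le_trans ?_ (Finset.le_sup (f := fun a : ℝ≥0 => (a : ℝ≥0∞) * M (⇑(φ.map g) ⁻¹' {a}) ω) hg)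
    simp only [hω _ hg]
    gcongr
    exact Finset.le_sup (f := fun v => M (φ ⁻¹' {v}) ω) (by simpa using hv)

/-- The integral is a finite sum over the disjoint level sets; `expNeg` turns it into a product,
which independence of `M` on these sets matches factor by factor. -/
theorem IsFrechetSupMeasure.prob_forall_fiber (hM : IsFrechetSupMeasure α μ P M) (hα : 0 < α)
    {β : Type*} (φ : SimpleFunc S β) (c : β → ℝ≥0) :
    P {ω | ∀ v ∈ φ.range, (c v : ℝ≥0∞) * M (φ ⁻¹' {v}) ω ≤ 1} =
      expNeg (∫⁻ s, (c (φ s) : ℝ≥0∞) ^ α ∂μ) := by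
  have hint : ∫⁻ s, (c (φ s) : ℝ≥0∞) ^ α ∂μ =
      ∑ v ∈ φ.range, (c v : ℝ≥0∞) ^ α * μ (φ ⁻¹' {v}) := by
    rw [← SimpleFunc.map_lintegral, ← SimpleFunc.lintegral_eq_lintegral]
    rfl
  rw [hint, expNeg_sum]
  let e := φ.range.equivFin
  have hind := hM.indep φ.range.card (fun i => φ ⁻¹' {(e.symm i : β)})
    (fun i => φ.measurableSet_fiber _) (fun i j hij => pairwise_disjoint_fiber φ
      (fun h => hij (e.symm.injective (Subtype.ext h))))
  have hprod := hind.measure_inter_preimage_eq_mul Finset.univ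
    (sets := fun i => {x | (c (e.symm i) : ℝ≥0∞) * x ≤ 1})
    (fun i _ => measurableSet_le (measurable_const_mul _) measurable_const)
  have hset : {ω | ∀ v ∈ φ.range, (c v : ℝ≥0∞) * M (φ ⁻¹' {v}) ω ≤ 1} =
      ⋂ i ∈ Finset.univ, M (φ ⁻¹' {(e.symm i : β)}) ⁻¹' {x | (c (e.symm i) : ℝ≥0∞) * x ≤ 1} := by
    ext ω
    simp only [mem_ofPred_eq, mem_iInter, Finset.mem_univ, forall_true_left, mem_preimage]
    constructor
    · intro h i
      exact h _ (e.symm i).2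
    · intro h v hv
      simpa using h (e ⟨v, hv⟩)
  rw [hset, hprod, ← Finset.prod_coe_sort φ.range]
  rw [← Equiv.prod_comp e.symm]
  refine Finset.prod_congr rfl fun i _ => ?_
  exact hM.prob_mul_le hα (φ.measurableSet_fiber _) _

/-- A finite family of simple functions as a simple function. -/
def simpleFuncPi {ι β : Type*} [Finite ι] (φ : ι → SimpleFunc S β) : SimpleFunc S (ι → β) where
  toFun s i := φ i s
  measurableSet_fiber' v := by
    have : (fun s i => φ i s) ⁻¹' {v} = ⋂ i, φ i ⁻¹' {v i} := by
      ext s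
      simp [funext_iff]
    rw [this]
    exact MeasurableSet.iInter fun i => (φ i).measurableSet_fiber _
  finite_range' := by
    refine (Set.Finite.pi' fun i => (φ i).finite_range).subset ?_
    rintro _ ⟨s, rfl⟩ i
    exact ⟨s, rfl⟩

theorem IsFrechetSupMeasure.prob_simpleIntegral_le (hM : IsFrechetSupMeasure α μ P M)
    (hα : 0 < α) {ι : Type*} [Fintype ι] (φ : ι → SimpleFunc S ℝ≥0) (a : ι → ℝ≥0) :
    P {ω | ∀ i, (a i : ℝ≥0∞) * simpleIntegral M (φ i) ω ≤ 1} =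
      expNeg (∫⁻ s, ((Finset.univ.sup fun i => a i * φ i s : ℝ≥0) : ℝ≥0∞) ^ α ∂μ) := by
  refine Eq.trans ?_ (hM.prob_forall_fiber hα (simpleFuncPi φ)
    fun v => Finset.univ.sup fun i => a i * v i)
  have h : ∀ i, ∀ᵐ ω ∂P, simpleIntegral M (φ i) ω =
      (simpleFuncPi φ).range.sup fun v => (v i : ℝ≥0∞) * M (simpleFuncPi φ ⁻¹' {v}) ω := by
    intro i
    exact hM.simpleIntegral_map hα (simpleFuncPi φ) (fun v => v i)
  apply measure_congr
  filter_upwards [ae_all_iff.2 h] with ω hω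
  -- On the common partition, the bounds over `i` and over the cells `v` are interchanged: for fixed
  -- `v` they merge into one bound with coefficient `max_i a_i v_i`.
  have key : (∀ i, (a i : ℝ≥0∞) * simpleIntegral M (φ i) ω ≤ 1) ↔
      ∀ v ∈ (simpleFuncPi φ).range, ((Finset.univ.sup fun i => a i * v i : ℝ≥0) : ℝ≥0∞) *
        M (simpleFuncPi φ ⁻¹' {v}) ω ≤ 1 := by
    simp only [hω]
    constructor
    · intro h v hv
      rcases isEmpty_or_nonempty ι with hι | hι
      · simp
      · obtain ⟨i, -, hi⟩ := Finset.exists_mem_eq_sup Finset.univ Finset.univ_nonempty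
          fun i => a i * v i
        rw [hi]
        refine le_trans ?_ (h i)
        push_cast
        rw [mul_assoc]
        gcongr
        exact Finset.le_sup
          (f := fun v => (v i : ℝ≥0∞) * M (simpleFuncPi φ ⁻¹' {v}) ω) hv
    · intro h i
      rcases (simpleFuncPi φ).range.eq_empty_or_nonempty with h0 | h0
      · simp [h0]
      · obtain ⟨v, hv, hve⟩ := Finset.exists_mem_eq_sup _ h0
          fun v => (v i : ℝ≥0∞) * M (simpleFuncPi φ ⁻¹' {v}) ω
        rw [hve]
        refine le_trans ?_ (h v hv)
        rw [← mul_assoc, ← ENNReal.coe_mul]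
        gcongr
        exact Finset.le_sup (f := fun i => a i * v i) (Finset.mem_univ i)
  exact propext key

end Law

/-! ### Passage from simple functions to limits in probability. -/

theorem ennreal_le_add_edist (x y : ℝ≥0∞) : x ≤ y + edist x y ∧ y ≤ x + edist x y := by
  induction x with
  | top =>
    induction y with
    | top => simp
    | coe y => simp [(ENNReal.edist_eq_top_iff ⊤ (y : ℝ≥0∞)).2 (by simp)]
  | coe x =>
    induction y with
    | top => simp [(ENNReal.edist_eq_top_iff (x : ℝ≥0∞) ⊤).2 (by simp)]
    | coe y =>
      have h : edist (x : ℝ≥0∞) (y : ℝ≥0∞) = ((nndist x y : ℝ≥0) : ℝ≥0∞) :=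
        (edist_nndist x y : edist x y = _)
      rw [h, NNReal.nndist_eq]
      norm_cast
      exact ⟨(le_add_tsub.trans (add_le_add_right (le_max_left _ _) _)),
        (le_add_tsub.trans (add_le_add_right (le_max_right _ _) _))⟩

theorem ofReal_coe_rpow {α : ℝ} (hα : 0 < α) (x : ℝ≥0) :
    ENNReal.ofReal ((x : ℝ) ^ α) = (x : ℝ≥0∞) ^ α := by
  rw [← ENNReal.ofReal_rpow_of_nonneg x.coe_nonneg hα.le, ENNReal.ofReal_coe_nnreal]

theorem rpow_le_rpow_add_dist {α : ℝ} (hα : 0 < α) (x y : ℝ≥0) :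
    (x : ℝ≥0∞) ^ α ≤ (y : ℝ≥0∞) ^ α + ENNReal.ofReal |(x : ℝ) ^ α - (y : ℝ) ^ α| := by
  rw [← ofReal_coe_rpow hα, ← ofReal_coe_rpow hα,
    ← ENNReal.ofReal_add (by positivity) (abs_nonneg _)]
  apply ENNReal.ofReal_le_ofReal
  have := le_abs_self ((x : ℝ) ^ α - (y : ℝ) ^ α)
  linarith

theorem coe_finsetSup_rpow {ι : Type*} {α : ℝ} (hα : 0 < α) (s : Finset ι) (f : ι → ℝ≥0) :
    ((s.sup f : ℝ≥0) : ℝ≥0∞) ^ α = s.sup fun i => (f i : ℝ≥0∞) ^ α := by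
  have hm : Monotone fun x : ℝ≥0 => (x : ℝ≥0∞) ^ α := fun a b h =>
    ENNReal.rpow_le_rpow (by exact_mod_cast h) hα.le
  exact Finset.apply_sup_eq_sup_comp_of_linearOrder (g := fun x : ℝ≥0 => (x : ℝ≥0∞) ^ α) hm
    (by simp [ENNReal.zero_rpow_of_pos hα])

theorem finsetSup_mul_rpow_le {ι : Type*} {α : ℝ} (hα : 0 < α) (s : Finset ι)
    (a x y : ι → ℝ≥0) :
    ((s.sup fun i => a i * x i : ℝ≥0) : ℝ≥0∞) ^ α ≤
      ((s.sup fun i => a i * y i : ℝ≥0) : ℝ≥0∞) ^ α +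
        ∑ i ∈ s, (a i : ℝ≥0∞) ^ α * ENNReal.ofReal |(x i : ℝ) ^ α - (y i : ℝ) ^ α| := by
  rw [coe_finsetSup_rpow hα, coe_finsetSup_rpow hα]
  refine Finset.sup_le fun i hi => ?_
  have h1 : ((a i * x i : ℝ≥0) : ℝ≥0∞) ^ α ≤ ((a i * y i : ℝ≥0) : ℝ≥0∞) ^ α +
      (a i : ℝ≥0∞) ^ α * ENNReal.ofReal |(x i : ℝ) ^ α - (y i : ℝ) ^ α| := by
    rw [ENNReal.coe_mul, ENNReal.coe_mul, ENNReal.mul_rpow_of_nonneg _ _ hα.le,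
      ENNReal.mul_rpow_of_nonneg _ _ hα.le, ← mul_add]
    gcongr
    exact rpow_le_rpow_add_dist hα _ _
  refine h1.trans (add_le_add ?_ ?_)
  · exact Finset.le_sup (f := fun i => ((a i * y i : ℝ≥0) : ℝ≥0∞) ^ α) hi
  · exact Finset.single_le_sum (f := fun i => (a i : ℝ≥0∞) ^ α *
      ENNReal.ofReal |(x i : ℝ) ^ α - (y i : ℝ) ^ α|) (fun _ _ => zero_le) hi

theorem rho_comm {S : Type*} [MeasurableSpace S] (α : ℝ) (μ : Measure S) (f g : S → ℝ≥0) :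
    rho α μ f g = rho α μ g f := by
  simp only [rho, abs_sub_comm]

section Limit

variable {S Ω : Type*} [MeasurableSpace S] [MeasurableSpace Ω] {α : ℝ} {μ : Measure S}

theorem measurable_dist_rpow (α : ℝ) {f g : S → ℝ≥0} (hf : Measurable f) (hg : Measurable g) :
    Measurable fun s => ENNReal.ofReal |(f s : ℝ) ^ α - (g s : ℝ) ^ α| := by
  have h : ∀ {f : S → ℝ≥0}, Measurable f → Measurable fun s => (f s : ℝ) ^ α := fun hf =>
    (measurable_coe_nnreal_real.comp hf).pow_const α
  exact ((h hf).sub (h hg)).abs.ennreal_ofReal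

/-- A quantitative form of the `ρ`-continuity of norms of finite maxima; it is applied in both
directions to an approximating sequence. -/
theorem lintegral_finsetSup_le {ι : Type*} (hα : 0 < α) (s : Finset ι)
    (a : ι → ℝ≥0) {f g : ι → S → ℝ≥0} (hf : ∀ i, Measurable (f i)) (hg : ∀ i, Measurable (g i)) :
    ∫⁻ x, ((s.sup fun i => a i * f i x : ℝ≥0) : ℝ≥0∞) ^ α ∂μ ≤
      ∫⁻ x, ((s.sup fun i => a i * g i x : ℝ≥0) : ℝ≥0∞) ^ α ∂μ +
        ∑ i ∈ s, (a i : ℝ≥0∞) ^ α * rho α μ (f i) (g i) := by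
  have hm : ∀ i, Measurable fun x => ENNReal.ofReal |(f i x : ℝ) ^ α - (g i x : ℝ) ^ α| :=
    fun i => measurable_dist_rpow α (hf i) (hg i)
  have : ∑ i ∈ s, (a i : ℝ≥0∞) ^ α * rho α μ (f i) (g i) = ∫⁻ x, ∑ i ∈ s, (a i : ℝ≥0∞) ^ α *
      ENNReal.ofReal |(f i x : ℝ) ^ α - (g i x : ℝ) ^ α| ∂μ := by
    rw [lintegral_finsetSum _ fun i _ => (hm i).const_mul _]
    exact Finset.sum_congr rfl fun i _ => (lintegral_const_mul _ (hm i)).symm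
  rw [this, ← lintegral_add_right _ (Finset.measurable_sum _ fun i _ => (hm i).const_mul _)]
  exact lintegral_mono fun x => finsetSup_mul_rpow_le hα s a _ _

/-- The bounds say `x ≤ 1 / (c a)` and `y ≤ 1 / (b a)`, and `(b⁻¹ - c⁻¹) / a` is exactly the gap
between the two thresholds. -/
theorem mul_le_one_of_edist_lt {a b c : ℝ≥0} (ha : 0 < a) (hb : 0 < b) (hbc : b < c)
    {x y : ℝ≥0∞} (hx : ((c * a : ℝ≥0) : ℝ≥0∞) * x ≤ 1) (hxy : y ≤ x + ((b⁻¹ - c⁻¹) / a : ℝ≥0)) :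
    ((b * a : ℝ≥0) : ℝ≥0∞) * y ≤ 1 := by
  have hc : 0 < c := hb.trans hbc
  have hx' : x ≠ ⊤ := by
    rintro rfl
    rw [ENNReal.mul_top (by positivity)] at hx
    simp at hx
  lift x to ℝ≥0 using hx'
  refine (mul_le_mul_right hxy _).trans ?_
  norm_cast at hx ⊢
  rw [mul_add]
  have h1 : b * a * ((b⁻¹ - c⁻¹) / a) = 1 - b / c := by
    rw [← NNReal.coe_inj]
    have hle : c⁻¹ ≤ b⁻¹ := inv_anti₀ hb hbc.le
    have hle' : b / c ≤ 1 := (div_le_one hc).2 hbc.le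
    push_cast [NNReal.coe_sub hle, NNReal.coe_sub hle']
    have : (b : ℝ) ≠ 0 := by positivity
    have : (a : ℝ) ≠ 0 := by positivity
    have : (c : ℝ) ≠ 0 := by positivity
    field_simp
  have h2 : b * a * x ≤ b / c := by
    rw [le_div_iff₀ hc]
    calc b * a * x * c = b * (c * a * x) := by ring
      _ ≤ b * 1 := by gcongr
      _ = b := mul_one b
  rw [h1]
  calc b * a * x + (1 - b / c) ≤ b / c + (1 - b / c) := by gcongr
    _ = 1 := add_tsub_cancel_of_le ((div_le_one hc).2 hbc.le)

variable {P : Measure Ω} [IsProbabilityMeasure P] {M : Set S → Ω → ℝ≥0∞}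

/-- The joint distribution function of extremal integrals. -/
theorem IsFrechetSupMeasure.prob_extremalIntegral_le (hM : IsFrechetSupMeasure α μ P M)
    (hα : 0 < α) {ι : Type*} [Fintype ι] {f : ι → S → ℝ≥0} {ξ : ι → Ω → ℝ≥0}
    (hf : ∀ i, f i ∈ LPlus α μ) (hξ : ∀ i, IsExtremalIntegral α μ P M (f i) (ξ i))
    {a : ι → ℝ≥0} (ha : ∀ i, 0 < a i) :
    P {ω | ∀ i, a i * ξ i ω ≤ 1} =
      expNeg (∫⁻ s, ((Finset.univ.sup fun i => a i * f i s : ℝ≥0) : ℝ≥0∞) ^ α ∂μ) := by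
  choose φ hφL hφ hφP using hξ
  set Q := ∫⁻ s, ((Finset.univ.sup fun i => a i * f i s : ℝ≥0) : ℝ≥0∞) ^ α ∂μ with hQ
  let Qn : ℕ → ℝ≥0∞ := fun n =>
    ∫⁻ s, ((Finset.univ.sup fun i => a i * φ i n s : ℝ≥0) : ℝ≥0∞) ^ α ∂μ
  have hQn : Tendsto Qn atTop (𝓝 Q) := by
    let R : ℕ → ℝ≥0∞ := fun n => ∑ i, (a i : ℝ≥0∞) ^ α * rho α μ (φ i n) (f i)
    have hR : Tendsto R atTop (𝓝 0) := by
      have : Tendsto R atTop (𝓝 (∑ i, (a i : ℝ≥0∞) ^ α * 0)) := by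
        refine tendsto_finsetSum _ fun i _ => ENNReal.Tendsto.const_mul (hφ i) (Or.inr ?_)
        exact ENNReal.rpow_ne_top_of_nonneg hα.le ENNReal.coe_ne_top
      simpa using this
    have h1 : ∀ n, Qn n ≤ Q + R n := fun n =>
      lintegral_finsetSup_le hα _ a (fun i => (φ i n).measurable) fun i => (hf i).1
    have h2 : ∀ n, Q - R n ≤ Qn n := by
      intro n
      rw [tsub_le_iff_right]
      have := lintegral_finsetSup_le (μ := μ) hα Finset.univ a (fun i => (hf i).1)
        (fun i => (φ i n).measurable)
      simpa only [rho_comm α μ (f _)] using this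
    refine tendsto_of_tendsto_of_tendsto_of_le_of_le ?_ ?_ h2 h1
    · simpa using ENNReal.Tendsto.sub (tendsto_const_nhds (x := Q)) hR (Or.inr ENNReal.zero_ne_top)
    · simpa using tendsto_const_nhds (x := Q).add hR
  have hscale : ∀ (c : ℝ≥0) n, P {ω | ∀ i, ((c * a i : ℝ≥0) : ℝ≥0∞) *
      simpleIntegral M (φ i n) ω ≤ 1} = expNeg ((c : ℝ≥0∞) ^ α * Qn n) := by
    intro c n
    rw [hM.prob_simpleIntegral_le hα (fun i => φ i n) (fun i => c * a i)]
    congr 1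
    rw [← lintegral_const_mul' _ _ (ENNReal.rpow_ne_top_of_nonneg hα.le ENNReal.coe_ne_top)]
    congr 1 with s
    rw [← ENNReal.mul_rpow_of_nonneg _ _ hα.le, ← ENNReal.coe_mul, NNReal.mul_finset_sup]
    simp only [mul_assoc]
  have hscaleLim : ∀ c : ℝ≥0, Tendsto (fun n => expNeg ((c : ℝ≥0∞) ^ α * Qn n)) atTop
      (𝓝 (expNeg ((c : ℝ≥0∞) ^ α * Q))) := fun c =>
    (continuous_expNeg.tendsto _).comp (ENNReal.Tendsto.const_mul hQn
      (Or.inr (ENNReal.rpow_ne_top_of_nonneg hα.le ENNReal.coe_ne_top)))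
  let D : (ι → ℝ≥0∞) → ℕ → ℝ≥0∞ := fun δ n =>
    ∑ i, P {ω | δ i ≤ edist (simpleIntegral M (φ i n) ω) (ξ i ω : ℝ≥0∞)}
  have hD : ∀ δ : ι → ℝ≥0∞, (∀ i, 0 < δ i) → Tendsto (D δ) atTop (𝓝 0) := by
    intro δ hδ
    have : Tendsto (D δ) atTop (𝓝 (∑ _i : ι, 0)) :=
      tendsto_finsetSum _ fun i _ => hφP i (δ i) (hδ i)
    simpa using this
  have hδpos : ∀ b c : ℝ≥0, 0 < b → b < c → ∀ i, (0 : ℝ≥0∞) < ((b⁻¹ - c⁻¹) / a i : ℝ≥0) := by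
    intro b c hb hbc i
    have : c⁻¹ < b⁻¹ := inv_strictAnti₀ hb hbc
    exact_mod_cast div_pos (tsub_pos_of_lt this) (ha i)
  -- Lowering the factor from `c` to `b` leaves room for the error between simple integral and
  -- limit, up to the probability `D` of a large error. `Y` and `Z` are later the simple integrals
  -- and their limits, in either order.
  have hsub : ∀ (b c : ℝ≥0), 0 < b → b < c → ∀ n (Y Z : ι → Ω → ℝ≥0∞),
      (∀ i ω, Z i ω ≤ Y i ω + edist (simpleIntegral M (φ i n) ω) (ξ i ω : ℝ≥0∞)) →
      P {ω | ∀ i, ((c * a i : ℝ≥0) : ℝ≥0∞) * Y i ω ≤ 1} ≤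
        P {ω | ∀ i, ((b * a i : ℝ≥0) : ℝ≥0∞) * Z i ω ≤ 1} +
          D (fun i => ((b⁻¹ - c⁻¹) / a i : ℝ≥0)) n := by
    intro b c hb hbc n Y Z hYZ
    refine (measure_mono (t := {ω | ∀ i, ((b * a i : ℝ≥0) : ℝ≥0∞) * Z i ω ≤ 1} ∪
      ⋃ i, {ω | (((b⁻¹ - c⁻¹) / a i : ℝ≥0) : ℝ≥0∞) ≤
        edist (simpleIntegral M (φ i n) ω) (ξ i ω : ℝ≥0∞)}) ?_).trans
      ((measure_union_le _ _).trans (add_le_add_right ?_ _))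
    · intro ω hω
      by_cases h : ∃ i, (((b⁻¹ - c⁻¹) / a i : ℝ≥0) : ℝ≥0∞) ≤
          edist (simpleIntegral M (φ i n) ω) (ξ i ω : ℝ≥0∞)
      · exact Or.inr (mem_iUnion.2 h)
      · push Not at h
        refine Or.inl fun i => mul_le_one_of_edist_lt (ha i) hb hbc (hω i) ?_
        exact (hYZ i ω).trans (add_le_add_right (h i).le _)
    · exact (measure_iUnion_fintype_le _ _)
  have hup : ∀ b c : ℝ≥0, 0 < b → b < c →
      P {ω | ∀ i, ((c * a i : ℝ≥0) : ℝ≥0∞) * (ξ i ω : ℝ≥0∞) ≤ 1} ≤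
        expNeg ((b : ℝ≥0∞) ^ α * Q) := by
    intro b c hb hbc
    have := ((hscaleLim b).add (hD _ (hδpos b c hb hbc)))
    rw [add_zero] at this
    refine ge_of_tendsto' this fun n => ?_
    rw [← hscale]
    exact hsub b c hb hbc n _ _ fun i ω => (ennreal_le_add_edist _ _).1
  have hlow : ∀ b c : ℝ≥0, 0 < b → b < c → expNeg ((c : ℝ≥0∞) ^ α * Q) ≤
      P {ω | ∀ i, ((b * a i : ℝ≥0) : ℝ≥0∞) * (ξ i ω : ℝ≥0∞) ≤ 1} := by
    intro b c hb hbc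
    have := (tendsto_const_nhds (x := P {ω | ∀ i, ((b * a i : ℝ≥0) : ℝ≥0∞) *
      (ξ i ω : ℝ≥0∞) ≤ 1})).add (hD _ (hδpos b c hb hbc))
    rw [add_zero] at this
    refine le_of_tendsto_of_tendsto' (hscaleLim c) this fun n => ?_
    rw [← hscale]
    exact hsub b c hb hbc n _ _ fun i ω => (ennreal_le_add_edist _ _).2
  have hset : {ω | ∀ i, ((1 * a i : ℝ≥0) : ℝ≥0∞) * (ξ i ω : ℝ≥0∞) ≤ 1} =
      {ω | ∀ i, a i * ξ i ω ≤ 1} := by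
    ext ω
    simp only [mem_ofPred_eq, one_mul]
    norm_cast
  -- Continuity of the limiting law in the scaling factor closes the gap between `hup` and `hlow` as
  -- `b` increases to `1`, respectively `c` decreases to `1`.
  have hcont : ContinuousAt (fun c : ℝ≥0 => expNeg ((c : ℝ≥0∞) ^ α * Q)) 1 := by
    have hQtop : ((1 : ℝ≥0) : ℝ≥0∞) ^ α ≠ 0 := by simp
    refine (continuous_expNeg.tendsto _).comp ?_
    refine ENNReal.Tendsto.mul_const ?_ (Or.inl hQtop)
    exact (ENNReal.continuous_rpow_const.tendsto _).comp (ENNReal.continuous_coe.tendsto _)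
  have h1 : expNeg (((1 : ℝ≥0) : ℝ≥0∞) ^ α * Q) = expNeg Q := by simp
  rw [← hset]
  apply le_antisymm
  · rw [← h1]
    have hlim : Tendsto (fun n : ℕ => (n / (n + 1) : ℝ≥0)) atTop (𝓝 1) := by
      have := tendsto_natCast_div_add_atTop (𝕜 := ℝ) 1
      rw [← NNReal.tendsto_coe]
      simpa using this
    refine ge_of_tendsto (hcont.tendsto.comp hlim) ?_
    filter_upwards [eventually_gt_atTop 0] with n hn
    have hn' : (0 : ℝ≥0) < n := by exact_mod_cast hn
    exact hup _ 1 (by positivity) ((div_lt_one (by positivity)).2 (by simp))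
  · rw [← h1]
    have hlim : Tendsto (fun n : ℕ => (1 + 1 / (n + 1) : ℝ≥0)) atTop (𝓝 1) := by
      have := (tendsto_one_div_add_atTop_nhds_zero_nat (𝕜 := ℝ)).const_add 1
      rw [← NNReal.tendsto_coe]
      simpa using this
    refine le_of_tendsto' (hcont.tendsto.comp hlim) fun n => ?_
    refine hlow 1 _ one_pos ?_
    have : (0 : ℝ≥0) < 1 / (n + 1) := by positivity
    exact lt_add_of_pos_right _ this

end Limit

/-! ### The spectral measure of a family of functions -/

/-- Vanishing coefficients are discarded because the distribution formula requires positive ones,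
whereas `NormsAgree` is stated for arbitrary finite sets of coefficients. -/
theorem finsetSup_filter_pos {T : Type*} (p : Finset (T × ℝ≥0)) (x : T → ℝ≥0) :
    (p.sup fun q => q.2 * x q.1) =
      Finset.univ.sup fun q : ↥(p.filter fun q => 0 < q.2) => q.1.2 * x q.1.1 := by
  rw [Finset.univ_eq_attach]
  refine Eq.trans ?_ (Finset.sup_attach (p.filter fun q => 0 < q.2) fun q => q.2 * x q.1).symm
  apply le_antisymm
  · refine Finset.sup_le fun q hq => ?_
    rcases eq_or_ne q.2 0 with h0 | h0
    · simp [h0]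
    · exact Finset.le_sup (f := fun q : T × ℝ≥0 => q.2 * x q.1)
        (Finset.mem_filter.2 ⟨hq, pos_iff_ne_zero.2 h0⟩)
  · exact Finset.sup_mono (Finset.filter_subset _ _)

/-- The (possibly infinite) max-linear combination `⋁ a_i f_{t_i}`. -/
def maxComb {T S : Type*} {ι : Sort*} (t : ι → T) (a : ι → ℝ≥0) (f : T → S → ℝ≥0) (s : S) : ℝ≥0∞ :=
  ⨆ i, (a i : ℝ≥0∞) * f (t i) s

/-- Since `max (b u) v` is again a countable max-linear combination, its norm is known for every
`b`, as the differentiation in `b` requires. -/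
theorem max_mul_maxComb {T S ι κ : Type*} (t : ι → T) (a : ι → ℝ≥0) (u : κ → T) (c : κ → ℝ≥0)
    (b : ℝ≥0) (f : T → S → ℝ≥0) (s : S) :
    max (b * maxComb u c f s) (maxComb t a f s) =
      maxComb (Sum.elim u t) (Sum.elim (fun k => b * c k) a) f s := by
  simp only [maxComb, iSup_sum, Sum.elim_inl, Sum.elim_inr, ENNReal.coe_mul, mul_assoc,
    ENNReal.mul_iSup]

section SpectralMeasure

variable {T Ω Ω' Ω₁ Ω₂ S S₁ S₂ : Type*} [MeasurableSpace Ω] [MeasurableSpace Ω']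
  [MeasurableSpace Ω₁] [MeasurableSpace Ω₂] [MeasurableSpace S] [MeasurableSpace S₁]
  [MeasurableSpace S₂] {α : ℝ} {μ : Measure S} {μ₁ : Measure S₁} {μ₂ : Measure S₂}
  {f : T → S → ℝ≥0} {f₁ : T → S₁ → ℝ≥0} {f₂ : T → S₂ → ℝ≥0}

theorem IsSpectralRepresentation.prob_le {P : Measure Ω} {P' : Measure Ω'}
    [IsProbabilityMeasure P'] {X : T → Ω → ℝ} {M : Set S → Ω' → ℝ≥0∞}
    (hf : IsSpectralRepresentation α P X μ P' M f) (hM : IsFrechetSupMeasure α μ P' M)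
    (hα : 0 < α) {ι : Type*} [Fintype ι] (t : ι → T) {a : ι → ℝ≥0} (ha : ∀ i, 0 < a i) :
    P {ω | ∀ i, a i * X (t i) ω ≤ 1} =
      expNeg (∫⁻ s, ((Finset.univ.sup fun i => a i * f (t i) s : ℝ≥0) : ℝ≥0∞) ^ α ∂μ) := by
  classical
  obtain ⟨hL, ξ, hξ, hd⟩ := hf
  rw [← hM.prob_extremalIntegral_le hα (fun i => hL (t i)) (fun i => hξ (t i)) ha]
  have hJ := hd (Finset.univ.image t)
  let C : Set (↥(Finset.univ.image t) → ℝ) :=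
    {x | ∀ i, (a i : ℝ) * x ⟨t i, Finset.mem_image_of_mem t (Finset.mem_univ i)⟩ ≤ 1}
  have hC : MeasurableSet C := by
    have : C = ⋂ i, {x | (a i : ℝ) * x ⟨t i, Finset.mem_image_of_mem t (Finset.mem_univ i)⟩ ≤ 1} := by
      ext x
      simp [C]
    rw [this]
    exact MeasurableSet.iInter fun i =>
      measurableSet_le ((measurable_pi_apply _).const_mul _) measurable_const
  have := hJ.measure_mem_eq hC
  exact this

/-- The norms of the max-linear combinations of two families agree. -/
def NormsAgree (α : ℝ) (μ₁ : Measure S₁) (μ₂ : Measure S₂) (f₁ : T → S₁ → ℝ≥0)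
    (f₂ : T → S₂ → ℝ≥0) : Prop :=
  ∀ p : Finset (T × ℝ≥0),
    ∫⁻ s, ((p.sup fun q => q.2 * f₁ q.1 s : ℝ≥0) : ℝ≥0∞) ^ α ∂μ₁ =
      ∫⁻ s, ((p.sup fun q => q.2 * f₂ q.1 s : ℝ≥0) : ℝ≥0∞) ^ α ∂μ₂

theorem NormsAgree.of_spectral {P : Measure Ω} {P₁ : Measure Ω₁} {P₂ : Measure Ω₂}
    [IsProbabilityMeasure P₁] [IsProbabilityMeasure P₂] {X : T → Ω → ℝ}
    {M₁ : Set S₁ → Ω₁ → ℝ≥0∞} {M₂ : Set S₂ → Ω₂ → ℝ≥0∞} (hα : 0 < α)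
    (hf₁ : IsSpectralRepresentation α P X μ₁ P₁ M₁ f₁) (hM₁ : IsFrechetSupMeasure α μ₁ P₁ M₁)
    (hf₂ : IsSpectralRepresentation α P X μ₂ P₂ M₂ f₂) (hM₂ : IsFrechetSupMeasure α μ₂ P₂ M₂) :
    NormsAgree α μ₁ μ₂ f₁ f₂ := by
  classical
  intro p
  have ha : ∀ q : ↥(p.filter fun q => 0 < q.2), 0 < q.1.2 := fun q => (Finset.mem_filter.1 q.2).2
  have h1 := hf₁.prob_le hM₁ hα (fun q : ↥(p.filter fun q => 0 < q.2) => q.1.1) ha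
  have h2 := hf₂.prob_le hM₂ hα (fun q : ↥(p.filter fun q => 0 < q.2) => q.1.1) ha
  have h3 := fun s => finsetSup_filter_pos p fun t => f₁ t s
  have h4 := fun s => finsetSup_filter_pos p fun t => f₂ t s
  simp only [h3, h4]
  exact expNeg_injective (h1.symm.trans h2)

theorem measurable_maxComb {ι : Sort*} [Countable ι] (t : ι → T) (a : ι → ℝ≥0)
    (hf : ∀ t, Measurable (f t)) : Measurable (maxComb t a f) :=
  Measurable.iSup fun i => ((hf (t i)).coe_nnreal_ennreal).const_mul _

theorem iSup_rpow {ι : Sort*} (hα : 0 < α) (x : ι → ℝ≥0∞) : (⨆ i, x i) ^ α = ⨆ i, x i ^ α :=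
  (ENNReal.orderIsoRpow α hα).map_iSup x

theorem lintegral_maxComb_eq_iSup {ι : Type*} [Countable ι] (hα : 0 < α)
    (hf : ∀ t, Measurable (f t)) (t : ι → T) (a : ι → ℝ≥0) :
    ∫⁻ s, maxComb t a f s ^ α ∂μ =
      ⨆ p : Finset ι, ∫⁻ s, ((p.sup fun i => a i * f (t i) s : ℝ≥0) : ℝ≥0∞) ^ α ∂μ := by
  rw [← lintegral_iSup_directed]
  · congr 1 with s
    rw [← iSup_rpow hα, maxComb, iSup_eq_iSup_finset]
    congr 2 with p
    rw [← Finset.sup_eq_iSup]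
    simpa only [ENNReal.rpow_one, ENNReal.coe_mul] using (coe_finsetSup_rpow one_pos p fun i => a i * f (t i) s).symm
  · intro p
    refine Measurable.aemeasurable ?_
    simp only [coe_finsetSup_rpow hα]
    simp only [Finset.sup_eq_iSup]
    exact Measurable.iSup fun i => Measurable.iSup fun _ =>
      (measurable_const.mul (hf (t i))).coe_nnreal_ennreal.pow_const α
  · refine Monotone.directed_le fun p q hpq s => ?_
    exact ENNReal.rpow_le_rpow (by exact_mod_cast Finset.sup_mono hpq) hα.le

theorem NormsAgree.lintegral_maxComb (h : NormsAgree α μ₁ μ₂ f₁ f₂) (hα : 0 < α)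
    (hf₁ : ∀ t, Measurable (f₁ t)) (hf₂ : ∀ t, Measurable (f₂ t)) {ι : Type*} [Countable ι]
    (t : ι → T) (a : ι → ℝ≥0) :
    ∫⁻ s, maxComb t a f₁ s ^ α ∂μ₁ = ∫⁻ s, maxComb t a f₂ s ^ α ∂μ₂ := by
  classical
  rw [lintegral_maxComb_eq_iSup hα hf₁, lintegral_maxComb_eq_iSup hα hf₂]
  congr 1 with p
  have := h (p.image fun i => (t i, a i))
  simpa only [Finset.sup_image, Function.comp_def] using this

/-- The difference quotients at `b = 1` of `∫ max (b u) v ^ α` recover the integral of `u ^ α`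
over `{v ≤ u}`. -/
theorem tendsto_lintegral_max_rpow (hα : 0 < α) {u v : S → ℝ≥0∞} (hu : Measurable u)
    (hv : Measurable v) (hui : ∫⁻ s, u s ^ α ∂μ ≠ ∞) (hvi : ∫⁻ s, v s ^ α ∂μ ≠ ∞) :
    Tendsto (fun n : ℕ =>
        (∫⁻ s, max (((1 + 1 / (n + 1) : ℝ≥0) : ℝ≥0∞) * u s) (v s) ^ α ∂μ -
          ∫⁻ s, max (((1 : ℝ≥0) : ℝ≥0∞) * u s) (v s) ^ α ∂μ) *
            ((((1 + 1 / (n + 1) : ℝ≥0) : ℝ≥0∞)) ^ α - 1)⁻¹)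
      atTop (𝓝 (∫⁻ s in {s | v s ≤ u s}, u s ^ α ∂μ)) := by
  set b : ℕ → ℝ≥0∞ := fun n => ((1 + 1 / (n + 1) : ℝ≥0) : ℝ≥0∞) with hb
  have hb1 : ∀ n, 1 < b n := by
    intro n
    have : (0 : ℝ≥0) < 1 / (n + 1) := by positivity
    exact ENNReal.coe_lt_coe.2 (lt_add_of_pos_right (1 : ℝ≥0) this)
  have hK1 : ∀ n, 1 < b n ^ α := fun n => ENNReal.one_lt_rpow (hb1 n) hα
  have hKtop : ∀ n, b n ^ α ≠ ∞ := fun n =>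
    ENNReal.rpow_ne_top_of_nonneg hα.le ENNReal.coe_ne_top
  have hk0 : ∀ n, b n ^ α - 1 ≠ 0 := fun n => (tsub_pos_of_lt (hK1 n)).ne'
  have hktop : ∀ n, b n ^ α - 1 ≠ ∞ := fun n => ENNReal.sub_ne_top (hKtop n)
  have hblim : Tendsto b atTop (𝓝 1) := by
    have : Tendsto (fun n : ℕ => (1 + 1 / (n + 1) : ℝ≥0)) atTop (𝓝 1) := by
      have := (tendsto_one_div_add_atTop_nhds_zero_nat (𝕜 := ℝ)).const_add 1
      rw [← NNReal.tendsto_coe]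
      simpa using this
    exact (ENNReal.continuous_coe.tendsto _).comp this
  have hmaxi : ∫⁻ s, max (u s) (v s) ^ α ∂μ ≠ ∞ := by
    refine ne_top_of_le_ne_top (ENNReal.add_ne_top.2 ⟨hui, hvi⟩) ?_
    rw [← lintegral_add_left (hu.pow_const α)]
    refine lintegral_mono fun s => ?_
    rcases max_choice (u s) (v s) with h | h <;> simp only [h]
    exacts [le_self_add, le_add_self]
  -- Where `v ≤ u` the quotient equals `u ^ α` for every `b > 1`; where `u < v` and `u` is finite it
  -- vanishes for `b` close to `1`; and it never exceeds `u ^ α`. Taking `b > 1` is what includes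
  -- the ties `u = v` in the limit.
  let F : ℕ → S → ℝ≥0∞ := fun n s =>
    (max (b n * u s) (v s) ^ α - max (u s) (v s) ^ α) * (b n ^ α - 1)⁻¹
  have hF : ∀ n, ∫⁻ s, F n s ∂μ = (∫⁻ s, max (b n * u s) (v s) ^ α ∂μ -
      ∫⁻ s, max (((1 : ℝ≥0) : ℝ≥0∞) * u s) (v s) ^ α ∂μ) * (b n ^ α - 1)⁻¹ := by
    intro n
    simp only [ENNReal.coe_one, one_mul]
    rw [lintegral_mul_const' _ _ (ENNReal.inv_ne_top.2 (hk0 n)),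
      lintegral_sub ((hu.max hv).pow_const α) hmaxi]
    refine Eventually.of_forall fun s => ENNReal.rpow_le_rpow (max_le_max ?_ le_rfl) hα.le
    exact le_mul_of_one_le_left' (hb1 n).le
  change Tendsto (fun n => (∫⁻ s, max (b n * u s) (v s) ^ α ∂μ -
      ∫⁻ s, max (((1 : ℝ≥0) : ℝ≥0∞) * u s) (v s) ^ α ∂μ) * (b n ^ α - 1)⁻¹) _ _
  simp only [← hF]
  rw [← lintegral_indicator (measurableSet_le hv hu)]
  refine tendsto_lintegral_of_dominated_convergence (fun s => u s ^ α) ?_ ?_ hui ?_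
  · intro n
    exact ((((hu.const_mul _).max hv).pow_const α).sub ((hu.max hv).pow_const α)).mul_const _
  · intro n
    refine Eventually.of_forall fun s => ?_
    change (_ - _) * _ ≤ _
    rw [← div_eq_mul_inv]
    refine ENNReal.div_le_of_le_mul ?_
    rw [tsub_le_iff_left]
    rcases le_total (b n * u s) (v s) with h | h
    · rw [max_eq_right h]
      exact (ENNReal.rpow_le_rpow (le_max_right _ _) hα.le).trans le_self_add
    · rw [max_eq_left h, ENNReal.mul_rpow_of_nonneg _ _ hα.le]
      calc b n ^ α * u s ^ α = (1 + (b n ^ α - 1)) * u s ^ α := by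
            rw [add_tsub_cancel_of_le (hK1 n).le]
        _ = u s ^ α + u s ^ α * (b n ^ α - 1) := by ring
        _ ≤ _ := add_le_add_left (ENNReal.rpow_le_rpow (le_max_left _ _) hα.le) _
  · have hufin : ∀ᵐ s ∂μ, u s ^ α < ∞ := ae_lt_top (hu.pow_const α) hui
    filter_upwards [hufin] with s hs
    have hus : u s ≠ ∞ := by
      intro h
      simp [h, ENNReal.top_rpow_of_pos hα] at hs
    by_cases h : v s ≤ u s
    · rw [indicator_of_mem (by exact h)]
      refine tendsto_const_nhds.congr fun n => ?_
      have h1 : v s ≤ b n * u s := h.trans (le_mul_of_one_le_left' (hb1 n).le)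
      simp only [F, max_eq_left h1, max_eq_left h]
      rw [ENNReal.mul_rpow_of_nonneg _ _ hα.le, ← div_eq_mul_inv,
        ENNReal.eq_div_iff (hk0 n) (hktop n), ENNReal.sub_mul (fun _ _ => hs.ne), one_mul]
    · rw [indicator_of_notMem (by exact h)]
      push Not at h
      have hlim : Tendsto (fun n => b n * u s) atTop (𝓝 (u s)) := by
        simpa using ENNReal.Tendsto.mul_const hblim (Or.inr hus)
      refine tendsto_const_nhds.congr' ?_
      filter_upwards [hlim.eventually (gt_mem_nhds h)] with n hn
      simp only [F, max_eq_right hn.le, max_eq_right h.le, tsub_self, zero_mul]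

/-- Both sides are limits of the same difference quotients, which involve only norms of countable
max-linear combinations. -/
theorem NormsAgree.setLIntegral_eq (h : NormsAgree α μ₁ μ₂ f₁ f₂) (hα : 0 < α)
    (hf₁ : ∀ t, Measurable (f₁ t)) (hf₂ : ∀ t, Measurable (f₂ t)) {ι κ : Type*} [Countable ι]
    [Countable κ] (t : ι → T) (a : ι → ℝ≥0) (u : κ → T) (c : κ → ℝ≥0)
    (hu : ∫⁻ s, maxComb u c f₁ s ^ α ∂μ₁ ≠ ∞) (ht : ∫⁻ s, maxComb t a f₁ s ^ α ∂μ₁ ≠ ∞) :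
    ∫⁻ s in {s | maxComb t a f₁ s ≤ maxComb u c f₁ s}, maxComb u c f₁ s ^ α ∂μ₁ =
      ∫⁻ s in {s | maxComb t a f₂ s ≤ maxComb u c f₂ s}, maxComb u c f₂ s ^ α ∂μ₂ := by
  have h1 := tendsto_lintegral_max_rpow hα (measurable_maxComb u c hf₁)
    (measurable_maxComb t a hf₁) hu ht
  rw [h.lintegral_maxComb hα hf₁ hf₂] at hu ht
  have h2 := tendsto_lintegral_max_rpow hα (measurable_maxComb u c hf₂)
    (measurable_maxComb t a hf₂) hu ht
  refine tendsto_nhds_unique h1 (h2.congr fun n => ?_)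
  simp only [max_mul_maxComb, h.lintegral_maxComb hα hf₁ hf₂]

/-- The intervals `[0, b]`, `b > 0`, of `[0, ∞]`. -/
def posIic : Set (Set ℝ≥0∞) := {A | ∃ b : ℝ≥0∞, 0 < b ∧ A = Iic b}

theorem isPiSystem_posIic : IsPiSystem posIic := by
  rintro _ ⟨b, hb, rfl⟩ _ ⟨c, hc, rfl⟩ -
  exact ⟨b ⊓ c, lt_min hb hc, Iic_inter_Iic⟩

/-- The endpoint `0` must be avoided because `1 / b` will serve as a finite coefficient; `{0}` is
recovered as the intersection of the `[0, 1 / n]`. The endpoint `∞` gives coefficient `0`, hence no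
constraint. -/
theorem borel_eq_generateFrom_posIic :
    ENNReal.measurableSpace = MeasurableSpace.generateFrom posIic := by
  apply le_antisymm
  · rw [BorelSpace.measurable_eq (α := ℝ≥0∞), borel_eq_generateFrom_Iic]
    refine MeasurableSpace.generateFrom_le ?_
    rintro _ ⟨b, rfl⟩
    rcases eq_or_ne b 0 with rfl | hb
    · have : Iic (0 : ℝ≥0∞) = ⋂ n : ℕ, Iic ((n : ℝ≥0∞)⁻¹) := by
        ext x
        simp only [mem_Iic, mem_iInter]
        exact ⟨fun h n => h.trans zero_le, fun h => ge_of_tendsto' ENNReal.tendsto_inv_nat_nhds_zero h⟩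
      rw [this]
      exact MeasurableSet.iInter fun n =>
        MeasurableSpace.measurableSet_generateFrom ⟨_, by simp, rfl⟩
    · exact MeasurableSpace.measurableSet_generateFrom ⟨b, pos_iff_ne_zero.2 hb, rfl⟩
  · refine MeasurableSpace.generateFrom_le ?_
    rintro _ ⟨b, -, rfl⟩
    exact measurableSet_Iic

theorem pi_eq_generateFrom_posIic :
    (MeasurableSpace.pi : MeasurableSpace (T → ℝ≥0∞)) =
      MeasurableSpace.generateFrom (squareCylinders fun _ : T => posIic) := by
  apply le_antisymm
  · refine iSup_le fun t => ?_
    rw [borel_eq_generateFrom_posIic, MeasurableSpace.comap_generateFrom]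
    refine MeasurableSpace.generateFrom_mono ?_
    rintro _ ⟨A, hA, rfl⟩
    exact ⟨{t}, fun _ => A, fun _ _ => hA, by ext; simp⟩
  · refine MeasurableSpace.generateFrom_le ?_
    rintro _ ⟨J, A, hA, rfl⟩
    refine MeasurableSet.pi J.countable_toSet fun t _ => ?_
    obtain ⟨b, -, hb⟩ := hA t (mem_univ t)
    rw [hb]
    exact measurableSet_Iic

/-- The ratios `f_t / f₀`. -/
def ratioMap (f : T → S → ℝ≥0) (f₀ : S → ℝ≥0∞) (s : S) (t : T) : ℝ≥0∞ := f t s / f₀ s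

theorem measurable_ratioMap (hf : ∀ t, Measurable (f t)) {f₀ : S → ℝ≥0∞} (hf₀ : Measurable f₀) :
    Measurable (ratioMap f f₀) :=
  measurable_pi_lambda _ fun t => (hf t).coe_nnreal_ennreal.div hf₀

theorem lintegral_maxComb_finite {ι : Type*} [Finite ι] (hα : 0 < α) (hf : ∀ t, f t ∈ LPlus α μ)
    (t : ι → T) (a : ι → ℝ≥0) : ∫⁻ s, maxComb t a f s ^ α ∂μ ≠ ∞ := by
  have := Fintype.ofFinite ι
  have hm : ∀ i, Measurable fun s => ((a i : ℝ≥0∞) * f (t i) s) ^ α := fun i =>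
    ((hf (t i)).1.coe_nnreal_ennreal.const_mul _).pow_const α
  have hle : ∫⁻ s, maxComb t a f s ^ α ∂μ ≤ ∑ i, ∫⁻ s, ((a i : ℝ≥0∞) * f (t i) s) ^ α ∂μ := by
    rw [← lintegral_finsetSum _ fun i _ => hm i]
    refine lintegral_mono fun s => ?_
    rw [maxComb, iSup_rpow hα]
    exact iSup_le fun i => Finset.single_le_sum
      (f := fun i => ((a i : ℝ≥0∞) * f (t i) s) ^ α) (fun _ _ => zero_le) (Finset.mem_univ i)
  refine ne_top_of_le_ne_top (ENNReal.sum_ne_top.2 fun i _ => ?_) hle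
  simp only [ENNReal.mul_rpow_of_nonneg _ _ hα.le]
  rw [lintegral_const_mul _ ((hf (t i)).1.coe_nnreal_ennreal.pow_const α)]
  exact ENNReal.mul_ne_top (ENNReal.rpow_ne_top_of_nonneg hα.le ENNReal.coe_ne_top) (hf (t i)).2.ne

/-- With `q = maxComb u c f` positive and finite, `f_t / q ≤ b_t` for all `t ∈ J` means `max_{t ∈ J}
f_t / b_t ≤ q`. Where `q = 0` both integrands vanish, and `q = ∞` only on a null set for the
density. -/
theorem map_ratioMap_pi_Iic (hα : 0 < α) (hm : ∀ t, Measurable (f t)) {κ : Type*} [Countable κ]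
    (u : κ → T) (c : κ → ℝ≥0) (hui : ∫⁻ s, maxComb u c f s ^ α ∂μ ≠ ∞) (J : Finset T)
    (b : T → ℝ≥0∞) (hb : ∀ t, 0 < b t) :
    ((μ.withDensity fun s => maxComb u c f s ^ α).map (ratioMap f (maxComb u c f)))
        ((J : Set T).pi fun t => Iic (b t)) =
      ∫⁻ s in {s | maxComb (fun t : J => (t : T)) (fun t : J => ((b t)⁻¹).toNNReal) f s ≤
        maxComb u c f s}, maxComb u c f s ^ α ∂μ := by
  have hm₀ := measurable_maxComb u c hm
  have hms : MeasurableSet ((J : Set T).pi fun t => Iic (b t)) :=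
    MeasurableSet.pi J.countable_toSet fun t _ => measurableSet_Iic
  rw [Measure.map_apply (measurable_ratioMap hm hm₀) hms,
    withDensity_apply _ ((measurable_ratioMap hm hm₀) hms),
    ← lintegral_indicator ((measurable_ratioMap hm hm₀) hms),
    ← lintegral_indicator (measurableSet_le (measurable_maxComb _ _ hm) hm₀)]
  refine lintegral_congr_ae ?_
  filter_upwards [ae_lt_top (hm₀.pow_const α) hui] with s hs
  have hs' : maxComb u c f s ≠ ∞ := by
    intro h
    simp [h, ENNReal.top_rpow_of_pos hα] at hs
  rcases eq_or_ne (maxComb u c f s) 0 with h0 | h0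
  · simp [indicator, h0, ENNReal.zero_rpow_of_pos hα]
  · have : s ∈ ratioMap f (maxComb u c f) ⁻¹' ((J : Set T).pi fun t => Iic (b t)) ↔
        s ∈ {s | maxComb (fun t : J => (t : T)) (fun t : J => ((b t)⁻¹).toNNReal) f s ≤
          maxComb u c f s} := by
      simp only [mem_preimage, Set.mem_pi, ratioMap, mem_Iic, mem_ofPred_eq]
      conv_rhs => rw [maxComb, iSup_le_iff]
      simp only [Subtype.forall, SetLike.mem_coe]
      refine forall₂_congr fun t _ => ?_
      change (f t s : ℝ≥0∞) / maxComb u c f s ≤ b t ↔ _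
      rw [ENNReal.coe_toNNReal (ENNReal.inv_ne_top.2 (hb t).ne'),
        ENNReal.div_le_iff h0 hs',
        mul_comm (b t)⁻¹, ← div_eq_mul_inv]
      rcases eq_or_ne (b t) ∞ with hbt | hbt
      · simp [hbt, ENNReal.top_mul h0]
      · rw [ENNReal.div_le_iff (hb t).ne' hbt, mul_comm]
    simp only [indicator, this]

/-- The spectral measures of two families whose max-linear combinations have the same norms
coincide. -/
theorem NormsAgree.map_ratioMap_eq (h : NormsAgree α μ₁ μ₂ f₁ f₂) (hα : 0 < α)
    (hf₁ : ∀ t, f₁ t ∈ LPlus α μ₁) (hf₂ : ∀ t, f₂ t ∈ LPlus α μ₂) {κ : Type*} [Countable κ]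
    (u : κ → T) (c : κ → ℝ≥0) (hu : ∫⁻ s, maxComb u c f₁ s ^ α ∂μ₁ ≠ ∞) :
    (μ₁.withDensity fun s => maxComb u c f₁ s ^ α).map (ratioMap f₁ (maxComb u c f₁)) =
      (μ₂.withDensity fun s => maxComb u c f₂ s ^ α).map (ratioMap f₂ (maxComb u c f₂)) := by
  have hm₁ := fun t => (hf₁ t).1
  have hm₂ := fun t => (hf₂ t).1
  have hu₂ : ∫⁻ s, maxComb u c f₂ s ^ α ∂μ₂ ≠ ∞ := by
    rwa [← h.lintegral_maxComb hα hm₁ hm₂]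
  have hfin : IsFiniteMeasure ((μ₁.withDensity fun s => maxComb u c f₁ s ^ α).map
      (ratioMap f₁ (maxComb u c f₁))) := by
    have : IsFiniteMeasure (μ₁.withDensity fun s => maxComb u c f₁ s ^ α) :=
      isFiniteMeasure_withDensity hu
    infer_instance
  have heq : ∀ (J : Finset T) (b : T → ℝ≥0∞), (∀ t, 0 < b t) →
      ((μ₁.withDensity fun s => maxComb u c f₁ s ^ α).map (ratioMap f₁ (maxComb u c f₁)))
        ((J : Set T).pi fun t => Iic (b t)) =
      ((μ₂.withDensity fun s => maxComb u c f₂ s ^ α).map (ratioMap f₂ (maxComb u c f₂)))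
        ((J : Set T).pi fun t => Iic (b t)) := by
    intro J b hb
    rw [map_ratioMap_pi_Iic hα hm₁ u c hu J b hb, map_ratioMap_pi_Iic hα hm₂ u c hu₂ J b hb]
    exact h.setLIntegral_eq hα hm₁ hm₂ _ _ u c hu (lintegral_maxComb_finite hα hf₁ _ _)
  refine ext_of_generate_finite _ pi_eq_generateFrom_posIic
    (isPiSystem_squareCylinders (fun _ => isPiSystem_posIic)
      fun _ => ⟨∞, ENNReal.zero_lt_top, by simp⟩) ?_ ?_
  · rintro _ ⟨J, A, hA, rfl⟩
    choose b hb hbA using fun t => hA t (mem_univ t)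
    obtain rfl : A = fun t => Iic (b t) := funext hbA
    exact heq J b hb
  -- The box without constraints yields equality of the total masses.
  · simpa using heq ∅ (fun _ => 1) fun _ => one_pos

end SpectralMeasure

/-! ### Isomorphisms of standard Borel spaces modulo null sets -/

/-- On the conull set `E` no two points share an image, so saturating `A ∩ E` along `g` changes `A`
only by a null set. A measure can thus be read off from its image under `g`. -/
theorem measure_eq_measure_preimage_image {S Y : Type*} [MeasurableSpace S] {m : Measure S} {g : S → Y} {E A : Set S}
    (hm : m Eᶜ = 0) (hinj : InjOn g E) : m A = m (g ⁻¹' (g '' (A ∩ E))) := by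
  have h : ∀ᵐ s ∂m, s ∈ E := by rwa [ae_iff]
  apply measure_congr
  filter_upwards [h] with s hs
  refine propext ⟨fun hA => ⟨s, ⟨hA, hs⟩, rfl⟩, ?_⟩
  rintro ⟨s', ⟨hA, hs'⟩, h⟩
  have : s' = s := hinj hs' hs h
  change s ∈ A
  rwa [← this]

theorem exists_measurableEquiv_of_eq {A B Y : Type*} [MeasurableSpace Y] [MeasurableSpace A] [MeasurableSpace B]
    {r₁ r₂ : Set Y} (h : r₁ = r₂) (e₁ : A ≃ᵐ r₁) (e₂ : B ≃ᵐ r₂) :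
    ∃ e : B ≃ᵐ A, ∀ x, (e₁ (e x) : Y) = e₂ x := by
  subst h
  exact ⟨e₂.trans e₁.symm, fun x => by simp⟩

open Classical in
theorem exists_measurableEquiv_extend {S₁ S₂ : Type*} [MeasurableSpace S₁]
    [MeasurableSpace S₂] {F₁ : Set S₁} {F₂ : Set S₂} (hF₁ : MeasurableSet F₁)
    (hF₂ : MeasurableSet F₂) (e : F₂ ≃ᵐ F₁) (e' : ↥F₂ᶜ ≃ᵐ ↥F₁ᶜ) :
    ∃ Φ : S₂ ≃ᵐ S₁, ∀ x : F₂, Φ x = e x := by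
  refine ⟨((MeasurableEquiv.sumCompl hF₂).symm.trans (e.sumCongr e')).trans
    (MeasurableEquiv.sumCompl hF₁), fun x => ?_⟩
  have : (MeasurableEquiv.sumCompl hF₂).symm x = Sum.inl x := by
    rw [MeasurableEquiv.symm_apply_eq]
    rfl
  simp only [MeasurableEquiv.coe_trans, Function.comp_apply, this]
  rfl

section BorelIsomorphism

variable {S S₁ S₂ Y : Type*} [MeasurableSpace S] [MeasurableSpace S₁] [MeasurableSpace S₂]
  [MeasurableSpace Y] [StandardBorelSpace S] [StandardBorelSpace S₁] [StandardBorelSpace S₂]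
  [MeasurableSpace.CountablySeparated Y]

theorem measure_ext_of_map_eq {m m' : Measure S} {g : S → Y} (hg : Measurable g) {E : Set S}
    (hE : MeasurableSet E) (hinj : InjOn g E) (hm : m Eᶜ = 0) (hm' : m' Eᶜ = 0)
    (hmap : m.map g = m'.map g) : m = m' := by
  ext A hA
  have hA' : MeasurableSet (g '' (A ∩ E)) :=
    (hA.inter hE).image_of_measurable_injOn hg (hinj.mono inter_subset_right)
  rw [measure_eq_measure_preimage_image hm hinj, measure_eq_measure_preimage_image hm' hinj,
    ← Measure.map_apply hg hA', hmap, Measure.map_apply hg hA']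

/-- On `E`, `u` factors as `U ∘ g` with `U` measurable, by Lusin–Souslin. The law of `(g, u)` then
lives on the graph of `U`, and so does that of `(g, v)`, which forces `v = U ∘ g`. -/
theorem ae_eq_of_map_prodMk_eq {m : Measure S} {g : S → Y} (hg : Measurable g) {E : Set S}
    (hE : MeasurableSet E) (hinj : InjOn g E) (hm : m Eᶜ = 0) {u v : S → ℝ≥0∞}
    (hu : Measurable u) (hv : Measurable v)
    (hmap : m.map (fun s => (g s, u s)) = m.map (fun s => (g s, v s))) : u =ᵐ[m] v := by
  have := hE.standardBorel
  have hemb : MeasurableEmbedding (E.domRestrict g) :=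
    (hg.comp measurable_subtype_coe).measurableEmbedding (injOn_iff_injective.1 hinj)
  obtain ⟨U, hU, hUg⟩ := hemb.exists_measurable_extend
    (hu.comp (measurable_subtype_coe : Measurable ((↑) : E → S))) fun _ => inferInstance
  have hUE : ∀ s ∈ E, U (g s) = u s := fun s hs => congrFun hUg ⟨s, hs⟩
  have hEae : ∀ᵐ s ∂m, s ∈ E := by rwa [ae_iff]
  have hgraph : MeasurableSet {p : Y × ℝ≥0∞ | p.2 = U p.1} :=
    measurableSet_eq_fun measurable_snd (hU.comp measurable_fst)
  have h1 : ∀ᵐ p ∂(m.map fun s => (g s, u s)), p.2 = U p.1 := by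
    rw [ae_map_iff (hg.prodMk hu).aemeasurable hgraph]
    filter_upwards [hEae] with s hs
    exact (hUE s hs).symm
  rw [hmap, ae_map_iff (hg.prodMk hv).aemeasurable hgraph] at h1
  filter_upwards [h1, hEae] with s hs hsE
  rw [← hUE s hsE]
  exact hs.symm

/-- Two measures on standard Borel spaces that have the same image under maps which are injective
modulo null sets are isomorphic modulo null sets. -/
theorem exists_measurableEquiv_of_map_eq {m₁ : Measure S₁} {m₂ : Measure S₂} {g₁ : S₁ → Y}
    {g₂ : S₂ → Y} (hg₁ : Measurable g₁) (hg₂ : Measurable g₂) {E₁ : Set S₁} {E₂ : Set S₂}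
    (hE₁ : MeasurableSet E₁) (hE₂ : MeasurableSet E₂) (hi₁ : InjOn g₁ E₁) (hi₂ : InjOn g₂ E₂)
    (hm₁ : m₁ E₁ᶜ = 0) (hm₂ : m₂ E₂ᶜ = 0) (hmap : m₁.map g₁ = m₂.map g₂) :
    ∃ F₁ ⊆ E₁, ∃ F₂ ⊆ E₂, MeasurableSet F₁ ∧ MeasurableSet F₂ ∧ m₁ F₁ᶜ = 0 ∧ m₂ F₂ᶜ = 0 ∧
      ∃ e : F₂ ≃ᵐ F₁, ∀ x, g₁ (e x) = g₂ x := by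
  have hR₁ : MeasurableSet (g₁ '' E₁) := hE₁.image_of_measurable_injOn hg₁ hi₁
  have hR₂ : MeasurableSet (g₂ '' E₂) := hE₂.image_of_measurable_injOn hg₂ hi₂
  -- Only the points whose image is also attained on the other side are kept; the rest is null
  -- because the image measures agree. Both restricted maps then have the same range.
  have hF₁ : MeasurableSet (E₁ ∩ g₁ ⁻¹' (g₂ '' E₂)) := hE₁.inter (hg₁ hR₂)
  have hF₂ : MeasurableSet (E₂ ∩ g₂ ⁻¹' (g₁ '' E₁)) := hE₂.inter (hg₂ hR₁)
  have hn₁ : m₁ (E₁ ∩ g₁ ⁻¹' (g₂ '' E₂))ᶜ = 0 := by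
    rw [compl_inter]
    refine measure_union_null hm₁ ?_
    rw [← preimage_compl, ← Measure.map_apply hg₁ hR₂.compl, hmap,
      Measure.map_apply hg₂ hR₂.compl]
    exact measure_mono_null (fun s hs hsE => hs ⟨s, hsE, rfl⟩) hm₂
  have hn₂ : m₂ (E₂ ∩ g₂ ⁻¹' (g₁ '' E₁))ᶜ = 0 := by
    rw [compl_inter]
    refine measure_union_null hm₂ ?_
    rw [← preimage_compl, ← Measure.map_apply hg₂ hR₁.compl, ← hmap,
      Measure.map_apply hg₁ hR₁.compl]
    exact measure_mono_null (fun s hs hsE => hs ⟨s, hsE, rfl⟩) hm₁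
  have := hF₁.standardBorel
  have := hF₂.standardBorel
  have hemb₁ : MeasurableEmbedding ((E₁ ∩ g₁ ⁻¹' (g₂ '' E₂)).domRestrict g₁) :=
    (hg₁.comp measurable_subtype_coe).measurableEmbedding
      (injOn_iff_injective.1 (hi₁.mono inter_subset_left))
  have hemb₂ : MeasurableEmbedding ((E₂ ∩ g₂ ⁻¹' (g₁ '' E₁)).domRestrict g₂) :=
    (hg₂.comp measurable_subtype_coe).measurableEmbedding
      (injOn_iff_injective.1 (hi₂.mono inter_subset_left))
  have hr : range ((E₁ ∩ g₁ ⁻¹' (g₂ '' E₂)).domRestrict g₁) =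
      range ((E₂ ∩ g₂ ⁻¹' (g₁ '' E₁)).domRestrict g₂) := by
    rw [range_domRestrict, range_domRestrict, image_inter_preimage, image_inter_preimage,
      inter_comm]
  obtain ⟨e, he⟩ := exists_measurableEquiv_of_eq hr hemb₁.equivRange hemb₂.equivRange
  refine ⟨_, inter_subset_left, _, inter_subset_left, hF₁, hF₂, hn₁, hn₂, e, fun x => ?_⟩
  simpa using he x

end BorelIsomorphism

/-! ### Existence of the point map -/

section PointMap

/-- The conventions `0 / 0 = 0` and `x / 0 = ∞` make this true also for `y = 0`, so the ratio
`σ`-field is handled through the sets `{c f_u < f_t}` without division. -/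
theorem coe_lt_div_iff (c x y : ℝ≥0) : (c : ℝ≥0∞) < (x : ℝ≥0∞) / y ↔ c * y < x := by
  rcases eq_or_ne y 0 with h0 | h0
  · rcases eq_or_ne x 0 with h1 | h1
    · simp [h0, h1]
    · simp [h0, h1, ENNReal.div_zero, pos_iff_ne_zero]
  · rw [ENNReal.lt_div_iff_mul_lt (by simp [h0]) (by simp)]
    norm_cast

theorem ratioField_induction {T S : Type*} {f : T → S → ℝ≥0} {p : Set S → Prop} (empty : p ∅)
    (compl : ∀ A, p A → p Aᶜ) (iUnion : ∀ A : ℕ → Set S, (∀ n, p (A n)) → p (⋃ n, A n))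
    (basic : ∀ t u (c : ℝ≥0), p {s | c * f u s < f t s}) {A : Set S}
    (hA : MeasurableSet[ratioField f] A) : p A := by
  let m : MeasurableSpace S :=
    { MeasurableSet' := p
      measurableSet_empty := empty
      measurableSet_compl := compl
      measurableSet_iUnion := iUnion }
  have hle : ratioField f ≤ m := by
    refine iSup₂_le fun t u => ?_
    rw [← measurable_iff_comap_le]
    refine measurable_of_Ioi fun c => ?_
    induction c with
    | top => simp
    | coe c =>
      have hset : (fun s => (f t s : ℝ≥0∞) / f u s) ⁻¹' Ioi (c : ℝ≥0∞) =
          {s | c * f u s < f t s} := by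
        ext s
        exact coe_lt_div_iff c (f t s) (f u s)
      rw [hset]
      exact basic t u c
  exact hle A hA

/-- Although `T` may be uncountable, a set in a generated `σ`-field depends on countably many
generators. -/
theorem exists_countable_of_measurableSet_ratioField {T S : Type*} (f : T → S → ℝ≥0) {A : Set S}
    (hA : MeasurableSet[ratioField f] A) :
    ∃ C : Set T, C.Countable ∧ ∀ x y, (∀ t ∈ C, ∀ u ∈ C,
      (f t x : ℝ≥0∞) / f u x = (f t y : ℝ≥0∞) / f u y) → (x ∈ A ↔ y ∈ A) := by
  refine ratioField_induction (p := fun A => ∃ C : Set T, C.Countable ∧ ∀ x y, (∀ t ∈ C, ∀ u ∈ C,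
      (f t x : ℝ≥0∞) / f u x = (f t y : ℝ≥0∞) / f u y) → (x ∈ A ↔ y ∈ A))
    ⟨∅, countable_empty, by simp⟩ ?_ ?_ ?_ hA
  · rintro A ⟨C, hC, h⟩
    exact ⟨C, hC, fun x y hxy => not_congr (h x y hxy)⟩
  · intro A hA
    choose C hC h using hA
    refine ⟨⋃ n, C n, countable_iUnion hC, fun x y hxy => ?_⟩
    simp only [mem_iUnion]
    refine exists_congr fun n => h n x y fun t ht u hu => ?_
    exact hxy t (mem_iUnion_of_mem n ht) u (mem_iUnion_of_mem n hu)
  · intro t u c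
    refine ⟨{t, u}, (countable_singleton u).insert t, fun x y hxy => ?_⟩
    rw [mem_ofPred_eq, mem_ofPred_eq, ← coe_lt_div_iff, ← coe_lt_div_iff,
      hxy t (by simp) u (by simp)]

theorem exists_seq_of_mem_closedMaxSpan {T S : Type*} [MeasurableSpace S] {α : ℝ} {μ : Measure S}
    {f : T → S → ℝ≥0} {g : S → ℝ≥0} (hg : g ∈ closedMaxSpan α μ f) :
    ∃ m : ℕ → S → ℝ≥0, (∀ n, m n ∈ maxSpan f) ∧
      Tendsto (fun n => rho α μ (m n) g) atTop (𝓝 0) := by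
  choose m hm hmg using fun n : ℕ => hg.2 ((n : ℝ≥0∞)⁻¹) (by simp)
  refine ⟨m, hm, tendsto_of_tendsto_of_tendsto_of_le_of_le tendsto_const_nhds
    ENNReal.tendsto_inv_nat_nhds_zero (fun _ => zero_le) fun n => (hmg n).le⟩

/-- Minimality reduces to countably many indices: those occurring in a sequence of max-linear
combinations tending to a function of full support, and those on which sets of the ratio `σ`-field
depend that agree, modulo null sets, with a separating sequence of Borel sets. -/
theorem IsMinimal.exists_countable {T S : Type*} [MeasurableSpace S] [StandardBorelSpace S]
    {α : ℝ} {μ : Measure S} {f : T → S → ℝ≥0} (hmin : IsMinimal α μ f) (hα : 0 < α)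
    (hf : ∀ t, Measurable (f t)) :
    ∃ C : Set T, C.Countable ∧ (∀ᵐ s ∂μ, ∃ t ∈ C, f t s ≠ 0) ∧
      ∃ N, MeasurableSet N ∧ μ N = 0 ∧ ∀ x ∉ N, ∀ y ∉ N, (∀ t ∈ C, ∀ u ∈ C,
        (f t x : ℝ≥0∞) / f u x = (f t y : ℝ≥0∞) / f u y) → x = y := by
  obtain ⟨f₀, hf₀, -, hsupp⟩ := hmin.support
  obtain ⟨m, hm, hlim⟩ := exists_seq_of_mem_closedMaxSpan hf₀
  choose k a t hk ha hma using hm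
  let C₀ : Set T := ⋃ n, range (t n)
  have hC₀ : C₀.Countable := countable_iUnion fun n => countable_range _
  have hpos : ∀ᵐ s ∂μ, ∃ t ∈ C₀, f t s ≠ 0 := by
    have hZ : MeasurableSet {s | ∀ t ∈ C₀, f t s = 0} := by
      have : {s | ∀ t ∈ C₀, f t s = 0} = ⋂ t ∈ C₀, f t ⁻¹' {0} := by
        ext s
        simp
      rw [this]
      exact MeasurableSet.biInter hC₀ fun t _ => hf t (measurableSet_singleton 0)
    -- On the common zero set of the chosen `f_t` every approximant vanishes, so the mass of `f₀ ^
    -- α` there is bounded by the approximation error, which tends to `0`.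
    have h1 : ∀ n, ∫⁻ s in {s | ∀ t ∈ C₀, f t s = 0}, (f₀ s : ℝ≥0∞) ^ α ∂μ ≤
        rho α μ (m n) f₀ := by
      intro n
      refine le_trans (setLIntegral_mono' hZ fun s hs => ?_) (setLIntegral_le_lintegral _ _)
      have hmz : m n s = 0 := by
        rw [hma n]
        refine le_antisymm (Finset.sup_le fun i _ => ?_) zero_le
        rw [hs (t n i) (mem_iUnion_of_mem n (mem_range_self i)), mul_zero]
      have := rpow_le_rpow_add_dist hα (f₀ s) (m n s)
      rw [hmz] at this ⊢
      rw [abs_sub_comm]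
      simpa [ENNReal.zero_rpow_of_pos hα] using this
    have h2 : ∫⁻ s in {s | ∀ t ∈ C₀, f t s = 0}, (f₀ s : ℝ≥0∞) ^ α ∂μ = 0 :=
      le_antisymm (ge_of_tendsto' hlim h1) zero_le
    rw [lintegral_eq_zero_iff (hf₀.1.1.coe_nnreal_ennreal.pow_const α),
      Filter.EventuallyEq, ae_restrict_iff' hZ] at h2
    have h3 : ∀ᵐ s ∂μ, f₀ s ≠ 0 := by
      rw [ae_iff]
      simpa [Function.support, compl_ofPred] using hsupp
    filter_upwards [h2, h3] with s hs2 hs3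
    by_contra hcon
    push Not at hcon
    have := hs2 hcon
    simp only [Pi.zero_apply, ENNReal.rpow_eq_zero_iff] at this
    rcases this with h | h
    · exact hs3 (by simpa using h.1)
    · exact absurd h.1 ENNReal.coe_ne_top
  obtain ⟨B, hB, hBsep⟩ := exists_seq_separating S (p := MeasurableSet) MeasurableSet.empty univ
  choose A hA hAB using fun n => hmin.ratio (B n) (hB n)
  choose C hC hCA using fun n => exists_countable_of_measurableSet_ratioField f (hA n)
  refine ⟨C₀ ∪ ⋃ n, C n, hC₀.union (countable_iUnion hC), ?_,
    toMeasurable μ (⋃ n, symmDiff (A n) (B n)), measurableSet_toMeasurable _ _, ?_, ?_⟩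
  · filter_upwards [hpos] with s ⟨t, ht, hts⟩
    exact ⟨t, Or.inl ht, hts⟩
  · rw [measure_toMeasurable]
    exact measure_iUnion_null hAB
  · intro x hx y hy hxy
    have hy' := notMem_subset (subset_toMeasurable μ _) hy
    refine hBsep x (mem_univ x) y (mem_univ y) fun n => ?_
    have h1 : ∀ z, z ∉ ⋃ n, symmDiff (A n) (B n) → (z ∈ A n ↔ z ∈ B n) := by
      intro z hz
      have := fun h => hz (mem_iUnion_of_mem n h)
      rw [mem_symmDiff] at this
      tauto
    rw [← h1 x (notMem_subset (subset_toMeasurable μ _) hx), ← h1 y hy']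
    refine hCA n x y fun t ht u hu => ?_
    exact hxy t (Or.inr (mem_iUnion_of_mem n ht)) u (Or.inr (mem_iUnion_of_mem n hu))

theorem exists_weights {T S : Type*} [MeasurableSpace S] {α : ℝ} (hα : 0 < α) {μ : Measure S}
    {f : T → S → ℝ≥0} (hf : ∀ t, f t ∈ LPlus α μ) {ι : Type*} [Countable ι] (u : ι → T) :
    ∃ c : ι → ℝ≥0, (∀ i, 0 < c i) ∧ ∫⁻ s, maxComb u c f s ^ α ∂μ ≠ ∞ := by
  obtain ⟨δ, hδ, hsum⟩ := ENNReal.exists_pos_tsum_mul_lt_of_countable one_ne_zero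
    (fun i : ι => ∫⁻ s, (f (u i) s : ℝ≥0∞) ^ α ∂μ) fun i => (hf (u i)).2.ne
  -- The `α`-th powers of these weights are a sequence `δ` that makes the norms summable, and a
  -- supremum is bounded by the sum.
  refine ⟨fun i => δ i ^ (1 / α), fun i => NNReal.rpow_pos (hδ i), ?_⟩
  refine ne_top_of_le_ne_top (hsum.trans ENNReal.one_lt_top).ne ?_
  have hm : ∀ i, Measurable fun s => (f (u i) s : ℝ≥0∞) ^ α := fun i =>
    (hf (u i)).1.coe_nnreal_ennreal.pow_const α
  simp only [← lintegral_mul_const _ (hm _)]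
  rw [← lintegral_tsum fun i => ((hm i).mul_const _).aemeasurable]
  refine lintegral_mono fun s => ?_
  rw [maxComb, iSup_rpow hα]
  refine iSup_le fun i => le_trans (le_of_eq ?_)
    (ENNReal.le_tsum (f := fun i => (f (u i) s : ℝ≥0∞) ^ α * (δ i : ℝ≥0∞)) i)
  rw [ENNReal.mul_rpow_of_nonneg _ _ hα.le, ← ENNReal.coe_rpow_of_nonneg _ hα.le, ← NNReal.rpow_mul,
    one_div, inv_mul_cancel₀ hα.ne', NNReal.rpow_one, mul_comm]

/-- The reference function cancels: `f_t / f_u = (f_t / q) / (f_u / q)` wherever `q` is positive and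
finite. -/
theorem injOn_ratioMap {T S : Type*} {f : T → S → ℝ≥0} {q : S → ℝ≥0∞} {C : Set T} {N E : Set S}
    (hN : ∀ x ∉ N, ∀ y ∉ N, (∀ t ∈ C, ∀ u ∈ C,
        (f t x : ℝ≥0∞) / f u x = (f t y : ℝ≥0∞) / f u y) → x = y)
    (hE : ∀ x ∈ E, x ∉ N ∧ q x ≠ 0 ∧ q x ≠ ∞) :
    InjOn (fun s (t : C) => ratioMap f q s t) E := by
  intro x hx y hy hxy
  obtain ⟨hxN, hx0, hxt⟩ := hE x hx
  obtain ⟨hyN, hy0, hyt⟩ := hE y hy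
  refine hN x hxN y hyN fun t ht u hu => ?_
  have key : ∀ z, q z ≠ 0 → q z ≠ ∞ →
      (f t z : ℝ≥0∞) / f u z = ratioMap f q z t / ratioMap f q z u := by
    intro z h0 ht
    simp only [ratioMap, div_eq_mul_inv (_ : ℝ≥0∞) (q z)]
    exact (ENNReal.mul_div_mul_right _ _ (ENNReal.inv_ne_zero.2 ht) (ENNReal.inv_ne_top.2 h0)).symm
  rw [key x hx0 hxt, key y hy0 hyt]
  have h1 : ratioMap f q x t = ratioMap f q y t := congrFun hxy ⟨t, ht⟩
  have h2 : ratioMap f q x u = ratioMap f q y u := congrFun hxy ⟨u, hu⟩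
  rw [h1, h2]

theorem maxComb_ne_zero {T S : Type*} {f : T → S → ℝ≥0} {C : Set T} {c : C → ℝ≥0}
    (hc : ∀ i, 0 < c i) {s : S} (hs : ∃ t ∈ C, f t s ≠ 0) :
    maxComb (fun t : C => (t : T)) c f s ≠ 0 := by
  obtain ⟨t, ht, hts⟩ := hs
  have h : (c ⟨t, ht⟩ : ℝ≥0∞) * f t s ≤ maxComb (fun t : C => (t : T)) c f s :=
    le_iSup (fun i : C => (c i : ℝ≥0∞) * f i s) ⟨t, ht⟩
  refine (lt_of_lt_of_le ?_ h).ne'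
  exact ENNReal.mul_pos (by simpa using (hc ⟨t, ht⟩).ne') (by simpa using hts)

/-- The weight of the point map. -/
def pointWeight {S₁ S₂ : Type*} (q₁ : S₁ → ℝ≥0∞) (q₂ : S₂ → ℝ≥0∞) (Φ : S₂ → S₁) (s : S₂) : ℝ≥0 :=
  open Classical in if (q₂ s ≠ 0 ∧ q₂ s ≠ ∞) ∧ (q₁ (Φ s) ≠ 0 ∧ q₁ (Φ s) ≠ ∞) then
    (q₂ s / q₁ (Φ s)).toNNReal else 1

/-- The identity `q₁ ^ α μ₁ = Φ_* (q₂ ^ α μ₂)` is divided by `q₁ ^ α`, which is positive and finite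
almost everywhere. -/
theorem comap_eq_withDensity {S₁ S₂ : Type*} [MeasurableSpace S₁] [MeasurableSpace S₂] {α : ℝ}
    {μ₁ : Measure S₁} {μ₂ : Measure S₂} {q₁ : S₁ → ℝ≥0∞} {q₂ : S₂ → ℝ≥0∞} (hα : 0 < α) (hq₁ : Measurable q₁)
    (hq₂ : Measurable q₂) (h₁ : ∀ᵐ s ∂μ₁, q₁ s ≠ 0 ∧ q₁ s ≠ ∞) (Φ : S₂ ≃ᵐ S₁)
    (hgood : ∀ᵐ s ∂μ₂, (q₂ s ≠ 0 ∧ q₂ s ≠ ∞) ∧ (q₁ (Φ s) ≠ 0 ∧ q₁ (Φ s) ≠ ∞))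
    (hmap : (μ₁.withDensity fun s => q₁ s ^ α) = (μ₂.withDensity fun s => q₂ s ^ α).map Φ) :
    μ₁.comap Φ = μ₂.withDensity fun s => (pointWeight q₁ q₂ Φ s : ℝ≥0∞) ^ α := by
  have hw : Measurable fun s => (q₁ s ^ α)⁻¹ := (hq₁.pow_const α).inv
  have hinv : (μ₁.withDensity fun s => q₁ s ^ α).withDensity (fun s => (q₁ s ^ α)⁻¹) = μ₁ := by
    refine withDensity_inv_same (hq₁.pow_const α) ?_ ?_
    · filter_upwards [h₁] with s hs
      exact (ENNReal.rpow_pos (pos_iff_ne_zero.2 hs.1) hs.2).ne'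
    · filter_upwards [h₁] with s hs
      exact ENNReal.rpow_ne_top_of_nonneg hα.le hs.2
  ext A hA
  rw [Φ.measurableEmbedding.comap_apply, ← hinv, hmap,
    withDensity_apply _ (Φ.measurableEmbedding.measurableSet_image.2 hA),
    setLIntegral_map (Φ.measurableEmbedding.measurableSet_image.2 hA) hw Φ.measurable,
    preimage_image_eq _ Φ.injective,
    setLIntegral_withDensity_eq_setLIntegral_mul (g := fun s => (q₁ (Φ s) ^ α)⁻¹) _
      (hq₂.pow_const α) (hw.comp Φ.measurable) hA,
    withDensity_apply _ hA]
  refine lintegral_congr_ae (ae_restrict_of_ae ?_)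
  filter_upwards [hgood] with s hs
  rw [pointWeight, if_pos hs, ENNReal.coe_toNNReal (ENNReal.div_ne_top hs.1.2 hs.2.1),
    ENNReal.div_rpow_of_nonneg _ _ hα.le, div_eq_mul_inv]
  rfl

variable {T S₁ S₂ : Type*} [MeasurableSpace S₁] [MeasurableSpace S₂] [StandardBorelSpace S₁]
  [StandardBorelSpace S₂] {α : ℝ} {μ₁ : Measure S₁} {μ₂ : Measure S₂}
  {f₁ : T → S₁ → ℝ≥0} {f₂ : T → S₂ → ℝ≥0}

/-- Two minimal families with the same norms of max-linear combinations are related by a point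
map. The sets `K₁`, `K₂` are left out before the point map is extended to all points. -/
theorem exists_pointMap (hα : 0 < α) [SigmaFinite μ₂] (h : NormsAgree α μ₁ μ₂ f₁ f₂)
    (hf₁ : ∀ t, f₁ t ∈ LPlus α μ₁) (hf₂ : ∀ t, f₂ t ∈ LPlus α μ₂)
    (hmin₁ : IsMinimal α μ₁ f₁) (hmin₂ : IsMinimal α μ₂ f₂) {K₁ : Set S₁} {K₂ : Set S₂}
    (hK₁ : MeasurableSet K₁) (hK₂ : MeasurableSet K₂) (hKn₁ : μ₁ K₁ = 0) (hKn₂ : μ₂ K₂ = 0)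
    (hglue : ∀ F₁ F₂, MeasurableSet F₁ → MeasurableSet F₂ → F₁ ⊆ K₁ᶜ → F₂ ⊆ K₂ᶜ → μ₁ F₁ᶜ = 0 →
      μ₂ F₂ᶜ = 0 → (F₂ ≃ᵐ F₁) → Nonempty (↥F₂ᶜ ≃ᵐ ↥F₁ᶜ)) :
    ∃ (Φ : S₂ ≃ᵐ S₁) (w : S₂ → ℝ≥0), IsPointMapRelation α μ₁ μ₂ f₁ f₂ Φ w := by
  have hm₁ := fun t => (hf₁ t).1
  have hm₂ := fun t => (hf₂ t).1
  obtain ⟨C₁, hC₁, hs₁, N₁, hNm₁, hN₁, hsep₁⟩ := hmin₁.exists_countable hα hm₁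
  obtain ⟨C₂, hC₂, hs₂, N₂, hNm₂, hN₂, hsep₂⟩ := hmin₂.exists_countable hα hm₂
  -- The same indices and weights must serve both families, so that `q₁` and `q₂` are the same
  -- max-linear combination.
  let C := C₁ ∪ C₂
  have : Countable C := (hC₁.union hC₂).to_subtype
  let u : C → T := fun t => t
  obtain ⟨c, hc, hq₁⟩ := exists_weights hα hf₁ u
  have hq₂ : ∫⁻ s, maxComb u c f₂ s ^ α ∂μ₂ ≠ ∞ := by rwa [← h.lintegral_maxComb hα hm₁ hm₂]
  set q₁ := maxComb u c f₁ with hq₁def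
  set q₂ := maxComb u c f₂ with hq₂def
  have hqm₁ : Measurable q₁ := measurable_maxComb u c hm₁
  have hqm₂ : Measurable q₂ := measurable_maxComb u c hm₂
  have hgood₁ : ∀ᵐ s ∂μ₁, q₁ s ≠ 0 ∧ q₁ s ≠ ∞ := by
    filter_upwards [hs₁, ae_lt_top (hqm₁.pow_const α) hq₁] with s ⟨t, ht, hts⟩ hs'
    refine ⟨maxComb_ne_zero hc ⟨t, Or.inl ht, hts⟩, fun hs => ?_⟩
    simp [hs, ENNReal.top_rpow_of_pos hα] at hs'
  have hgood₂ : ∀ᵐ s ∂μ₂, q₂ s ≠ 0 ∧ q₂ s ≠ ∞ := by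
    filter_upwards [hs₂, ae_lt_top (hqm₂.pow_const α) hq₂] with s ⟨t, ht, hts⟩ hs'
    refine ⟨maxComb_ne_zero hc ⟨t, Or.inr ht, hts⟩, fun hs => ?_⟩
    simp [hs, ENNReal.top_rpow_of_pos hα] at hs'
  have hG := h.map_ratioMap_eq hα hf₁ hf₂ u c hq₁
  set m₁ := μ₁.withDensity fun s => q₁ s ^ α with hm₁def
  set m₂ := μ₂.withDensity fun s => q₂ s ^ α with hm₂def
  have hac₁ : m₁ ≪ μ₁ := withDensity_absolutelyContinuous _ _
  have hac₂ : m₂ ≪ μ₂ := withDensity_absolutelyContinuous _ _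
  have hac₁' : μ₁ ≪ m₁ := by
    refine withDensity_absolutelyContinuous' (hqm₁.pow_const α).aemeasurable ?_
    filter_upwards [hgood₁] with s hs
    exact (ENNReal.rpow_pos (pos_iff_ne_zero.2 hs.1) hs.2).ne'
  have hac₂' : μ₂ ≪ m₂ := by
    refine withDensity_absolutelyContinuous' (hqm₂.pow_const α).aemeasurable ?_
    filter_upwards [hgood₂] with s hs
    exact (ENNReal.rpow_pos (pos_iff_ne_zero.2 hs.1) hs.2).ne'
  have hGm₁ : Measurable (ratioMap f₁ q₁) := measurable_ratioMap hm₁ hqm₁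
  have hGm₂ : Measurable (ratioMap f₂ q₂) := measurable_ratioMap hm₂ hqm₂
  -- Restriction to countably many coordinates gives a countably separated target, as Lusin–Souslin
  -- needs.
  let r : (T → ℝ≥0∞) → (C → ℝ≥0∞) := fun x t => x t
  have hr : Measurable r := measurable_pi_lambda _ fun t => measurable_pi_apply _
  have hg₁ : Measurable (r ∘ ratioMap f₁ q₁) := hr.comp hGm₁
  have hg₂ : Measurable (r ∘ ratioMap f₂ q₂) := hr.comp hGm₂
  have hgmap : m₁.map (r ∘ ratioMap f₁ q₁) = m₂.map (r ∘ ratioMap f₂ q₂) := by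
    rw [← Measure.map_map hr hGm₁, ← Measure.map_map hr hGm₂, hG]
  let E₁ : Set S₁ := {s | q₁ s ≠ 0 ∧ q₁ s ≠ ∞} ∩ (N₁ᶜ ∩ K₁ᶜ)
  let E₂ : Set S₂ := {s | q₂ s ≠ 0 ∧ q₂ s ≠ ∞} ∩ (N₂ᶜ ∩ K₂ᶜ)
  have hgm₁ : MeasurableSet {s | q₁ s ≠ 0 ∧ q₁ s ≠ ∞} :=
    hqm₁ ((measurableSet_singleton 0).compl.inter (measurableSet_singleton ∞).compl)
  have hgm₂ : MeasurableSet {s | q₂ s ≠ 0 ∧ q₂ s ≠ ∞} :=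
    hqm₂ ((measurableSet_singleton 0).compl.inter (measurableSet_singleton ∞).compl)
  have hE₁ : MeasurableSet E₁ := hgm₁.inter (hNm₁.compl.inter hK₁.compl)
  have hE₂ : MeasurableSet E₂ := hgm₂.inter (hNm₂.compl.inter hK₂.compl)
  have hn₁ : m₁ E₁ᶜ = 0 := by
    refine hac₁ ?_
    rw [compl_inter, compl_inter, compl_compl, compl_compl]
    exact measure_union_null hgood₁ (measure_union_null hN₁ hKn₁)
  have hn₂ : m₂ E₂ᶜ = 0 := by
    refine hac₂ ?_
    rw [compl_inter, compl_inter, compl_compl, compl_compl]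
    exact measure_union_null hgood₂ (measure_union_null hN₂ hKn₂)
  have hi₁ : InjOn (r ∘ ratioMap f₁ q₁) E₁ := by
    refine injOn_ratioMap (C := C) (N := N₁) (fun x hx y hy hxy => ?_)
      fun x hx => ⟨hx.2.1, hx.1⟩
    exact hsep₁ x hx y hy fun t ht u hu => hxy t (Or.inl ht) u (Or.inl hu)
  have hi₂ : InjOn (r ∘ ratioMap f₂ q₂) E₂ := by
    refine injOn_ratioMap (C := C) (N := N₂) (fun x hx y hy hxy => ?_)
      fun x hx => ⟨hx.2.1, hx.1⟩
    exact hsep₂ x hx y hy fun t ht u hu => hxy t (Or.inr ht) u (Or.inr hu)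
  obtain ⟨F₁, hFE₁, F₂, hFE₂, hF₁, hF₂, hFn₁, hFn₂, e, he⟩ :=
    exists_measurableEquiv_of_map_eq hg₁ hg₂ hE₁ hE₂ hi₁ hi₂ hn₁ hn₂ hgmap
  obtain ⟨e'⟩ := hglue F₁ F₂ hF₁ hF₂ (fun s hs => (hFE₁ hs).2.2) (fun s hs => (hFE₂ hs).2.2)
    (hac₁' hFn₁) (hac₂' hFn₂) e
  obtain ⟨Φ, hΦ⟩ := exists_measurableEquiv_extend hF₁ hF₂ e e'
  have hF₂ae : ∀ᵐ s ∂m₂, s ∈ F₂ := by rwa [ae_iff]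
  have hΦF : ∀ s ∈ F₂, Φ s ∈ F₁ := by
    intro s hs
    rw [hΦ ⟨s, hs⟩]
    exact (e _).2
  have hΦg : ∀ s ∈ F₂, r (ratioMap f₁ q₁ (Φ s)) = r (ratioMap f₂ q₂ s) := by
    intro s hs
    rw [hΦ ⟨s, hs⟩]
    exact he _
  -- `Φ` intertwines the ratio maps almost everywhere, so both measures have the same image under a
  -- map that is injective on `F₁`.
  have hmap : m₁ = m₂.map Φ := by
    refine measure_ext_of_map_eq hg₁ hF₁ (hi₁.mono hFE₁) hFn₁ ?_ ?_
    · rw [Φ.map_apply]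
      exact measure_mono_null (fun s hs hsF => hs (hΦF s hsF)) hFn₂
    · rw [Measure.map_map hg₁ Φ.measurable, hgmap]
      refine Measure.map_congr ?_
      filter_upwards [hF₂ae] with s hs
      exact (hΦg s hs).symm
  have hgood : ∀ᵐ s ∂μ₂, (q₂ s ≠ 0 ∧ q₂ s ≠ ∞) ∧ (q₁ (Φ s) ≠ 0 ∧ q₁ (Φ s) ≠ ∞) := by
    filter_upwards [hac₂'.ae_le hF₂ae] with s hs
    exact ⟨(hFE₂ hs).1, (hFE₁ (hΦF s hs)).1⟩
  have hcomap := comap_eq_withDensity hα hqm₁ hqm₂ hgood₁ Φ hgood hmap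
  have hwm : Measurable (pointWeight q₁ q₂ Φ) := by
    refine Measurable.ite (hgm₂.inter (Φ.measurable hgm₁)) ?_ measurable_const
    exact (hqm₂.div (hqm₁.comp Φ.measurable)).ennreal_toNNReal
  refine ⟨Φ, pointWeight q₁ q₂ Φ, Φ.measurable, Φ.bijective, hwm, ?_, ?_, ?_, ?_⟩
  · intro s
    unfold pointWeight
    split_ifs with hs
    · exact ENNReal.toNNReal_pos (ENNReal.div_pos hs.1.1 hs.2.2).ne'
        (ENNReal.div_ne_top hs.1.2 hs.2.1)
    · exact one_pos
  · intro t
    -- An index `t` outside `C` is not controlled by the construction of `Φ`. The spectral measures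
    -- agree on all coordinates, however, so the coordinate `t` is the same function of the
    -- coordinates in `C` for both families.
    have hGt : (fun s => ratioMap f₂ q₂ s t) =ᵐ[m₂] fun s => ratioMap f₁ q₁ (Φ s) t := by
      refine ae_eq_of_map_prodMk_eq hg₂ hF₂ (hi₂.mono hFE₂) hFn₂
        ((measurable_pi_apply t).comp hGm₂)
        (((measurable_pi_apply t).comp hGm₁).comp Φ.measurable) ?_
      let p : (T → ℝ≥0∞) → (C → ℝ≥0∞) × ℝ≥0∞ := fun x => (r x, x t)
      have hp : Measurable p := hr.prodMk (measurable_pi_apply t)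
      calc m₂.map (p ∘ ratioMap f₂ q₂) = m₁.map (p ∘ ratioMap f₁ q₁) := by
            rw [← Measure.map_map hp hGm₁, ← Measure.map_map hp hGm₂, hG]
        _ = m₂.map ((p ∘ ratioMap f₁ q₁) ∘ Φ) := by
            rw [hmap, Measure.map_map (hp.comp hGm₁) Φ.measurable]
        _ = _ := by
            refine Measure.map_congr ?_
            filter_upwards [hF₂ae] with s hs
            exact Prod.ext (hΦg s hs) rfl
    filter_upwards [hgood, hac₂'.ae_le hGt] with s hs hst
    rw [pointWeight, if_pos hs, ← ENNReal.coe_inj, ENNReal.coe_mul,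
      ENNReal.coe_toNNReal (ENNReal.div_ne_top hs.1.2 hs.2.1)]
    simp only [ratioMap] at hst
    calc (f₂ t s : ℝ≥0∞) = f₂ t s / q₂ s * q₂ s := (ENNReal.div_mul_cancel hs.1.1 hs.1.2).symm
      _ = q₂ s / q₁ (Φ s) * f₁ t (Φ s) := by
        rw [hst, div_eq_mul_inv, div_eq_mul_inv]
        ring
  · rw [hcomap]
    exact withDensity_absolutelyContinuous _ _
  · rw [hcomap]
    exact Measure.rnDeriv_withDensity _ (hwm.coe_nnreal_ennreal.pow_const α)

end PointMap

/-! ### Max-linear isometries -/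

section Isometry

variable {T S S₁ S₂ : Type*} [MeasurableSpace S] [MeasurableSpace S₁] [MeasurableSpace S₂]
  {α : ℝ} {μ : Measure S} {μ₁ : Measure S₁} {μ₂ : Measure S₂}

theorem rpow_coe_injective (hα : 0 < α) {x y : ℝ≥0} (h : (x : ℝ≥0∞) ^ α = (y : ℝ≥0∞) ^ α) :
    x = y :=
  ENNReal.coe_injective (ENNReal.rpow_left_injective hα.ne' h)

/-- This is `|a - b| + a + b = 2 max a b`. It expresses `ρ` through norms and maxima, which is why
max-linear isometries preserve `ρ`. -/
theorem dist_rpow_add_add (hα : 0 < α) (x y : ℝ≥0) :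
    ENNReal.ofReal |(x : ℝ) ^ α - (y : ℝ) ^ α| + ((x : ℝ≥0∞) ^ α + (y : ℝ≥0∞) ^ α) =
      2 * ((max x y : ℝ≥0) : ℝ≥0∞) ^ α := by
  have hx : (0 : ℝ) ≤ (x : ℝ) ^ α := by positivity
  have hy : (0 : ℝ) ≤ (y : ℝ) ^ α := by positivity
  rw [← ofReal_coe_rpow hα, ← ofReal_coe_rpow hα, ← ofReal_coe_rpow hα,
    ← ENNReal.ofReal_add hx hy, ← ENNReal.ofReal_add (abs_nonneg _) (by positivity),
    ← ENNReal.ofReal_ofNat 2, ← ENNReal.ofReal_mul (by positivity)]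
  congr 1
  rcases le_total x y with h | h
  · have : (x : ℝ) ^ α ≤ (y : ℝ) ^ α := Real.rpow_le_rpow x.2 (by exact_mod_cast h) hα.le
    rw [max_eq_right h, abs_of_nonpos (by linarith)]
    ring
  · have : (y : ℝ) ^ α ≤ (x : ℝ) ^ α := Real.rpow_le_rpow y.2 (by exact_mod_cast h) hα.le
    rw [max_eq_left h, abs_of_nonneg (by linarith)]
    ring

theorem rho_add_add (hα : 0 < α) {f g : S → ℝ≥0} (hf : Measurable f) (hg : Measurable g) :
    rho α μ f g + (∫⁻ s, (f s : ℝ≥0∞) ^ α ∂μ + ∫⁻ s, (g s : ℝ≥0∞) ^ α ∂μ) =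
      2 * ∫⁻ s, ((max (f s) (g s) : ℝ≥0) : ℝ≥0∞) ^ α ∂μ := by
  rw [rho, ← lintegral_add_left (hf.coe_nnreal_ennreal.pow_const α),
    ← lintegral_add_left (measurable_dist_rpow α hf hg),
    ← lintegral_const_mul' _ _ ENNReal.ofNat_ne_top]
  exact lintegral_congr fun s => dist_rpow_add_add hα _ _

theorem rho_triangle {f g h : S → ℝ≥0} (hf : Measurable f) (hg : Measurable g) :
    rho α μ f h ≤ rho α μ f g + rho α μ g h := by
  rw [rho, rho, rho, ← lintegral_add_left (measurable_dist_rpow α hf hg)]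
  refine lintegral_mono fun s => ?_
  rw [← ENNReal.ofReal_add (abs_nonneg _) (abs_nonneg _)]
  exact ENNReal.ofReal_le_ofReal (abs_sub_le _ _ _)

theorem ae_eq_of_rho_eq_zero (hα : 0 < α) {f g : S → ℝ≥0} (hf : Measurable f)
    (hg : Measurable g) (h : rho α μ f g = 0) : f =ᵐ[μ] g := by
  rw [rho, lintegral_eq_zero_iff (measurable_dist_rpow α hf hg)] at h
  filter_upwards [h] with s hs
  have h1 : |(f s : ℝ) ^ α - (g s : ℝ) ^ α| ≤ 0 := by simpa using hs
  have h2 : (f s : ℝ) ^ α = (g s : ℝ) ^ α := sub_eq_zero.1 (abs_nonpos_iff.1 h1)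
  apply rpow_coe_injective hα
  rw [← ofReal_coe_rpow hα, ← ofReal_coe_rpow hα, h2]

theorem LPlus.max (hα : 0 < α) {f g : S → ℝ≥0} (hf : f ∈ LPlus α μ) (hg : g ∈ LPlus α μ) :
    (fun s => max (f s) (g s)) ∈ LPlus α μ := by
  refine ⟨hf.1.max hg.1, ?_⟩
  have h := rho_add_add (μ := μ) hα hf.1 hg.1
  have h1 : ∫⁻ s, ((Max.max (f s) (g s) : ℝ≥0) : ℝ≥0∞) ^ α ∂μ ≤
      ∫⁻ s, (f s : ℝ≥0∞) ^ α ∂μ + ∫⁻ s, (g s : ℝ≥0∞) ^ α ∂μ := by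
    rw [← lintegral_add_left (hf.1.coe_nnreal_ennreal.pow_const α)]
    refine lintegral_mono fun s => ?_
    rcases max_choice (f s) (g s) with h | h <;> simp only [h]
    exacts [le_self_add, le_add_self]
  exact h1.trans_lt (ENNReal.add_lt_top.2 ⟨hf.2, hg.2⟩)

theorem LPlus.mono (hα : 0 < α) {f g : S → ℝ≥0} (hf : Measurable f) (hg : g ∈ LPlus α μ)
    (hfg : ∀ s, f s ≤ g s) : f ∈ LPlus α μ :=
  ⟨hf, (lintegral_mono fun s => ENNReal.rpow_le_rpow
    (by exact_mod_cast hfg s) hα.le).trans_lt hg.2⟩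

theorem LPlus.const_mul (hα : 0 < α) {f : S → ℝ≥0} (hf : f ∈ LPlus α μ) (c : ℝ≥0) :
    (fun s => c * f s) ∈ LPlus α μ := by
  refine ⟨hf.1.const_mul c, ?_⟩
  simp only [ENNReal.coe_mul, ENNReal.mul_rpow_of_nonneg _ _ hα.le]
  rw [lintegral_const_mul _ (hf.1.coe_nnreal_ennreal.pow_const α)]
  exact ENNReal.mul_lt_top (ENNReal.rpow_lt_top_of_nonneg hα.le ENNReal.coe_ne_top) hf.2

theorem IsMaxLinearIsometryOn.lintegral_eq {F : Set (S₁ → ℝ≥0)} {V : (S₁ → ℝ≥0) → (S₂ → ℝ≥0)}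
    (hV : IsMaxLinearIsometryOn α μ₁ μ₂ F V) (hα : 0 < α) {f : S₁ → ℝ≥0} (hf : f ∈ F) :
    ∫⁻ s, (V f s : ℝ≥0∞) ^ α ∂μ₂ = ∫⁻ s, (f s : ℝ≥0∞) ^ α ∂μ₁ :=
  ENNReal.rpow_left_injective (one_div_ne_zero hα.ne') (hV.norm_eq f hf)

theorem IsMaxLinearIsometryOn.max {F : Set (S₁ → ℝ≥0)} {V : (S₁ → ℝ≥0) → (S₂ → ℝ≥0)}
    (hV : IsMaxLinearIsometryOn α μ₁ μ₂ F V) {f g : S₁ → ℝ≥0} (hf : f ∈ F) (hg : g ∈ F) :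
    V (fun s => max (f s) (g s)) =ᵐ[μ₂] fun s => max (V f s) (V g s) := by
  simpa using hV.maxLinear f hf g hg 1 1

theorem IsMaxLinearIsometryOn.const_mul {F : Set (S₁ → ℝ≥0)} {V : (S₁ → ℝ≥0) → (S₂ → ℝ≥0)}
    (hV : IsMaxLinearIsometryOn α μ₁ μ₂ F V) {f : S₁ → ℝ≥0} (hf : f ∈ F) (c : ℝ≥0) :
    V (fun s => c * f s) =ᵐ[μ₂] fun s => c * V f s := by
  simpa using hV.maxLinear f hf f hf c 0

theorem IsMaxLinearIsometryOn.rho_eq {F : Set (S₁ → ℝ≥0)} {V : (S₁ → ℝ≥0) → (S₂ → ℝ≥0)}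
    (hV : IsMaxLinearIsometryOn α μ₁ μ₂ F V) (hα : 0 < α) (hF : F ⊆ LPlus α μ₁)
    {f g : S₁ → ℝ≥0} (hf : f ∈ F) (hg : g ∈ F) (hfg : (fun s => Max.max (f s) (g s)) ∈ F) :
    rho α μ₂ (V f) (V g) = rho α μ₁ f g := by
  have h1 := rho_add_add (μ := μ₁) hα (hF hf).1 (hF hg).1
  have h2 := rho_add_add (μ := μ₂) hα (hV.mapsTo f hf).1 (hV.mapsTo g hg).1
  have h3 : ∫⁻ s, ((Max.max (V f s) (V g s) : ℝ≥0) : ℝ≥0∞) ^ α ∂μ₂ =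
      ∫⁻ s, ((Max.max (f s) (g s) : ℝ≥0) : ℝ≥0∞) ^ α ∂μ₁ := by
    rw [← hV.lintegral_eq hα hfg]
    refine lintegral_congr_ae ?_
    filter_upwards [hV.max hf hg] with s hs
    rw [hs]
  rw [hV.lintegral_eq hα hf, hV.lintegral_eq hα hg, h3, ← h1] at h2
  exact (ENNReal.add_left_inj (ENNReal.add_ne_top.2 ⟨(hF hf).2.ne, (hF hg).2.ne⟩)).1 h2

/-! ### The closed max-linear span -/

theorem mem_maxSpan_single {T S : Type*} (f : T → S → ℝ≥0) (t : T) {a : ℝ≥0} (ha : 0 < a) :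
    (fun s => a * f t s) ∈ maxSpan f :=
  ⟨1, fun _ => a, fun _ => t, one_pos, fun _ => ha, by simp⟩

theorem maxSpan_max {T S : Type*} {f : T → S → ℝ≥0} {g h : S → ℝ≥0} (hg : g ∈ maxSpan f)
    (hh : h ∈ maxSpan f) : (fun s => max (g s) (h s)) ∈ maxSpan f := by
  obtain ⟨n, a, t, hn, ha, rfl⟩ := hg
  obtain ⟨m, b, u, hm, hb, rfl⟩ := hh
  refine ⟨n + m, Fin.append a b, Fin.append t u, by omega, ?_, ?_⟩
  · intro i
    refine Fin.addCases (fun i => ?_) (fun i => ?_) i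
    · simpa using ha i
    · simpa using hb i
  · funext s
    apply le_antisymm
    · refine max_le (Finset.sup_le fun i _ => ?_) (Finset.sup_le fun i _ => ?_)
      · simpa using Finset.le_sup (f := fun i => Fin.append a b i * f (Fin.append t u i) s)
          (Finset.mem_univ (Fin.castAdd m i))
      · simpa using Finset.le_sup (f := fun i => Fin.append a b i * f (Fin.append t u i) s)
          (Finset.mem_univ (Fin.natAdd n i))
    · refine Finset.sup_le fun i _ => ?_
      refine Fin.addCases (fun i => ?_) (fun i => ?_) i
      · simp only [Fin.append_left]
        exact le_max_of_le_left (Finset.le_sup (f := fun i => a i * f (t i) s) (Finset.mem_univ i))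
      · simp only [Fin.append_right]
        exact le_max_of_le_right (Finset.le_sup (f := fun i => b i * f (u i) s) (Finset.mem_univ i))

theorem maxSpan_induction {T S : Type*} {f : T → S → ℝ≥0} {p : (S → ℝ≥0) → Prop}
    (single : ∀ t a, 0 < a → p fun s => a * f t s)
    (max : ∀ g ∈ maxSpan f, ∀ h ∈ maxSpan f, p g → p h → p fun s => max (g s) (h s)) {g : S → ℝ≥0}
    (hg : g ∈ maxSpan f) : p g := by
  obtain ⟨n, a, t, hn, ha, rfl⟩ := hg
  obtain ⟨n, rfl⟩ : ∃ k, n = k + 1 := ⟨n - 1, by omega⟩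
  induction n with
  | zero => simpa using single (t 0) (a 0) (ha 0)
  | succ n ih =>
    have h1 := ih (fun i => a i.succ) (fun i => t i.succ) (by omega) (fun i => ha _)
    have h2 := max _ (mem_maxSpan_single f (t 0) (ha 0)) _
      ⟨n + 1, fun i => a i.succ, fun i => t i.succ, by omega, fun i => ha _, rfl⟩
      (single (t 0) (a 0) (ha 0)) h1
    convert h2 using 2 with s
    rw [Fin.univ_succ, Finset.sup_cons, Finset.sup_map]
    rfl

theorem maxSpan_subset_LPlus (hα : 0 < α) {f : T → S → ℝ≥0} (hf : ∀ t, f t ∈ LPlus α μ) :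
    maxSpan f ⊆ LPlus α μ := fun _ hg =>
  maxSpan_induction (fun t a _ => LPlus.const_mul hα (hf t) a)
    (fun _ _ _ _ hg hh => LPlus.max hα hg hh) hg

theorem rho_self (f : S → ℝ≥0) : rho α μ f f = 0 := by simp [rho]

theorem maxSpan_subset_closedMaxSpan (hα : 0 < α) {f : T → S → ℝ≥0} (hf : ∀ t, f t ∈ LPlus α μ) :
    maxSpan f ⊆ closedMaxSpan α μ f := fun g hg =>
  ⟨maxSpan_subset_LPlus hα hf hg, fun ε hε => ⟨g, hg, by rwa [rho_self]⟩⟩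

theorem mem_closedMaxSpan (hα : 0 < α) {f : T → S → ℝ≥0} (hf : ∀ t, f t ∈ LPlus α μ) (t : T) :
    f t ∈ closedMaxSpan α μ f :=
  maxSpan_subset_closedMaxSpan hα hf (by simpa using mem_maxSpan_single f t one_pos)

theorem abs_max_rpow_sub_le (hα : 0 < α) (x y z : ℝ≥0) :
    |((max x y : ℝ≥0) : ℝ) ^ α - ((max x z : ℝ≥0) : ℝ) ^ α| ≤ |(y : ℝ) ^ α - (z : ℝ) ^ α| := by
  have h : ∀ x y : ℝ≥0, ((max x y : ℝ≥0) : ℝ) ^ α = max ((x : ℝ) ^ α) ((y : ℝ) ^ α) := by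
    intro x y
    have hm : Monotone fun x : ℝ≥0 => (x : ℝ) ^ α := fun a b h =>
      Real.rpow_le_rpow a.2 (by exact_mod_cast h) hα.le
    exact hm.map_max
  rw [h, h, max_comm, max_comm ((x : ℝ) ^ α)]
  exact abs_max_sub_max_le_abs _ _ _

/-- The map `y ↦ max x y` does not increase `ρ`. The case of a finite combination and a limit
suffices for applying `IsMaxLinearIsometryOn.rho_eq` to approximants. -/
theorem max_mem_closedMaxSpan (hα : 0 < α) {f : T → S → ℝ≥0} (hf : ∀ t, f t ∈ LPlus α μ)
    {m g : S → ℝ≥0} (hm : m ∈ maxSpan f) (hg : g ∈ closedMaxSpan α μ f) :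
    (fun s => max (m s) (g s)) ∈ closedMaxSpan α μ f := by
  refine ⟨LPlus.max hα (maxSpan_subset_LPlus hα hf hm) hg.1, fun ε hε => ?_⟩
  obtain ⟨k, hk, hkg⟩ := hg.2 ε hε
  refine ⟨_, maxSpan_max hm hk, lt_of_le_of_lt ?_ hkg⟩
  exact lintegral_mono fun s => ENNReal.ofReal_le_ofReal (abs_max_rpow_sub_le hα _ _ _)

variable {f₁ : T → S₁ → ℝ≥0} {f₂ : T → S₂ → ℝ≥0}

theorem IsRelatingIsometryOn.mono {F F' : Set (S₁ → ℝ≥0)} {V : (S₁ → ℝ≥0) → (S₂ → ℝ≥0)}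
    (hV : IsRelatingIsometryOn α μ₁ μ₂ f₁ f₂ F V) (h : F' ⊆ F) :
    IsRelatingIsometryOn α μ₁ μ₂ f₁ f₂ F' V :=
  ⟨⟨fun f hf => hV.1.mapsTo f (h hf), fun f hf g hg => hV.1.maxLinear f (h hf) g (h hg),
    fun f hf => hV.1.norm_eq f (h hf)⟩, hV.2⟩

theorem closedMaxSpan_subset_LPlus (f : T → S → ℝ≥0) : closedMaxSpan α μ f ⊆ LPlus α μ :=
  fun _ h => h.1

/-- Relating isometries of the closed max-linear span agree. -/
theorem IsRelatingIsometryOn.ae_eq_of_mem_closedMaxSpan (hα : 0 < α)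
    (hf₁ : ∀ t, f₁ t ∈ LPlus α μ₁) {V W : (S₁ → ℝ≥0) → (S₂ → ℝ≥0)}
    (hV : IsRelatingIsometryOn α μ₁ μ₂ f₁ f₂ (closedMaxSpan α μ₁ f₁) V)
    (hW : IsRelatingIsometryOn α μ₁ μ₂ f₁ f₂ (closedMaxSpan α μ₁ f₁) W) {g : S₁ → ℝ≥0}
    (hg : g ∈ closedMaxSpan α μ₁ f₁) : V g =ᵐ[μ₂] W g := by
  have hspan : ∀ m ∈ maxSpan f₁, V m =ᵐ[μ₂] W m := by
    intro m hm
    refine maxSpan_induction (p := fun m => V m =ᵐ[μ₂] W m) ?_ ?_ hm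
    · intro t a _
      have ht := mem_closedMaxSpan hα hf₁ t
      filter_upwards [hV.1.const_mul ht a, hW.1.const_mul ht a, hV.2 t, hW.2 t] with s h1 h2 h3 h4
      rw [h1, h2, h3, h4]
    · intro k hk l hl h1 h2
      have hk' := maxSpan_subset_closedMaxSpan hα hf₁ hk
      have hl' := maxSpan_subset_closedMaxSpan hα hf₁ hl
      filter_upwards [hV.1.max hk' hl', hW.1.max hk' hl', h1, h2] with s h3 h4 h5 h6
      rw [h3, h4, h5, h6]
  have hVg := (hV.1.mapsTo g hg).1
  have hWg := (hW.1.mapsTo g hg).1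
  refine ae_eq_of_rho_eq_zero hα hVg hWg (le_antisymm ?_ zero_le)
  obtain ⟨m, hm, hlim⟩ := exists_seq_of_mem_closedMaxSpan hg
  -- The two isometries agree at the approximant `m n` and both preserve its distance to `g`.
  have hbound : ∀ n, rho α μ₂ (V g) (W g) ≤ rho α μ₁ (m n) g + rho α μ₁ (m n) g := by
    intro n
    have hmn := maxSpan_subset_closedMaxSpan hα hf₁ (hm n)
    have hmax := max_mem_closedMaxSpan hα hf₁ (hm n) hg
    have h1 := hV.1.rho_eq hα (closedMaxSpan_subset_LPlus f₁) hmn hg hmax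
    have h2 := hW.1.rho_eq hα (closedMaxSpan_subset_LPlus f₁) hmn hg hmax
    have h3 : rho α μ₂ (V (m n)) (W g) = rho α μ₂ (W (m n)) (W g) := by
      refine lintegral_congr_ae ?_
      filter_upwards [hspan _ (hm n)] with s hs
      rw [hs]
    refine (rho_triangle hVg (hV.1.mapsTo _ hmn).1).trans ?_
    rw [h3, h2, rho_comm, h1]
  have := hlim.add hlim
  rw [add_zero] at this
  exact ge_of_tendsto' this hbound

end Isometry

/-! ### Weighted composition operators -/

section Composition

/-- The weighted composition operator `f ↦ w · (f ∘ Φ)`. -/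
def weightedComp {S₁ S₂ : Type*} (Φ : S₂ → S₁) (w : S₂ → ℝ≥0) (f : S₁ → ℝ≥0) (s : S₂) : ℝ≥0 :=
  w s * f (Φ s)

theorem IsPointMapRelation.measurable_weightedComp {T S₁ S₂ : Type*} [MeasurableSpace S₁]
    [MeasurableSpace S₂] {α : ℝ} {μ₁ : Measure S₁} {μ₂ : Measure S₂} {f₁ : T → S₁ → ℝ≥0}
    {f₂ : T → S₂ → ℝ≥0} {Φ : S₂ → S₁} {w : S₂ → ℝ≥0}
    (h : IsPointMapRelation α μ₁ μ₂ f₁ f₂ Φ w) {f : S₁ → ℝ≥0} (hf : Measurable f) : Measurable (weightedComp Φ w f) :=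
  h.measurable_weight.mul (hf.comp h.measurable_map)

variable {T S₁ S₂ : Type*} [MeasurableSpace S₁] [MeasurableSpace S₂]
  [StandardBorelSpace S₁] [StandardBorelSpace S₂] {α : ℝ} {μ₁ : Measure S₁} {μ₂ : Measure S₂}
  {f₁ : T → S₁ → ℝ≥0} {f₂ : T → S₂ → ℝ≥0}
  {Φ : S₂ → S₁} {w : S₂ → ℝ≥0}

theorem IsPointMapRelation.measurableEmbedding (h : IsPointMapRelation α μ₁ μ₂ f₁ f₂ Φ w) :
    MeasurableEmbedding Φ :=
  h.measurable_map.measurableEmbedding h.bijective.1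

theorem IsPointMapRelation.map_comap (h : IsPointMapRelation α μ₁ μ₂ f₁ f₂ Φ w) :
    (μ₁.comap Φ).map Φ = μ₁ := by
  rw [h.measurableEmbedding.map_comap, h.bijective.2.range_eq, Measure.restrict_univ]

variable [SigmaFinite μ₁] [SigmaFinite μ₂]

theorem IsPointMapRelation.comap_eq (h : IsPointMapRelation α μ₁ μ₂ f₁ f₂ Φ w) :
    μ₁.comap Φ = μ₂.withDensity fun s => (w s : ℝ≥0∞) ^ α := by
  have : SigmaFinite (μ₁.comap Φ) := by
    have hs : SigmaFinite ((μ₁.comap Φ).map Φ) := by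
      rw [h.map_comap]
      infer_instance
    exact hs.of_map _ h.measurable_map.aemeasurable
  rw [← withDensity_congr_ae h.rnDeriv_eq]
  exact (Measure.withDensity_rnDeriv_eq _ _ h.absolutelyContinuous).symm

theorem IsPointMapRelation.lintegral_eq (h : IsPointMapRelation α μ₁ μ₂ f₁ f₂ Φ w)
    {g : S₁ → ℝ≥0∞} (hg : Measurable g) :
    ∫⁻ s, (w s : ℝ≥0∞) ^ α * g (Φ s) ∂μ₂ = ∫⁻ s, g s ∂μ₁ := by
  conv_rhs => rw [← h.map_comap, lintegral_map hg h.measurable_map, h.comap_eq]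
  exact (lintegral_withDensity_eq_lintegral_mul _ (h.measurable_weight.coe_nnreal_ennreal.pow_const α)
    (hg.comp h.measurable_map)).symm

/-- As the weight is positive, `μ₂` is absolutely continuous with respect to `μ₁ ∘ Φ`, so preimages
of null sets under `Φ` are null. -/
theorem IsPointMapRelation.ae (h : IsPointMapRelation α μ₁ μ₂ f₁ f₂ Φ w)
    {p : S₁ → Prop} (hp : ∀ᵐ s ∂μ₁, p s) : ∀ᵐ s ∂μ₂, p (Φ s) := by
  have h1 : ∀ᵐ s ∂(μ₁.comap Φ), p (Φ s) := by
    rw [← h.map_comap] at hp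
    exact ae_of_ae_map h.measurable_map.aemeasurable hp
  have h2 : μ₂ ≪ μ₁.comap Φ := by
    rw [h.comap_eq]
    refine withDensity_absolutelyContinuous'
      (h.measurable_weight.coe_nnreal_ennreal.pow_const α).aemeasurable ?_
    exact Eventually.of_forall fun s =>
      (ENNReal.rpow_pos (by exact_mod_cast h.weight_pos s) ENNReal.coe_ne_top).ne'
  exact h2.ae_le h1

theorem IsPointMapRelation.lintegral_weightedComp (h : IsPointMapRelation α μ₁ μ₂ f₁ f₂ Φ w)
    (hα : 0 < α) {f : S₁ → ℝ≥0} (hf : Measurable f) :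
    ∫⁻ s, (weightedComp Φ w f s : ℝ≥0∞) ^ α ∂μ₂ = ∫⁻ s, (f s : ℝ≥0∞) ^ α ∂μ₁ := by
  rw [← h.lintegral_eq (hf.coe_nnreal_ennreal.pow_const α)]
  refine lintegral_congr fun s => ?_
  rw [weightedComp, ENNReal.coe_mul, ENNReal.mul_rpow_of_nonneg _ _ hα.le]

theorem IsPointMapRelation.isRelatingIsometryOn (h : IsPointMapRelation α μ₁ μ₂ f₁ f₂ Φ w)
    (hα : 0 < α) :
    IsRelatingIsometryOn α μ₁ μ₂ f₁ f₂ (LPlus α μ₁) (weightedComp Φ w) := by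
  refine ⟨⟨fun f hf => ⟨h.measurable_weightedComp hf.1, ?_⟩, fun f _ g _ a b => ?_,
    fun f hf => ?_⟩, fun t => (h.relates t).symm⟩
  · rw [h.lintegral_weightedComp hα hf.1]
    exact hf.2
  · refine Eventually.of_forall fun s => ?_
    simp only [weightedComp]
    rw [mul_left_comm a, mul_left_comm b, mul_max]
  · rw [lNorm, lNorm, h.lintegral_weightedComp hα hf.1]

theorem IsPointMapRelation.exists_preimage (h : IsPointMapRelation α μ₁ μ₂ f₁ f₂ Φ w)
    (hα : 0 < α) {g : S₂ → ℝ≥0} (hg : g ∈ LPlus α μ₂) :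
    ∃ f ∈ LPlus α μ₁, weightedComp Φ w f = g := by
  -- The preimage is `(g / w) ∘ Φ⁻¹`.
  obtain ⟨f, hf, hfg⟩ := h.measurableEmbedding.exists_measurable_extend
    (hg.1.div h.measurable_weight) fun _ => inferInstance
  have hU : weightedComp Φ w f = g := by
    funext s
    have : f (Φ s) = g s / w s := congrFun hfg s
    rw [weightedComp, this, mul_div_cancel₀ _ (h.weight_pos s).ne']
  refine ⟨f, ⟨hf, ?_⟩, hU⟩
  rw [← h.lintegral_weightedComp hα hf, hU]
  exact hg.2

end Composition

/-! ### Uniqueness -/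

section Uniqueness

variable {T S₁ S₂ : Type*} [MeasurableSpace S₁] [MeasurableSpace S₂] {α : ℝ} {μ₁ : Measure S₁}
  {μ₂ : Measure S₂} {f₁ : T → S₁ → ℝ≥0} {f₂ : T → S₂ → ℝ≥0}

theorem IsMaxLinearIsometryOn.ae_le {V : (S₁ → ℝ≥0) → (S₂ → ℝ≥0)}
    (hV : IsMaxLinearIsometryOn α μ₁ μ₂ (LPlus α μ₁) V) {f g : S₁ → ℝ≥0}
    (hf : f ∈ LPlus α μ₁) (hg : g ∈ LPlus α μ₁) (h : ∀ s, f s ≤ g s) : V f ≤ᵐ[μ₂] V g := by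
  have h1 := hV.max hf hg
  simp only [max_eq_right (h _)] at h1
  filter_upwards [h1] with s hs
  rw [hs]
  exact le_max_left _ _

theorem ae_eq_of_ae_le_of_lintegral_rpow_eq {S : Type*} [MeasurableSpace S] {μ : Measure S}
    (hα : 0 < α) {f g : S → ℝ≥0} (hf : f ∈ LPlus α μ) (hg : Measurable g) (h : f ≤ᵐ[μ] g)
    (heq : ∫⁻ s, (g s : ℝ≥0∞) ^ α ∂μ = ∫⁻ s, (f s : ℝ≥0∞) ^ α ∂μ) : f =ᵐ[μ] g := by
  have h1 : (fun s => (f s : ℝ≥0∞) ^ α) ≤ᵐ[μ] fun s => (g s : ℝ≥0∞) ^ α := by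
    filter_upwards [h] with s hs
    exact ENNReal.rpow_le_rpow (by exact_mod_cast hs) hα.le
  have h2 := ae_eq_of_ae_le_of_lintegral_le h1 hf.2.ne
    (hg.coe_nnreal_ennreal.pow_const α).aemeasurable heq.le
  filter_upwards [h2] with s hs
  exact rpow_coe_injective hα hs

/-- Isometries are not assumed to respect almost everywhere equality of functions; this follows from
the norms. `V g ≤ V (max f g)` holds by monotonicity, and both have the same norm when `f ≤ g`
almost everywhere. -/
theorem IsMaxLinearIsometryOn.ae_le_of_ae_le {V : (S₁ → ℝ≥0) → (S₂ → ℝ≥0)} (hα : 0 < α)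
    (hV : IsMaxLinearIsometryOn α μ₁ μ₂ (LPlus α μ₁) V) {f g : S₁ → ℝ≥0}
    (hf : f ∈ LPlus α μ₁) (hg : g ∈ LPlus α μ₁) (h : f ≤ᵐ[μ₁] g) : V f ≤ᵐ[μ₂] V g := by
  have hm := LPlus.max hα hf hg
  have h1 : V g =ᵐ[μ₂] V fun s => Max.max (f s) (g s) := by
    refine ae_eq_of_ae_le_of_lintegral_rpow_eq hα (hV.mapsTo g hg) (hV.mapsTo _ hm).1
      (hV.ae_le hg hm fun s => le_max_right _ _) ?_
    rw [hV.lintegral_eq hα hm, hV.lintegral_eq hα hg]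
    refine lintegral_congr_ae ?_
    filter_upwards [h] with s hs
    rw [max_eq_right hs]
  filter_upwards [h1, hV.ae_le hf hm fun s => le_max_left _ _] with s h2 h3
  rwa [h2]

variable {Φ : S₂ → S₁} {w : S₂ → ℝ≥0} {V : (S₁ → ℝ≥0) → (S₂ → ℝ≥0)}

/-- The functions on which `V` dominates the weighted composition operator of `Φ` and `w`. -/
def dominated (α : ℝ) (μ₁ : Measure S₁) (μ₂ : Measure S₂) (Φ : S₂ → S₁) (w : S₂ → ℝ≥0)
    (V : (S₁ → ℝ≥0) → (S₂ → ℝ≥0)) : Set (S₁ → ℝ≥0) :=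
  {g | g ∈ LPlus α μ₁ ∧ weightedComp Φ w g ≤ᵐ[μ₂] V g}

theorem dominated.max (hα : 0 < α)
    (hV : IsMaxLinearIsometryOn α μ₁ μ₂ (LPlus α μ₁) V)
    {f g : S₁ → ℝ≥0} (hf : f ∈ dominated α μ₁ μ₂ Φ w V)
    (hg : g ∈ dominated α μ₁ μ₂ Φ w V) :
    (fun s => max (f s) (g s)) ∈ dominated α μ₁ μ₂ Φ w V := by
  refine ⟨LPlus.max hα hf.1 hg.1, ?_⟩
  filter_upwards [hV.max hf.1 hg.1, hf.2, hg.2] with s h1 h2 h3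
  rw [h1]
  simp only [weightedComp] at h2 h3 ⊢
  rw [mul_max]
  exact max_le_max h2 h3

theorem dominated.const_mul (hα : 0 < α)
    (hV : IsMaxLinearIsometryOn α μ₁ μ₂ (LPlus α μ₁) V)
    {f : S₁ → ℝ≥0} (hf : f ∈ dominated α μ₁ μ₂ Φ w V) (c : ℝ≥0) :
    (fun s => c * f s) ∈ dominated α μ₁ μ₂ Φ w V := by
  refine ⟨LPlus.const_mul hα hf.1 c, ?_⟩
  filter_upwards [hV.const_mul hf.1 c, hf.2] with s h1 h2
  rw [h1]
  simp only [weightedComp] at h2 ⊢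
  rw [mul_left_comm]
  gcongr

/-- For a generator `{c f_u < f_t}` the positive weight cancels, so its preimage under either map
is, modulo null sets, the corresponding set for the second family. -/
theorem IsPointMapRelation.ae_mem_iff {Φ' : S₂ → S₁} {w' : S₂ → ℝ≥0}
    (hΦ : IsPointMapRelation α μ₁ μ₂ f₁ f₂ Φ w) (hΦ' : IsPointMapRelation α μ₁ μ₂ f₁ f₂ Φ' w')
    {A : Set S₁} (hA : MeasurableSet[ratioField f₁] A) : ∀ᵐ s ∂μ₂, Φ s ∈ A ↔ Φ' s ∈ A := by
  refine ratioField_induction (p := fun A => ∀ᵐ s ∂μ₂, Φ s ∈ A ↔ Φ' s ∈ A) (by simp) ?_ ?_ ?_ hA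
  · intro A hA
    filter_upwards [hA] with s hs
    exact not_congr hs
  · intro B hB
    filter_upwards [ae_all_iff.2 hB] with s hs
    simp only [mem_iUnion, hs]
  · intro t u c
    have hr : ∀ {Φ : S₂ → S₁} {w : S₂ → ℝ≥0}, IsPointMapRelation α μ₁ μ₂ f₁ f₂ Φ w →
        ∀ᵐ s ∂μ₂, Φ s ∈ {s | c * f₁ u s < f₁ t s} ↔ c * f₂ u s < f₂ t s := by
      intro Φ w h
      filter_upwards [h.relates t, h.relates u] with s h1 h2
      rw [h1, h2, mul_left_comm, mul_lt_mul_iff_of_pos_left (h.weight_pos s)]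
    filter_upwards [hr hΦ, hr hΦ'] with s h1 h2
    rw [h1, h2]

variable [StandardBorelSpace S₁] [StandardBorelSpace S₂] [SigmaFinite μ₁] [SigmaFinite μ₂]

/-- Both functions have the norm of `g`, so domination is already equality. Only the inequality has
to be propagated, which is easier for suprema. -/
theorem dominated.ae_eq (hα : 0 < α) (hΦ : IsPointMapRelation α μ₁ μ₂ f₁ f₂ Φ w)
    (hV : IsMaxLinearIsometryOn α μ₁ μ₂ (LPlus α μ₁) V)
    {g : S₁ → ℝ≥0} (hg : g ∈ dominated α μ₁ μ₂ Φ w V) :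
    weightedComp Φ w g =ᵐ[μ₂] V g := by
  refine ae_eq_of_ae_le_of_lintegral_rpow_eq hα
    ((hΦ.isRelatingIsometryOn hα).1.mapsTo g hg.1) (hV.mapsTo g hg.1).1 hg.2 ?_
  rw [hV.lintegral_eq hα hg.1, hΦ.lintegral_weightedComp hα hg.1.1]

/-- By monotonicity `V g` lies above every `V (f i)`, hence above every `w · (f i ∘ Φ)`, and so
above their supremum. Countability keeps the exceptional set null. -/
theorem dominated.sup (hα : 0 < α) (hΦ : IsPointMapRelation α μ₁ μ₂ f₁ f₂ Φ w)
    (hV : IsMaxLinearIsometryOn α μ₁ μ₂ (LPlus α μ₁) V)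
    {ι : Type*} [Countable ι] {f : ι → S₁ → ℝ≥0} {g : S₁ → ℝ≥0}
    (hf : ∀ i, f i ∈ dominated α μ₁ μ₂ Φ w V) (hg : g ∈ LPlus α μ₁)
    (hle : ∀ i, f i ≤ᵐ[μ₁] g) (hsup : ∀ᵐ s ∂μ₁, ∀ b < g s, ∃ i, b < f i s) :
    g ∈ dominated α μ₁ μ₂ Φ w V := by
  refine ⟨hg, ?_⟩
  filter_upwards [ae_all_iff.2 fun i => (hf i).2,
    ae_all_iff.2 fun i => hV.ae_le_of_ae_le hα (hf i).1 hg (hle i), hΦ.ae hsup] with s h1 h2 h3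
  by_contra hcon
  simp only [weightedComp, not_le] at hcon h1
  have hw := hΦ.weight_pos s
  obtain ⟨i, hi⟩ := h3 (V g s / w s) (by rwa [div_lt_iff₀' hw])
  rw [div_lt_iff₀' hw] at hi
  exact absurd ((h1 i).trans (h2 i)) (not_le.2 hi)

/-- Where `Φ s ∉ A`, the part of `g` on `A` is sent to `0`, so in the decomposition of `g` over `A`
and `Aᶜ` the whole value `V g s` comes from the part on `Aᶜ`. -/
theorem dominated.indicator_compl (hα : 0 < α) (hΦ : IsPointMapRelation α μ₁ μ₂ f₁ f₂ Φ w)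
    (hV : IsMaxLinearIsometryOn α μ₁ μ₂ (LPlus α μ₁) V)
    {g : S₁ → ℝ≥0} (hg : g ∈ dominated α μ₁ μ₂ Φ w V) {A : Set S₁}
    (hA : MeasurableSet A) (hgA : A.indicator g ∈ dominated α μ₁ μ₂ Φ w V) :
    Aᶜ.indicator g ∈ dominated α μ₁ μ₂ Φ w V := by
  have hL : Aᶜ.indicator g ∈ LPlus α μ₁ :=
    LPlus.mono hα (hg.1.1.indicator hA.compl) hg.1 fun s => indicator_le_self' (by simp) s
  refine ⟨hL, ?_⟩
  have hmax : (fun s => Max.max (A.indicator g s) (Aᶜ.indicator g s)) = g := by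
    funext s
    by_cases h : s ∈ A <;> simp [h]
  have h1 := hV.max hgA.1 hL
  rw [hmax] at h1
  filter_upwards [h1, dominated.ae_eq hα hΦ hV hgA, hg.2] with s h2 h3 h4
  by_cases h : Φ s ∈ A
  · simp [weightedComp, h]
  · have h5 : V (A.indicator g) s = 0 := by
      rw [← h3]
      simp [weightedComp, h]
    rw [h2, h5, max_eq_right zero_le] at h4
    simpa [weightedComp, h] using h4

/-- With `A = {u < f}`, `max f u` is also the maximum of `f` on `A` and `u` on `Aᶜ`. Where `u ∘ Φ <
f ∘ Φ` the image of the second piece is at most `w · (u ∘ Φ)`, too small to reach the value `w · (f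
∘ Φ)` of the maximum, so the first piece must attain it. -/
theorem dominated.indicator_lt (hα : 0 < α) (hΦ : IsPointMapRelation α μ₁ μ₂ f₁ f₂ Φ w)
    (hV : IsMaxLinearIsometryOn α μ₁ μ₂ (LPlus α μ₁) V)
    {f u : S₁ → ℝ≥0} (hf : f ∈ dominated α μ₁ μ₂ Φ w V)
    (hu : u ∈ dominated α μ₁ μ₂ Φ w V) :
    {s | u s < f s}.indicator f ∈ dominated α μ₁ μ₂ Φ w V := by
  have hA : MeasurableSet {s | u s < f s} := measurableSet_lt hu.1.1 hf.1.1
  have hLf : {s | u s < f s}.indicator f ∈ LPlus α μ₁ :=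
    LPlus.mono hα (hf.1.1.indicator hA) hf.1 fun s => indicator_le_self' (by simp) s
  have hLu : {s | u s < f s}ᶜ.indicator u ∈ LPlus α μ₁ :=
    LPlus.mono hα (hu.1.1.indicator hA.compl) hu.1 fun s => indicator_le_self' (by simp) s
  refine ⟨hLf, ?_⟩
  have hmax : (fun s => Max.max ({s | u s < f s}.indicator f s) ({s | u s < f s}ᶜ.indicator u s)) =
      fun s => Max.max (f s) (u s) := by
    funext s
    by_cases h : u s < f s
    · simp [h, h.le]
    · simp [h, not_lt.1 h]
  have h1 := hV.max hLf hLu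
  rw [hmax] at h1
  filter_upwards [h1, hV.max hf.1 hu.1, dominated.ae_eq hα hΦ hV hf,
    dominated.ae_eq hα hΦ hV hu,
    hV.ae_le hLu hu.1 fun s => indicator_le_self' (by simp) s] with s h2 h3 h4 h5 h6
  by_cases h : u (Φ s) < f (Φ s)
  · have h7 : weightedComp Φ w u s < weightedComp Φ w f s :=
      mul_lt_mul_of_pos_left h (hΦ.weight_pos s)
    rw [h3, ← h4, ← h5, max_eq_left h7.le] at h2
    rw [← h5] at h6
    have h8 : weightedComp Φ w ({s | u s < f s}.indicator f) s = weightedComp Φ w f s := by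
      simp [weightedComp, h]
    rw [h8]
    by_contra hcon
    exact absurd h2 (max_lt (not_le.1 hcon) (h6.trans_lt h7)).ne'
  · simp [weightedComp, h]

theorem dominated.min (hα : 0 < α) (hΦ : IsPointMapRelation α μ₁ μ₂ f₁ f₂ Φ w)
    (hV : IsMaxLinearIsometryOn α μ₁ μ₂ (LPlus α μ₁) V)
    {f u : S₁ → ℝ≥0} (hf : f ∈ dominated α μ₁ μ₂ Φ w V)
    (hu : u ∈ dominated α μ₁ μ₂ Φ w V) :
    (fun s => min (f s) (u s)) ∈ dominated α μ₁ μ₂ Φ w V := by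
  have h1 := dominated.indicator_compl hα hΦ hV hf (measurableSet_lt hu.1.1 hf.1.1)
    (dominated.indicator_lt hα hΦ hV hf hu)
  have h2 := dominated.indicator_compl hα hΦ hV hu (measurableSet_lt hf.1.1 hu.1.1)
    (dominated.indicator_lt hα hΦ hV hu hf)
  have h3 := dominated.max hα hV h1 h2
  convert h3 using 2 with s
  rcases lt_trichotomy (f s) (u s) with h | h | h
  · simp [h, h.le, h.not_gt]
  · simp [h]
  · simp [h, h.le, h.not_gt]

theorem dominated.indicator_ratioField (hα : 0 < α) (hΦ : IsPointMapRelation α μ₁ μ₂ f₁ f₂ Φ w)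
    (hV : IsMaxLinearIsometryOn α μ₁ μ₂ (LPlus α μ₁) V)
    (hf : ∀ t, f₁ t ∈ dominated α μ₁ μ₂ Φ w V)
    {f₀ : S₁ → ℝ≥0} (hf₀ : f₀ ∈ dominated α μ₁ μ₂ Φ w V) {A : Set S₁}
    (hA : MeasurableSet[ratioField f₁] A) : A.indicator f₀ ∈ dominated α μ₁ μ₂ Φ w V := by
  have hind : ∀ {A}, MeasurableSet A → A.indicator f₀ ∈ LPlus α μ₁ := fun hA =>
    LPlus.mono hα (hf₀.1.1.indicator hA) hf₀.1 fun s => indicator_le_self' (by simp) s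
  refine (ratioField_induction (p := fun A => MeasurableSet A ∧
    A.indicator f₀ ∈ dominated α μ₁ μ₂ Φ w V) ?_ ?_ ?_ ?_ hA).2
  · refine ⟨MeasurableSet.empty, hind MeasurableSet.empty, Eventually.of_forall fun s => ?_⟩
    simp [weightedComp]
  · exact fun A hA => ⟨hA.1.compl, dominated.indicator_compl hα hΦ hV hf₀ hA.1 hA.2⟩
  · intro B hB
    have hU : MeasurableSet (⋃ n, B n) := MeasurableSet.iUnion fun n => (hB n).1
    refine ⟨hU, dominated.sup hα hΦ hV (fun n => (hB n).2) (hind hU)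
      (fun n => Eventually.of_forall fun s => indicator_le_indicator_of_subset
        (subset_iUnion B n) (by simp) s) (Eventually.of_forall fun s b hb => ?_)⟩
    by_cases h : s ∈ ⋃ n, B n
    · rw [indicator_of_mem h] at hb
      obtain ⟨n, hn⟩ := mem_iUnion.1 h
      exact ⟨n, by rwa [indicator_of_mem hn]⟩
    · rw [indicator_of_notMem h] at hb
      exact absurd hb not_lt_zero
  · intro t u c
    have hc := dominated.const_mul hα hV (hf u) c
    have hlt := dominated.indicator_lt hα hΦ hV (hf t) hc
    have hAm : MeasurableSet {s | c * f₁ u s < f₁ t s} := measurableSet_lt hc.1.1 (hf t).1.1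
    -- On `A = {c f_u < f_t}` the function `f_t` is positive, so the restriction of `f₀` to `A` is
    -- the supremum over `n` of `min f₀ (n · 1_A f_t)`.
    refine ⟨hAm, dominated.sup hα hΦ hV (ι := ℕ) (fun n => dominated.min hα hΦ hV hf₀
      (dominated.const_mul hα hV hlt n)) (hind hAm)
      (fun n => Eventually.of_forall fun s => ?_) (Eventually.of_forall fun s b hb => ?_)⟩
    · by_cases h : c * f₁ u s < f₁ t s <;> simp [h]
    · by_cases h : c * f₁ u s < f₁ t s
      · have hpos : 0 < f₁ t s := zero_le.trans_lt h
        obtain ⟨n, hn⟩ := exists_nat_ge (f₀ s / f₁ t s)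
        refine ⟨n, ?_⟩
        rw [div_le_iff₀ hpos] at hn
        simpa [h, hn] using hb
      · simp [h] at hb

theorem LPlus_subset_dominated (hα : 0 < α) (hΦ : IsPointMapRelation α μ₁ μ₂ f₁ f₂ Φ w)
    (hV : IsMaxLinearIsometryOn α μ₁ μ₂ (LPlus α μ₁) V)
    (hmin : IsMinimal α μ₁ f₁)
    (hf : ∀ t, f₁ t ∈ dominated α μ₁ μ₂ Φ w V) {f₀ : S₁ → ℝ≥0}
    (hf₀ : f₀ ∈ dominated α μ₁ μ₂ Φ w V) (hpos : ∀ᵐ s ∂μ₁, f₀ s ≠ 0) {g : S₁ → ℝ≥0}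
    (hg : g ∈ LPlus α μ₁) : g ∈ dominated α μ₁ μ₂ Φ w V := by
  have hind : ∀ {B}, MeasurableSet B → B.indicator f₀ ∈ dominated α μ₁ μ₂ Φ w V := by
    intro B hB
    obtain ⟨A, hA, hAB⟩ := hmin.ratio B hB
    have heq : A.indicator f₀ =ᵐ[μ₁] B.indicator f₀ := by
      have : A =ᵐ[μ₁] B := measure_symmDiff_eq_zero_iff.1 hAB
      exact indicator_ae_eq_of_ae_eq_set this
    -- A one-term supremum transfers domination across almost everywhere equality.
    refine dominated.sup hα hΦ hV (ι := Unit)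
      (fun _ => dominated.indicator_ratioField hα hΦ hV hf hf₀ hA)
      (LPlus.mono hα (hf₀.1.1.indicator hB) hf₀.1 fun s => indicator_le_self' (by simp) s)
      (fun _ => heq.le) ?_
    filter_upwards [heq] with s hs b hb
    exact ⟨(), by rwa [hs]⟩
  have hB : ∀ q : ℚ, MeasurableSet {s | Real.toNNReal q * f₀ s < g s} := fun q =>
    measurableSet_lt (hf₀.1.1.const_mul _) hg.1
  -- As `f₀ > 0` almost everywhere, `g` is the supremum over rationals `q` of `q f₀` restricted to
  -- `{q f₀ < g}`. Negative `q` contribute the zero function.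
  refine dominated.sup hα hΦ hV (ι := ℚ)
    (fun q => dominated.const_mul hα hV (hind (hB q)) (Real.toNNReal q)) hg
    (fun q => Eventually.of_forall fun s => ?_) ?_
  · by_cases h : Real.toNNReal q * f₀ s < g s
    · simpa [h] using h.le
    · simp [h]
  · filter_upwards [hpos] with s hs b hb
    have hs' := pos_iff_ne_zero.2 hs
    obtain ⟨q, -, hq1, hq2⟩ := (NNReal.lt_iff_exists_rat_btwn _ _).1
      (div_lt_div_of_pos_right hb hs')
    rw [div_lt_iff₀ hs'] at hq1
    rw [lt_div_iff₀ hs'] at hq2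
    exact ⟨q, by simpa [hq2] using hq1⟩

theorem ae_ne_zero_of_measure_support_compl {S : Type*} [MeasurableSpace S] {μ : Measure S}
    {f : S → ℝ≥0} (h : μ (Function.support f)ᶜ = 0) : ∀ᵐ s ∂μ, f s ≠ 0 := by
  rw [ae_iff]
  simpa [Function.support, compl_ofPred] using h

/-- A relating isometry of the full space is the weighted composition operator of the point map. -/
theorem IsRelatingIsometryOn.ae_eq_weightedComp (hα : 0 < α)
    (hΦ : IsPointMapRelation α μ₁ μ₂ f₁ f₂ Φ w) (hf₁ : ∀ t, f₁ t ∈ LPlus α μ₁)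
    (hmin : IsMinimal α μ₁ f₁)
    (hV : IsRelatingIsometryOn α μ₁ μ₂ f₁ f₂ (LPlus α μ₁) V) {g : S₁ → ℝ≥0}
    (hg : g ∈ LPlus α μ₁) : V g =ᵐ[μ₂] weightedComp Φ w g := by
  obtain ⟨f₀, hf₀, -, hsupp⟩ := hmin.support
  have hspan : ∀ f ∈ closedMaxSpan α μ₁ f₁, f ∈ dominated α μ₁ μ₂ Φ w V := fun f hf =>
    ⟨hf.1, (IsRelatingIsometryOn.ae_eq_of_mem_closedMaxSpan hα hf₁
      ((hΦ.isRelatingIsometryOn hα).mono (closedMaxSpan_subset_LPlus f₁))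
      (hV.mono (closedMaxSpan_subset_LPlus f₁)) hf).le⟩
  exact (dominated.ae_eq hα hΦ hV.1 (LPlus_subset_dominated hα hΦ hV.1 hmin
    (fun t => hspan _ (mem_closedMaxSpan hα hf₁ t)) (hspan f₀ hf₀)
    (ae_ne_zero_of_measure_support_compl hsupp) hg)).symm

theorem IsPointMapRelation.unique {Φ' : S₂ → S₁} {w' : S₂ → ℝ≥0} (hα : 0 < α)
    (hΦ : IsPointMapRelation α μ₁ μ₂ f₁ f₂ Φ w) (hΦ' : IsPointMapRelation α μ₁ μ₂ f₁ f₂ Φ' w')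
    (hf₁ : ∀ t, Measurable (f₁ t)) (hmin : IsMinimal α μ₁ f₁) :
    Φ' =ᵐ[μ₂] Φ ∧ w' =ᵐ[μ₂] w := by
  obtain ⟨B, hB, hBsep⟩ := exists_seq_separating S₁ (p := MeasurableSet) MeasurableSet.empty univ
  choose A hA hAB using fun n => hmin.ratio (B n) (hB n)
  have hAB' : ∀ᵐ s ∂μ₁, ∀ n, s ∈ A n ↔ s ∈ B n := by
    refine ae_all_iff.2 fun n => ?_
    filter_upwards [(measure_symmDiff_eq_zero_iff.1 (hAB n)).mem_iff] with s hs
    exact hs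
  have hmap : Φ' =ᵐ[μ₂] Φ := by
    filter_upwards [ae_all_iff.2 fun n => hΦ.ae_mem_iff hΦ' (hA n), hΦ.ae hAB', hΦ'.ae hAB']
      with s h1 h2 h3
    refine hBsep _ (mem_univ _) _ (mem_univ _) fun n => ?_
    rw [← h2 n, ← h3 n, h1 n]
  refine ⟨hmap, ?_⟩
  -- Almost every point has some `t` in a countable set with `f₁ t (Φ s) ≠ 0`, which can be
  -- cancelled to compare the weights.
  obtain ⟨C, hC, hpos, -⟩ := hmin.exists_countable hα hf₁
  have := hC.to_subtype
  filter_upwards [hmap, hΦ.ae hpos, ae_all_iff.2 fun t : C => hΦ.relates t,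
    ae_all_iff.2 fun t : C => hΦ'.relates t] with s h1 ⟨t, ht, hts⟩ h3 h4
  have h5 := (h4 ⟨t, ht⟩).symm.trans (h3 ⟨t, ht⟩)
  simp only [h1] at h5
  exact mul_right_cancel₀ hts h5

end Uniqueness

/-! ### Standardized supports -/

open scoped Pointwise in
-- The Cantor set is the union of two copies of itself scaled by `1 / 3`, so its finite measure is
-- at most `2 / 3` of itself.
theorem measure_cantorSet : volume cantorSet = 0 := by
  have hfin : volume cantorSet ≠ ∞ :=
    measure_ne_top_of_subset cantorSet_subset_unitInterval (by simp)
  have himage : ∀ a : ℝ, volume ((fun x : ℝ => (a + x) / 3) '' cantorSet) =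
      ENNReal.ofReal (1 / 3) * volume cantorSet := fun a => by
    have : (fun x : ℝ => (a + x) / 3) '' cantorSet =
        (fun y => a / 3 + y) '' ((1 / 3 : ℝ) • cantorSet) := by
      rw [← image_smul, image_image]
      refine image_congr fun x _ => ?_
      simp only [smul_eq_mul]
      ring
    rw [this, image_add_left, measure_preimage_add, Measure.addHaar_smul]
    simp
  have h : volume cantorSet ≤ ENNReal.ofReal (2 / 3) * volume cantorSet := by
    conv_lhs => rw [cantorSet_eq_union_halves]
    refine (measure_union_le _ _).trans ?_
    have h0 := himage 0
    simp only [zero_add] at h0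
    rw [h0, himage, ← add_mul, ← ENNReal.ofReal_add (by norm_num) (by norm_num)]
    norm_num
  by_contra h0
  have h1 : ENNReal.ofReal (2 / 3) * volume cantorSet < 1 * volume cantorSet :=
    ENNReal.mul_lt_mul_left h0 hfin (ENNReal.ofReal_lt_one.2 (by norm_num))
  rw [one_mul] at h1
  exact absurd h (not_le.2 h1)

theorem not_countable_cantorSet : ¬ cantorSet.Countable := by
  intro h
  have : Countable cantorSet := h.to_subtype
  have : Countable (ℕ → Bool) := cantorSetEquivNatToBool.symm.injective.countable
  have h1 := Cardinal.mk_le_aleph0 (α := ℕ → Bool)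
  simp only [Cardinal.mk_pi, Cardinal.mk_bool, Cardinal.prod_const] at h1
  simp at h1
  exact absurd h1 (not_le.2 (by simpa using Cardinal.aleph0_lt_continuum))

theorem measurableSet_contPart (I : Fin 2) : MeasurableSet (contPart I) :=
  (MeasurableSet.const _).inter measurableSet_Ioo

theorem countable_discPart (N : ℕ∞) : (discPart N).Countable :=
  (countable_range fun n : ℕ => (n : ℝ)).mono <| by
    rintro _ ⟨n, -, -, rfl⟩
    exact ⟨n, rfl⟩

theorem contPart_one : contPart 1 = Ioo 0 1 := by
  ext x
  simp [contPart]

theorem contPart_eq_empty {I : Fin 2} (hI : I ≠ 1) : contPart I = ∅ := by simp [contPart, hI]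

theorem notMem_contPart_of_mem_discPart {I : Fin 2} {N : ℕ∞} {x : ℝ} (h : x ∈ discPart N) :
    x ∉ contPart I := by
  rintro ⟨-, -, h1⟩
  obtain ⟨n, hn, -, rfl⟩ := h
  exact absurd (by exact_mod_cast h1 : n < 1) (not_lt.2 hn)

instance standardBorelSpace_stdSupport (I : Fin 2) (N : ℕ∞) : StandardBorelSpace (StdSupport I N) :=
  ((measurableSet_contPart I).union (countable_discPart N).measurableSet).standardBorel

section StdMeasure

variable {I : Fin 2} {N : ℕ∞}

theorem measurableEmbedding_coe : MeasurableEmbedding ((↑) : StdSupport I N → ℝ) :=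
  MeasurableEmbedding.subtype_coe
    ((measurableSet_contPart I).union (countable_discPart N).measurableSet)

theorem stdMeasure_apply (A : Set (StdSupport I N)) :
    stdMeasure I N A = volume ((↑) '' A ∩ contPart I) + Measure.count ((↑) '' A ∩ discPart N) := by
  rw [stdMeasure, measurableEmbedding_coe.comap_apply, Measure.add_apply,
    Measure.restrict_apply' (measurableSet_contPart I),
    Measure.restrict_apply' (countable_discPart N).measurableSet]

theorem stdMeasure_singleton_of_mem_contPart {s : StdSupport I N} (hs : (s : ℝ) ∈ contPart I) :
    stdMeasure I N {s} = 0 := by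
  have h : (s : ℝ) ∉ discPart N := fun h => notMem_contPart_of_mem_discPart h hs
  rw [stdMeasure_apply, image_singleton, singleton_inter_eq_empty.2 h,
    measure_mono_null inter_subset_left (measure_singleton _)]
  simp

theorem stdMeasure_singleton_of_mem_discPart {s : StdSupport I N} (hs : (s : ℝ) ∈ discPart N) :
    stdMeasure I N {s} = 1 := by
  rw [stdMeasure_apply, image_singleton,
    singleton_inter_eq_empty.2 (notMem_contPart_of_mem_discPart hs),
    inter_eq_left.2 (singleton_subset_iff.2 hs)]
  simp

theorem stdMeasure_singleton_eq_zero_iff {s : StdSupport I N} :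
    stdMeasure I N {s} = 0 ↔ (s : ℝ) ∈ contPart I := by
  refine ⟨fun h => s.2.resolve_right fun hs => ?_, stdMeasure_singleton_of_mem_contPart⟩
  simp [stdMeasure_singleton_of_mem_discPart hs] at h

theorem mem_contPart_of_stdMeasure_eq_zero {A : Set (StdSupport I N)} (hA : stdMeasure I N A = 0)
    {s : StdSupport I N} (hs : s ∈ A) : (s : ℝ) ∈ contPart I :=
  stdMeasure_singleton_eq_zero_iff.1 (measure_mono_null (singleton_subset_iff.2 hs) hA)

instance sigmaFinite_stdMeasure : SigmaFinite (stdMeasure I N) := by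
  refine Measure.sigmaFinite_of_countable
    (S := insert ((↑) ⁻¹' contPart I) (range fun n : discPart N => {s : StdSupport I N | s = (n : ℝ)}))
    ?_ ?_ ?_
  · have := (countable_discPart N).to_subtype
    exact (countable_range _).insert _
  · rintro A (rfl | ⟨n, rfl⟩)
    · rw [stdMeasure_apply, image_preimage_eq_inter_range, inter_assoc _ _ (discPart N)]
      have h1 : volume (contPart I ∩ range ((↑) : StdSupport I N → ℝ) ∩ contPart I) ≤ 1 := by
        refine (measure_mono (t := Ioo (0 : ℝ) 1) fun x hx => hx.2.2).trans ?_
        simp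
      have h2 : contPart I ∩ (range ((↑) : StdSupport I N → ℝ) ∩ discPart N) = ∅ :=
        eq_empty_of_forall_notMem fun x hx => notMem_contPart_of_mem_discPart hx.2.2 hx.1
      rw [h2, measure_empty, add_zero]
      exact h1.trans_lt ENNReal.one_lt_top
    · have : {s : StdSupport I N | (s : ℝ) = n} = {⟨n, Or.inr n.2⟩} := by
        ext s
        simp [Subtype.ext_iff]
      beta_reduce
      rw [this, stdMeasure_singleton_of_mem_discPart n.2]
      exact ENNReal.one_lt_top
  · refine eq_univ_of_forall fun s => ?_
    rcases s.2 with h | h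
    · exact mem_sUnion.2 ⟨_, mem_insert _ _, h⟩
    · exact mem_sUnion.2 ⟨_, Or.inr ⟨⟨s, h⟩, rfl⟩, rfl⟩

/-- Such a set is kept out of the almost everywhere isomorphism, so that the leftover null sets on
both sides are uncountable and therefore Borel isomorphic. -/
theorem exists_null_not_countable (I : Fin 2) (N : ℕ∞) :
    ∃ K : Set (StdSupport I N), MeasurableSet K ∧ stdMeasure I N K = 0 ∧ (I = 1 → ¬ K.Countable) := by
  refine ⟨(↑) ⁻¹' (cantorSet ∩ contPart I), measurable_subtype_coe
    (isClosed_cantorSet.measurableSet.inter (measurableSet_contPart I)), ?_, ?_⟩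
  · rw [stdMeasure_apply, image_preimage_eq_inter_range]
    have h1 : volume (cantorSet ∩ contPart I ∩ range ((↑) : StdSupport I N → ℝ) ∩ contPart I) = 0 :=
      measure_mono_null (fun x hx => hx.1.1.1) measure_cantorSet
    have h2 : cantorSet ∩ contPart I ∩ range ((↑) : StdSupport I N → ℝ) ∩ discPart N = ∅ :=
      eq_empty_of_forall_notMem fun x hx => notMem_contPart_of_mem_discPart hx.2 hx.1.1.2
    rw [h1, h2, measure_empty, add_zero]
  · rintro rfl hK
    refine not_countable_cantorSet (((hK.image (↑)).union
      ((countable_singleton (1 : ℝ)).insert 0)).mono fun x hx => ?_)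
    rcases eq_or_ne x 0 with rfl | h0
    · simp
    rcases eq_or_ne x 1 with rfl | h1
    · simp
    have hI := cantorSet_subset_unitInterval hx
    have hc : x ∈ contPart 1 := ⟨rfl, lt_of_le_of_ne hI.1 h0.symm, lt_of_le_of_ne hI.2 h1⟩
    exact Or.inl ⟨⟨x, Or.inl hc⟩, ⟨hx, hc⟩, rfl⟩

theorem countable_stdSupport (hI : I ≠ 1) : Countable (StdSupport I N) := by
  have h : (contPart I ∪ discPart N).Countable := by
    rw [contPart_eq_empty hI, empty_union]
    exact countable_discPart N
  exact h.to_subtype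

theorem not_countable_of_stdMeasure_compl_eq_zero {F : Set (StdSupport 1 N)}
    (hF : stdMeasure 1 N Fᶜ = 0) : ¬ F.Countable := by
  intro h
  have h1 : Ioo (0 : ℝ) 1 ⊆ (↑) '' F ∪ ((↑) '' Fᶜ ∩ contPart 1) := fun x hx => by
    have hc : x ∈ contPart 1 := ⟨rfl, hx⟩
    by_cases hxF : (⟨x, Or.inl hc⟩ : StdSupport 1 N) ∈ F
    · exact Or.inl ⟨_, hxF, rfl⟩
    · exact Or.inr ⟨⟨_, hxF, rfl⟩, hc⟩
  have h2 : volume ((↑) '' Fᶜ ∩ contPart 1) = 0 := by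
    rw [stdMeasure_apply] at hF
    exact (add_eq_zero.1 hF).1
  have h3 := measure_mono_null h1 (measure_union_null ((h.image _).measure_zero volume) h2)
  simp at h3

end StdMeasure

theorem exists_pointMap_stdSupport {T : Type*} {α : ℝ} (hα : 0 < α) {I₁ I₂ : Fin 2} {N₁ N₂ : ℕ∞}
    {f₁ : T → StdSupport I₁ N₁ → ℝ≥0} {f₂ : T → StdSupport I₂ N₂ → ℝ≥0}
    (h : NormsAgree α (stdMeasure I₁ N₁) (stdMeasure I₂ N₂) f₁ f₂)
    (hf₁ : ∀ t, f₁ t ∈ LPlus α (stdMeasure I₁ N₁)) (hf₂ : ∀ t, f₂ t ∈ LPlus α (stdMeasure I₂ N₂))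
    (hmin₁ : IsMinimal α (stdMeasure I₁ N₁) f₁) (hmin₂ : IsMinimal α (stdMeasure I₂ N₂) f₂) :
    ∃ (Φ : StdSupport I₂ N₂ ≃ᵐ StdSupport I₁ N₁) (w : StdSupport I₂ N₂ → ℝ≥0),
      IsPointMapRelation α (stdMeasure I₁ N₁) (stdMeasure I₂ N₂) f₁ f₂ Φ w := by
  obtain ⟨K₁, hK₁, hKn₁, hKc₁⟩ := exists_null_not_countable I₁ N₁
  obtain ⟨K₂, hK₂, hKn₂, hKc₂⟩ := exists_null_not_countable I₂ N₂
  refine exists_pointMap hα h hf₁ hf₂ hmin₁ hmin₂ hK₁ hK₂ hKn₁ hKn₂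
    fun F₁ F₂ hF₁ hF₂ hFK₁ hFK₂ hn₁ hn₂ e => ?_
  by_cases hI₁ : I₁ = 1 <;> by_cases hI₂ : I₂ = 1
  -- Both leftovers contain an uncountable `K`, and uncountable standard Borel spaces are
  -- isomorphic.
  · have := hF₁.compl.standardBorel
    have := hF₂.compl.standardBorel
    refine ⟨PolishSpace.measurableEquivOfNotCountable (fun hc => ?_) fun hc => ?_⟩
    · exact hKc₂ hI₂ ((countable_coe_iff.1 hc).mono (subset_compl_comm.1 hFK₂))
    · exact hKc₁ hI₁ ((countable_coe_iff.1 hc).mono (subset_compl_comm.1 hFK₁))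
  · subst hI₁
    have := countable_stdSupport (N := N₂) hI₂
    exact absurd (countable_coe_iff.1 e.symm.injective.countable)
      (not_countable_of_stdMeasure_compl_eq_zero hn₁)
  · subst hI₂
    have := countable_stdSupport (N := N₁) hI₁
    exact absurd (countable_coe_iff.1 e.injective.countable)
      (not_countable_of_stdMeasure_compl_eq_zero hn₂)
  -- Without continuous part every point has mass `1`, so the null leftovers are empty.
  · have h₁ : IsEmpty ↥F₁ᶜ := ⟨fun s => by
      simpa [contPart_eq_empty hI₁] using mem_contPart_of_stdMeasure_eq_zero hn₁ s.2⟩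
    have h₂ : IsEmpty ↥F₂ᶜ := ⟨fun s => by
      simpa [contPart_eq_empty hI₂] using mem_contPart_of_stdMeasure_eq_zero hn₂ s.2⟩
    exact ⟨⟨Equiv.equivOfIsEmpty _ _, measurable_of_empty _, measurable_of_empty _⟩⟩

/-! ### Atoms under a point map. -/

section PointMap

variable {T : Type*} {α : ℝ} {I₁ I₂ : Fin 2} {N₁ N₂ : ℕ∞}
  {f₁ : T → StdSupport I₁ N₁ → ℝ≥0} {f₂ : T → StdSupport I₂ N₂ → ℝ≥0}
  {Φ : StdSupport I₂ N₂ → StdSupport I₁ N₁} {w : StdSupport I₂ N₂ → ℝ≥0}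

/-- Since the weight is positive and finite, this mass formula makes `Φ` match atoms with atoms; as
all atoms have mass `1`, the weight there is `1`. -/
theorem IsPointMapRelation.stdMeasure_singleton
    (h : IsPointMapRelation α (stdMeasure I₁ N₁) (stdMeasure I₂ N₂) f₁ f₂ Φ w)
    (s : StdSupport I₂ N₂) :
    stdMeasure I₁ N₁ {Φ s} = (w s : ℝ≥0∞) ^ α * stdMeasure I₂ N₂ {s} := by
  have h1 := congrArg (fun m : Measure (StdSupport I₂ N₂) => m {s}) h.comap_eq
  simp only [h.measurableEmbedding.comap_apply, image_singleton] at h1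
  rw [h1, withDensity_apply _ (measurableSet_singleton s), lintegral_singleton]

theorem IsPointMapRelation.mem_contPart_iff
    (h : IsPointMapRelation α (stdMeasure I₁ N₁) (stdMeasure I₂ N₂) f₁ f₂ Φ w)
    {s : StdSupport I₂ N₂} : (Φ s : ℝ) ∈ contPart I₁ ↔ (s : ℝ) ∈ contPart I₂ := by
  have hw : (w s : ℝ≥0∞) ^ α ≠ 0 :=
    (ENNReal.rpow_pos (by exact_mod_cast h.weight_pos s) ENNReal.coe_ne_top).ne'
  rw [← stdMeasure_singleton_eq_zero_iff, ← stdMeasure_singleton_eq_zero_iff,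
    h.stdMeasure_singleton, mul_eq_zero]
  simp [hw]

theorem mem_discPart_iff {I : Fin 2} {N : ℕ∞} {s : StdSupport I N} :
    (s : ℝ) ∈ discPart N ↔ (s : ℝ) ∉ contPart I :=
  ⟨notMem_contPart_of_mem_discPart, fun h => s.2.resolve_left h⟩

theorem IsPointMapRelation.mem_discPart_iff
    (h : IsPointMapRelation α (stdMeasure I₁ N₁) (stdMeasure I₂ N₂) f₁ f₂ Φ w)
    {s : StdSupport I₂ N₂} : (Φ s : ℝ) ∈ discPart N₁ ↔ (s : ℝ) ∈ discPart N₂ := by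
  rw [MaxStable.mem_discPart_iff, MaxStable.mem_discPart_iff, h.mem_contPart_iff]

theorem IsPointMapRelation.weight_eq_one (hα : 0 < α)
    (h : IsPointMapRelation α (stdMeasure I₁ N₁) (stdMeasure I₂ N₂) f₁ f₂ Φ w)
    {s : StdSupport I₂ N₂} (hs : (s : ℝ) ∈ discPart N₂) : w s = 1 := by
  have h1 := h.stdMeasure_singleton s
  rw [stdMeasure_singleton_of_mem_discPart hs,
    stdMeasure_singleton_of_mem_discPart (h.mem_discPart_iff.2 hs), mul_one] at h1
  refine rpow_coe_injective hα ?_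
  rw [← h1]
  simp

end PointMap

theorem encard_discPart (N : ℕ∞) : (discPart N).encard = N := by
  have h : discPart N = (fun n : ℕ => (n : ℝ)) '' {n : ℕ | 1 ≤ n ∧ (n : ℕ∞) ≤ N} := by
    ext x
    constructor
    · rintro ⟨n, h1, h2, rfl⟩
      exact ⟨n, ⟨h1, h2⟩, rfl⟩
    · rintro ⟨n, ⟨h1, h2⟩, rfl⟩
      exact ⟨n, h1, h2, rfl⟩
  rw [h, Nat.cast_injective.encard_image]
  induction N using ENat.recTopCoe with
  | top =>
    simp only [le_top, and_true]
    exact (show {n : ℕ | 1 ≤ n}.Infinite from Set.Ici_infinite 1).encard_eq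
  | coe n =>
    have : {m : ℕ | 1 ≤ m ∧ (m : ℕ∞) ≤ n} = ↑(Finset.Icc 1 n) := by
      ext m
      simp
    rw [this, encard_coe_eq_coe_finsetCard]
    simp

/-- A bijection that preserves membership in two sets of reals restricts to them. -/
def restrictEquiv {A B A' B' : Set ℝ} (Φ : A ≃ B) (hA : A' ⊆ A) (hB : B' ⊆ B)
    (h : ∀ s : A, (Φ s : ℝ) ∈ B' ↔ (s : ℝ) ∈ A') : A' ≃ B' where
  toFun s := ⟨Φ ⟨s, hA s.2⟩, (h _).2 s.2⟩
  invFun s := ⟨Φ.symm ⟨s, hB s.2⟩, (h _).1 (by simp)⟩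
  left_inv s := by simp
  right_inv s := by simp

theorem IsPointMapRelation.eq_and_eq {T : Type*} {α : ℝ} {I₁ I₂ : Fin 2} {N₁ N₂ : ℕ∞}
    {f₁ : T → StdSupport I₁ N₁ → ℝ≥0} {f₂ : T → StdSupport I₂ N₂ → ℝ≥0}
    {Φ : StdSupport I₂ N₂ ≃ᵐ StdSupport I₁ N₁} {w : StdSupport I₂ N₂ → ℝ≥0}
    (h : IsPointMapRelation α (stdMeasure I₁ N₁) (stdMeasure I₂ N₂) f₁ f₂ Φ w) :
    I₁ = I₂ ∧ N₁ = N₂ := by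
  constructor
  · have e : contPart I₂ ≃ contPart I₁ := restrictEquiv Φ.toEquiv subset_union_left
      subset_union_left fun s => h.mem_contPart_iff
    have key : ∀ I : Fin 2, Nonempty (contPart I) ↔ I = 1 := fun I => by
      refine ⟨fun ⟨x⟩ => x.2.1, ?_⟩
      rintro rfl
      exact ⟨⟨1 / 2, rfl, by norm_num, by norm_num⟩⟩
    have h1 : I₁ = 1 ↔ I₂ = 1 := by rw [← key, ← key, e.nonempty_congr]
    omega
  · rw [← encard_discPart N₁, ← encard_discPart N₂]
    exact (encard_congr (restrictEquiv Φ.toEquiv subset_union_right subset_union_right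
      fun s => h.mem_discPart_iff)).symm

/-! ### The restriction of the point map to `(0, 1)` and to the integers. -/

section Continuous

variable {N : ℕ∞}

/-- The inclusion of `(0, 1)` into `S_{1,N}`. -/
def inclusionIoo (N : ℕ∞) (x : Ioo (0 : ℝ) 1) : StdSupport 1 N := ⟨x, Or.inl ⟨rfl, x.2⟩⟩

theorem measurableEmbedding_inclusionIoo : MeasurableEmbedding (inclusionIoo N) := by
  have := (measurableSet_Ioo (a := (0 : ℝ)) (b := 1)).standardBorel
  exact (measurable_subtype_coe.subtype_mk).measurableEmbedding
    fun x y h => Subtype.ext (congrArg (fun z : StdSupport 1 N => (z : ℝ)) h)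

theorem comap_inclusionIoo : (stdMeasure 1 N).comap (inclusionIoo N) = lebesgue := by
  ext A -
  rw [measurableEmbedding_inclusionIoo.comap_apply, stdMeasure_apply, lebesgue,
    (MeasurableEmbedding.subtype_coe measurableSet_Ioo).comap_apply, image_image]
  have h : ∀ x ∈ (fun x => (inclusionIoo N x : ℝ)) '' A, x ∈ contPart 1 := by
    rintro _ ⟨x, -, rfl⟩
    exact ⟨rfl, x.2⟩
  have h' : (fun x => (inclusionIoo N x : ℝ)) '' A ∩ discPart N = ∅ :=
    eq_empty_of_forall_notMem fun x hx => notMem_contPart_of_mem_discPart hx.2 (h x hx.1)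
  rw [inter_eq_left.2 h, h', measure_empty, add_zero]
  rfl

theorem map_inclusionIoo :
    lebesgue.map (inclusionIoo N) = (stdMeasure 1 N).restrict (range (inclusionIoo N)) := by
  rw [← comap_inclusionIoo (N := N), measurableEmbedding_inclusionIoo.map_comap]

theorem ae_stdMeasure_of_ae_lebesgue {p : Ioo (0 : ℝ) 1 → Prop} (hp : ∀ᵐ x ∂lebesgue, p x) :
    ∀ᵐ s : StdSupport 1 N ∂stdMeasure 1 N, ∀ hs : (s : ℝ) ∈ Ioo (0 : ℝ) 1, p ⟨s, hs⟩ := by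
  have h : ∀ᵐ s : StdSupport 1 N ∂lebesgue.map (inclusionIoo N), ∀ hs : (s : ℝ) ∈ Ioo (0 : ℝ) 1, p ⟨s, hs⟩ := by
    rw [measurableEmbedding_inclusionIoo.ae_map_iff]
    filter_upwards [hp] with x hx _
    exact hx
  rw [map_inclusionIoo, ae_restrict_iff' measurableEmbedding_inclusionIoo.measurableSet_range] at h
  filter_upwards [h] with s hs hs'
  exact hs ⟨⟨s, hs'⟩, rfl⟩ hs'

instance : SigmaFinite lebesgue := by
  refine @IsFiniteMeasure.toSigmaFinite _ _ _ ⟨?_⟩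
  rw [lebesgue, (MeasurableEmbedding.subtype_coe measurableSet_Ioo).comap_apply, image_univ,
    Subtype.range_coe]
  simp

variable {T : Type*} {α : ℝ} {f₁ f₂ : T → StdSupport 1 N → ℝ≥0}
  {Φ : StdSupport 1 N ≃ᵐ StdSupport 1 N} {w : StdSupport 1 N → ℝ≥0}

theorem IsPointMapRelation.comap_lebesgue
    (h : IsPointMapRelation α (stdMeasure 1 N) (stdMeasure 1 N) f₁ f₂ Φ w)
    {Φc : Ioo (0 : ℝ) 1 ≃ᵐ Ioo (0 : ℝ) 1}
    (hΦc : ∀ x, inclusionIoo N (Φc x) = Φ (inclusionIoo N x)) :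
    lebesgue.comap Φc = lebesgue.withDensity fun x => (w (inclusionIoo N x) : ℝ≥0∞) ^ α := by
  ext A hA
  have hι := measurableEmbedding_inclusionIoo (N := N)
  rw [Φc.measurableEmbedding.comap_apply, withDensity_apply _ hA]
  conv_lhs => rw [← comap_inclusionIoo (N := N)]
  rw [hι.comap_apply, image_image]
  simp only [hΦc]
  rw [← image_image (g := Φ) (f := inclusionIoo N), ← Φ.measurableEmbedding.comap_apply, h.comap_eq,
    withDensity_apply _ (hι.measurableSet_image.2 hA)]
  have h1 : (stdMeasure 1 N).restrict (inclusionIoo N '' A) =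
      (lebesgue.restrict A).map (inclusionIoo N) := by
    have : A = inclusionIoo N ⁻¹' (inclusionIoo N '' A) := (hι.injective.preimage_image A).symm
    conv_rhs => rw [this]
    rw [← hι.restrict_map, map_inclusionIoo, Measure.restrict_restrict
      (hι.measurableSet_image.2 hA), inter_eq_left.2 (image_subset_range _ _)]
  rw [h1, hι.lintegral_map]

theorem IsPointMapRelation.exists_measurableEquiv_Ioo (hα : 0 < α)
    (h : IsPointMapRelation α (stdMeasure 1 N) (stdMeasure 1 N) f₁ f₂ Φ w) :
    ∃ Φc : Ioo (0 : ℝ) 1 ≃ᵐ Ioo (0 : ℝ) 1,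
      (∀ (s : StdSupport 1 N) (hs : (s : ℝ) ∈ Ioo (0 : ℝ) 1), (Φ s : ℝ) = Φc ⟨s, hs⟩) ∧
      lebesgue.comap Φc ≪ lebesgue ∧
      ∀ f ∈ LPlus α lebesgue,
        weightedComp Φ w (extendZero (Ioo (0 : ℝ) 1) f) =ᵐ[stdMeasure 1 N]
          extendZero (Ioo (0 : ℝ) 1) fun s =>
            (((lebesgue.comap Φc).rnDeriv lebesgue s) ^ (1 / α)).toNNReal * f (Φc s) := by
  have hmem : ∀ s, (Φ s : ℝ) ∈ Ioo (0 : ℝ) 1 ↔ (s : ℝ) ∈ Ioo (0 : ℝ) 1 := fun s => by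
    simpa [contPart] using h.mem_contPart_iff (s := s)
  have hsub : Ioo (0 : ℝ) 1 ⊆ contPart 1 ∪ discPart N := contPart_one ▸ subset_union_left
  let Φc : Ioo (0 : ℝ) 1 ≃ᵐ Ioo (0 : ℝ) 1 :=
    { restrictEquiv Φ.toEquiv hsub hsub hmem with
      measurable_toFun := (measurable_subtype_coe.comp
        (Φ.measurable.comp (measurable_subtype_coe.subtype_mk))).subtype_mk
      measurable_invFun := (measurable_subtype_coe.comp
        (Φ.symm.measurable.comp (measurable_subtype_coe.subtype_mk))).subtype_mk }
  have hcomap := h.comap_lebesgue (Φc := Φc) fun x => Subtype.ext rfl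
  refine ⟨Φc, fun s hs => rfl, hcomap ▸ withDensity_absolutelyContinuous _ _, fun f _ => ?_⟩
  -- On `(0, 1)` the Radon–Nikodym derivative is `w ^ α`, so its power `1 / α` gives back the
  -- weight.
  have hrn : (lebesgue.comap Φc).rnDeriv lebesgue =ᵐ[lebesgue]
      fun x => (w (inclusionIoo N x) : ℝ≥0∞) ^ α := by
    rw [hcomap]
    exact Measure.rnDeriv_withDensity _ ((h.measurable_weight.comp
      measurableEmbedding_inclusionIoo.measurable).coe_nnreal_ennreal.pow_const α)
  filter_upwards [ae_stdMeasure_of_ae_lebesgue (N := N) hrn] with s hs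
  by_cases hs' : (s : ℝ) ∈ Ioo (0 : ℝ) 1
  · have h1 := hs hs'
    rw [weightedComp, extendZero, dif_pos ((hmem s).2 hs'), extendZero, dif_pos hs', h1,
      ← ENNReal.rpow_mul, mul_one_div_cancel hα.ne', ENNReal.rpow_one, ENNReal.toNNReal_coe]
    rfl
  · rw [weightedComp, extendZero, dif_neg (mt (hmem s).1 hs'), extendZero, dif_neg hs', mul_zero]

end Continuous

theorem IsPointMapRelation.exists_perm_discPart {T : Type*} {α : ℝ} {I : Fin 2} {N : ℕ∞}
    {f₁ f₂ : T → StdSupport I N → ℝ≥0} {Φ : StdSupport I N ≃ᵐ StdSupport I N}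
    {w : StdSupport I N → ℝ≥0} (hα : 0 < α)
    (h : IsPointMapRelation α (stdMeasure I N) (stdMeasure I N) f₁ f₂ Φ w) :
    ∃ Φd : Equiv.Perm (discPart N),
      (∀ (s : StdSupport I N) (hs : (s : ℝ) ∈ discPart N), (Φ s : ℝ) = Φd ⟨s, hs⟩) ∧
      ∀ f : discPart N → ℝ≥0, weightedComp Φ w (extendZero (discPart N) f) =
        extendZero (discPart N) fun n => f (Φd n) := by
  refine ⟨restrictEquiv Φ.toEquiv subset_union_right subset_union_right
    fun s => h.mem_discPart_iff, fun s hs => rfl, fun f => ?_⟩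
  funext s
  by_cases hs : (s : ℝ) ∈ discPart N
  · rw [weightedComp, extendZero, dif_pos (h.mem_discPart_iff.2 hs), extendZero, dif_pos hs,
      h.weight_eq_one hα hs, one_mul]
    rfl
  · rw [weightedComp, extendZero, dif_neg (mt h.mem_discPart_iff.1 hs), extendZero, dif_neg hs,
      mul_zero]

end MaxStable

end

/-! ### Assembly of the theorem. -/

theorem corollary4p2 {T Ω Ω₁ Ω₂ : Type*}
    [MeasurableSpace Ω] [MeasurableSpace Ω₁] [MeasurableSpace Ω₂]
    (P : Measure Ω) [IsProbabilityMeasure P]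
    (P₁ : Measure Ω₁) [IsProbabilityMeasure P₁]
    (P₂ : Measure Ω₂) [IsProbabilityMeasure P₂]
    (α : ℝ) (hα : 0 < α) (X : T → Ω → ℝ)
    (I₁ I₂ : Fin 2) (N₁ N₂ : ℕ∞)
    (M₁ : Set (StdSupport I₁ N₁) → Ω₁ → ℝ≥0∞)
    (hM₁ : IsFrechetSupMeasure α (stdMeasure I₁ N₁) P₁ M₁)
    (M₂ : Set (StdSupport I₂ N₂) → Ω₂ → ℝ≥0∞)
    (hM₂ : IsFrechetSupMeasure α (stdMeasure I₂ N₂) P₂ M₂)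
    (f₁ : T → StdSupport I₁ N₁ → ℝ≥0)
    (hf₁ : IsSpectralRepresentation α P X (stdMeasure I₁ N₁) P₁ M₁ f₁)
    (hmin₁ : IsMinimal α (stdMeasure I₁ N₁) f₁)
    (f₂ : T → StdSupport I₂ N₂ → ℝ≥0)
    (hf₂ : IsSpectralRepresentation α P X (stdMeasure I₂ N₂) P₂ M₂ f₂)
    (hmin₂ : IsMinimal α (stdMeasure I₂ N₂) f₂) :
    I₁ = I₂ ∧ N₁ = N₂ ∧
    ∃ U : (StdSupport I₁ N₁ → ℝ≥0) → (StdSupport I₂ N₂ → ℝ≥0),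
      -- `U` is a max-linear isometry on all of `L₊^α` with `U f_t⁽¹⁾ = f_t⁽²⁾`
      IsRelatingIsometryOn α (stdMeasure I₁ N₁) (stdMeasure I₂ N₂) f₁ f₂
        (LPlus α (stdMeasure I₁ N₁)) U ∧
      -- `U` extends the relating isometry of the closed max-linear spans
      (∀ V, IsRelatingIsometryOn α (stdMeasure I₁ N₁) (stdMeasure I₂ N₂) f₁ f₂
          (closedMaxSpan α (stdMeasure I₁ N₁) f₁) V →
        ∀ f ∈ closedMaxSpan α (stdMeasure I₁ N₁) f₁, V f =ᵐ[stdMeasure I₂ N₂] U f) ∧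
      -- and is the only such max-linear isometry on `L₊^α`
      (∀ V, IsRelatingIsometryOn α (stdMeasure I₁ N₁) (stdMeasure I₂ N₂) f₁ f₂
          (LPlus α (stdMeasure I₁ N₁)) V →
        ∀ f ∈ LPlus α (stdMeasure I₁ N₁), V f =ᵐ[stdMeasure I₂ N₂] U f) ∧
      -- `U` is onto
      (∀ g ∈ LPlus α (stdMeasure I₂ N₂), ∃ f ∈ LPlus α (stdMeasure I₁ N₁),
        U f =ᵐ[stdMeasure I₂ N₂] g) ∧
      -- `U` is given by a point map `Φ` and a weight `h`, unique modulo null sets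
      ∃ (Φ : StdSupport I₂ N₂ → StdSupport I₁ N₁) (h : StdSupport I₂ N₂ → ℝ≥0),
        IsPointMapRelation α (stdMeasure I₁ N₁) (stdMeasure I₂ N₂) f₁ f₂ Φ h ∧
        (∀ f ∈ LPlus α (stdMeasure I₁ N₁),
          U f =ᵐ[stdMeasure I₂ N₂] fun s => h s * f (Φ s)) ∧
        (∀ Φ' h', IsPointMapRelation α (stdMeasure I₁ N₁) (stdMeasure I₂ N₂) f₁ f₂ Φ' h' →
          Φ' =ᵐ[stdMeasure I₂ N₂] Φ ∧ h' =ᵐ[stdMeasure I₂ N₂] h) ∧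
        -- on the continuous part, `U` is a weighted composition operator
        (I₁ = 1 → ∃ Φc : Ioo (0 : ℝ) 1 ≃ᵐ Ioo (0 : ℝ) 1,
          (∀ (s : StdSupport I₂ N₂) (hs : (s : ℝ) ∈ Ioo (0 : ℝ) 1),
            ((Φ s : StdSupport I₁ N₁) : ℝ) = Φc ⟨s, hs⟩) ∧
          lebesgue.comap Φc ≪ lebesgue ∧
          ∀ f ∈ LPlus α lebesgue,
            U (extendZero (Ioo (0 : ℝ) 1) f) =ᵐ[stdMeasure I₂ N₂]
              extendZero (Ioo (0 : ℝ) 1) fun s =>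
                (((lebesgue.comap Φc).rnDeriv lebesgue s) ^ (1 / α)).toNNReal * f (Φc s)) ∧
        -- on the discrete part, `U` is the composition with a permutation
        (N₁ ≠ 0 → ∃ Φd : Equiv.Perm (discPart N₁),
          (∀ (s : StdSupport I₂ N₂) (hs : (s : ℝ) ∈ discPart N₁),
            ((Φ s : StdSupport I₁ N₁) : ℝ) = Φd ⟨s, hs⟩) ∧
          ∀ f ∈ LPlus α (Measure.count : Measure (discPart N₁)),
            U (extendZero (discPart N₁) f) =ᵐ[stdMeasure I₂ N₂]
              extendZero (discPart N₁) fun n => f (Φd n)) := by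
  -- The process and the sup-measures enter only through this equality of norms; the rest is measure
  -- theory of the two families.
  have hN := NormsAgree.of_spectral hα hf₁ hM₁ hf₂ hM₂
  obtain ⟨Φ, w, hΦ⟩ := exists_pointMap_stdSupport hα hN hf₁.1 hf₂.1 hmin₁ hmin₂
  obtain ⟨rfl, rfl⟩ := hΦ.eq_and_eq
  have hU := hΦ.isRelatingIsometryOn hα
  refine ⟨rfl, rfl, weightedComp Φ w, hU,
    fun V hV f hf => hV.ae_eq_of_mem_closedMaxSpan hα hf₁.1
      (hU.mono (closedMaxSpan_subset_LPlus f₁)) hf,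
    fun V hV f hf => hV.ae_eq_weightedComp hα hΦ hf₁.1 hmin₁ hf,
    fun g hg => ?_, Φ, w, hΦ, fun f _ => Filter.EventuallyEq.rfl,
    fun Φ' w' h' => hΦ.unique hα h' (fun t => (hf₁.1 t).1) hmin₁, ?_, fun _ => ?_⟩
  · obtain ⟨f, hf, rfl⟩ := hΦ.exists_preimage hα hg
    exact ⟨f, hf, Filter.EventuallyEq.rfl⟩
  · rintro rfl
    exact hΦ.exists_measurableEquiv_Ioo hα
  · obtain ⟨Φd, h1, h2⟩ := hΦ.exists_perm_discPart hα
    exact ⟨Φd, h1, fun f _ => (h2 f).eventuallyEq⟩
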